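/- Let $(M,g)$ be a smooth connected Riemannian manifold without boundary, with Riemannian measure $\nu$, and let $m:M\to[0,\infty)$ be a Morse function such that all preimages $m^{-1}([0,b])$ are compact. Fix $1\le p\le\infty$ and $\delta>0$. A window $[\vartheta-\delta,\vartheta+\delta]$ is called regular if it consists of values of $m$ that are not critical values. *The operators.* Let $s:\mathbb R\to[0,1]$ be a smooth function with $\operatorname{supp}s\subset(-\delta,\infty)$ and $s^2(t)+s^2(-t)=1$ for all $t$ (a different $s$ is allowed for each cut-off). For a regular window around $\vartheta$ put $I=(\vartheta-\delta,\vartheta+\delta)$ and $J_\vartheta=m^{-1}(\vartheta)$. Let $F_\vartheta:I\times J_\vartheta\to m^{-1}(I)$ be the parametrization for which $t\mapsto F_\vartheta(t,x)$ is the integral curve of $\operatorname{grad}m/|\operatorname{grad}m|^2$ with $F_\vartheta(\vartheta,x)=x$, and let $\psi=|\det DF_\vartheta|$ be its Jacobian determinant with respect to the Riemannian structures of $I\times J_\vartheta$ and $M$. The operator $E_\vartheta$ acts on $f:M\to\mathbb R$ by $E_\vartheta f(y)=f(y)$ if $m(y)\ge\vartheta+\delta$, $E_\vartheta f(y)=0$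 if $m(y)\le\vartheta-\delta$, and, for $y=F_\vartheta(t,x)$ with $(t,x)\in I\times J_\vartheta$, $$E_\vartheta f(y)=s^2(t-\vartheta)f(F_\vartheta(t,x))+s(t-\vartheta)s(\vartheta-t)\Big(\tfrac{\psi(2\vartheta-t,x)}{\psi(t,x)}\Big)^{1/p}f(F_\vartheta(2\vartheta-t,x)).$$ Put $E_0=\mathbf I$ and $Q_{\vartheta_1,\vartheta_2}=E_{\vartheta_1}-E_{\vartheta_2}$. Let $B_p=\sup_{0\le\xi\le1}\|A_\xi\|_{\ell^p\to\ell^p}$, where $A_\xi=\begin{pmatrix}\xi&\sqrt{\xi(1-\xi)}\\ \sqrt{\xi(1-\xi)}&1-\xi\end{pmatrix}$. *Hestenes operators.* A simple $H$-operator is $f\mapsto\varphi\cdot(f\circ\Phi)$ on $V$, extended by $0$, where $\Phi:V\to V'$ is a $C^\infty$ diffeomorphism between open subsets of $M$ and $\varphi\in C_c^\infty(M)$ has $\operatorname{supp}\varphi\subset V$. An operator on $C_0(M)$ is an $H$-operator localized on an open set $U$ if it is a finite linear combination of simple $H$-operators with $V,V'\subset U$. A family $\{P_i\}$ is a smooth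 decomposition of identity in $L^p(M)$, $1\le p<\infty$, subordinate to an open precompact cover $\{U_i\}$ of $M$ if: it is locally finite (for compact $K$, only finitely many $i$ with $U_i\cap K\neq\emptyset$ have $P_i\ne0$); each $P_i$ is an $H$-operator localized on $U_i$; each $P_i$ extends to a projection on $L^p(M)$; $P_iP_j=0$ for $i\ne j$; $\sum_iP_i=\mathbf I$ unconditionally in the strong operator topology; and there is $C>0$ (with $C=1$ if $p=2$) such that $C^{-1}\|f\|_p\le(\sum_i\|P_if\|_p^p)^{1/p}\le C\|f\|_p$ for all $f\in L^p(M)$. In $C_0(M)$ the definition is the same, with the last condition replaced by $(\|P_if\|_\infty)_i\in c_0$ and $C^{-1}\|f\|_\infty\le\sup_i\|P_if\|_\infty\le C\|f\|_\infty$. **(A) Latitudinal projections.** Let $m(M)=[0,\infty)$ or $m(M)=[0,1]$. Let $\vartheta_1+\delta<\vartheta_2-\delta$, let the window around $\vartheta_2$ be regular, and let either $\vartheta_1=0$ or the window around $\vartheta_1$ be regular. Then $E_{\vartheta_2}E_{\vartheta_1}=E_{\vartheta_1}E_{\vartheta_2}=E_{\vartheta_2}$. The operator $Q=Q_{\vartheta_1,\vartheta_2}$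 is an $H$-operator localized on $m^{-1}(\vartheta_1-\delta,\vartheta_2+\delta)$, and $Qf(x)$ equals $0$ if $m(x)\le\vartheta_1-\delta$ or $m(x)\ge\vartheta_2+\delta$; $E_{\vartheta_1}f(x)$ if $|m(x)-\vartheta_1|<\delta$; $f(x)$ if $\vartheta_1+\delta\le m(x)\le\vartheta_2-\delta$; and $f(x)-E_{\vartheta_2}f(x)$ if $|m(x)-\vartheta_2|<\delta$. On $L^p(M)$, $Q$ is a projection whose norm is $B_p$, which is also the norm on $L^p(\mathbb R)$ of every one-dimensional operator $h\mapsto s^2(t-\vartheta)h(t)\pm s(t-\vartheta)s(\vartheta-t)h(2\vartheta-t)$. If $p=2$, this projection is orthogonal. If $p=\infty$, the same holds on $C_0(M)$ and $C_0(\mathbb R)$. **(B) Non-compact case.** Let $M$ be non-compact and $m(M)=[0,\infty)$. Let $0=\vartheta_0<\vartheta_1<\cdots$ satisfy $\vartheta_i+\delta<\vartheta_{i+1}-\delta$ for $i\ge0$, with regular windows around $\vartheta_i$ for $i\ge1$. If $p<\infty$, then $\{Q_{\vartheta_i,\vartheta_{i+1}}\}_{i\ge0}$ is a smooth decomposition of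 identity in $L^p(M)$ subordinate to the cover $\{m^{-1}(\vartheta_i-\delta,\vartheta_{i+1}+\delta)\}_{i\ge0}$; in particular $\sum_iQ_{\vartheta_i,\vartheta_{i+1}}=\mathbf I$ unconditionally in the strong operator topology, and $$2^{1/p-1}\|f\|_p\le\Big(\sum_{i}\|Q_{\vartheta_i,\vartheta_{i+1}}f\|_p^p\Big)^{1/p}\le2^{1/p}B_p\|f\|_p\qquad\text{for all }f\in L^p(M).$$ If $p=2$, the $Q_{\vartheta_i,\vartheta_{i+1}}$ are orthogonal projections, so that they form an orthogonal decomposition of the identity on $L^2(M)$. If $p=\infty$, they form a smooth decomposition of identity in $C_0(M)$, with $\frac12\|f\|_\infty\le\sup_i\|Q_{\vartheta_i,\vartheta_{i+1}}f\|_\infty\le B_\infty\|f\|_\infty$. **(C) Compact case.** Let $M$ be compact and $m(M)=[0,1]$. Let $0=\vartheta_0<\cdots<\vartheta_n=1$ satisfy $\vartheta_i+\delta<\vartheta_{i+1}-\delta$ for $0\le i<n$, with regular windows around $\vartheta_i$ for $1\le i\le n-1$, and put $E_1=\mathbf 0$. Then all conclusions of (B) hold for $\{Q_{\vartheta_i,\vartheta_{i+1}}\}_{i=0}^{n-1}$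 and the cover $\{m^{-1}(\vartheta_i-\delta,\vartheta_{i+1}+\delta)\}_{i=0}^{n-1}$, with the same constants and with $C(M)$ in place of $C_0(M)$; in particular the universal decomposition constant $C=3$ is admissible. -/

import Mathlib

open MeasureTheory Manifold Bundle Set Filter Topology
open scoped ENNReal ContDiff ZeroAtInfty

noncomputable section

namespace Latitudinal

/-! ### Operators on function spaces induced by formulas -/

/-- The operator `T` on `C₀(X)` acts by the formula `A`. -/
def InducesC0 {X : Type*} [TopologicalSpace X] (A : (X → ℝ) → X → ℝ)
    (T : C₀(X, ℝ) →L[ℝ] C₀(X, ℝ)) : Prop :=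
  ∀ f : C₀(X, ℝ), ⇑(T f) = A f

/-- The operator `P` on `L^p(ν)` acts by the formula `A`, on every representative of every class. -/
def InducesLp {X : Type*} [MeasurableSpace X] {ν : Measure X} {p : ℝ≥0∞} [Fact (1 ≤ p)]
    (A : (X → ℝ) → X → ℝ) (P : Lp ℝ p ν →L[ℝ] Lp ℝ p ν) : Prop :=
  ∀ (f : X → ℝ) (hf : MemLp f p ν), P (hf.toLp f) =ᵐ[ν] A f

/-- `P` is symmetric for the inner product `⟨f, h⟩ = ∫ f h dν` when `p = 2`. -/
def IsSymmetricL2 {X : Type*} [MeasurableSpace X] {ν : Measure X} {p : ℝ≥0∞} [Fact (1 ≤ p)]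
    (P : Lp ℝ p ν →L[ℝ] Lp ℝ p ν) : Prop :=
  ∀ f h : Lp ℝ p ν, ∫ x, P f x * h x ∂ν = ∫ x, f x * P h x ∂ν

/-! ### Smooth projections on the line and the constant `B_p` -/

/-- The cut-off profiles `s : ℝ → [0, 1]`: smooth, supported in `(-δ, ∞)`, and
`s(t)^2 + s(-t)^2 = 1`. -/
structure IsProfile (s : ℝ → ℝ) (δ : ℝ) : Prop where
  smooth : ContDiff ℝ ∞ s
  mem_Icc : ∀ t, s t ∈ Icc (0 : ℝ) 1
  tsupport_subset : tsupport s ⊆ Ioi (-δ)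
  sq_add_sq : ∀ t, s t ^ 2 + s (-t) ^ 2 = 1

/-- The Auscher-Weiss-Wickerhauser operator on the line with cut-off `ϑ`, profile `s` and
polarity `ε = ± 1`. -/
def awwLine (ε : ℝ) (s : ℝ → ℝ) (ϑ : ℝ) (h : ℝ → ℝ) (t : ℝ) : ℝ :=
  s (t - ϑ) ^ 2 * h t + ε * (s (t - ϑ) * s (ϑ - t) * h (2 * ϑ - t))

/-- The matrix `A_ξ`. -/
def awwMatrix (ξ : ℝ) : Matrix (Fin 2) (Fin 2) ℝ :=
  !![ξ, √(ξ * (1 - ξ)); √(ξ * (1 - ξ)), 1 - ξ]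

/-- The constant `B_p`: the supremum over `0 ≤ ξ ≤ 1` of the norm of `A_ξ` on `ℓ^p({1, 2})`. -/
def awwConst (p : ℝ≥0∞) [Fact (1 ≤ p)] : ℝ :=
  ⨆ ξ : Icc (0 : ℝ) 1, ‖LinearMap.toContinuousLinearMap (Matrix.toLpLin p p (awwMatrix ξ))‖

/-- All the operators `awwLine` (of both polarities) extend to `L^p(ℝ)` with norm `c`. -/
def AWWLineNormLp (p : ℝ≥0∞) [Fact (1 ≤ p)] (c : ℝ) : Prop :=
  ∀ (δ ϑ ε : ℝ) (s : ℝ → ℝ), 0 < δ → IsProfile s δ → (ε = 1 ∨ ε = -1) →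
    ∃ R : Lp ℝ p (volume : Measure ℝ) →L[ℝ] Lp ℝ p (volume : Measure ℝ),
      InducesLp (awwLine ε s ϑ) R ∧ ‖R‖ = c

/-- All the operators `awwLine` (of both polarities) act on `C₀(ℝ)` with norm `c`. -/
def AWWLineNormC0 (c : ℝ) : Prop :=
  ∀ (δ ϑ ε : ℝ) (s : ℝ → ℝ), 0 < δ → IsProfile s δ → (ε = 1 ∨ ε = -1) →
    ∃ R : C₀(ℝ, ℝ) →L[ℝ] C₀(ℝ, ℝ), InducesC0 (awwLine ε s ϑ) R ∧ ‖R‖ = c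

/-! ### Riemannian geometry -/

/-- The `k`-dimensional volume `√(det ⟪v i, v j⟫)` of the parallelepiped spanned by the `v i`. -/
def gramVolume {ι V : Type*} [Fintype ι] [DecidableEq ι] [Inner ℝ V] (v : ι → V) : ℝ :=
  √(Matrix.gram ℝ v).det

section Manifold

variable {d : ℕ} {M : Type*} [TopologicalSpace M] [ChartedSpace (EuclideanSpace ℝ (Fin d)) M]

/-- `x` is a critical point of `m`. -/
def IsCritical (m : M → ℝ) (x : M) : Prop := mfderiv (𝓡 d) 𝓘(ℝ, ℝ) m x = 0

/-- The Hessian of `m` at `x`, in the preferred chart at `x`. -/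
def chartHessian (m : M → ℝ) (x : M) :
    EuclideanSpace ℝ (Fin d) →L[ℝ] EuclideanSpace ℝ (Fin d) →L[ℝ] ℝ :=
  fderiv ℝ (fderiv ℝ (m ∘ (extChartAt (𝓡 d) x).symm)) (extChartAt (𝓡 d) x x)

/-- Morse functions: smooth functions all of whose critical points are nondegenerate. -/
structure IsMorse (m : M → ℝ) : Prop where
  smooth : ContMDiff (𝓡 d) 𝓘(ℝ, ℝ) ∞ m
  nondegenerate : ∀ x, IsCritical (d := d) m x →
    ∀ v, (∀ w, chartHessian (d := d) m x v w = 0) → v = 0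

/-- The closed window `[ϑ - δ, ϑ + δ]` consists of regular values of `m`: values that `m`
attains, and attains at no critical point. -/
def IsRegularWindow (d : ℕ) {M : Type*} [TopologicalSpace M]
    [ChartedSpace (EuclideanSpace ℝ (Fin d)) M] (m : M → ℝ) (ϑ δ : ℝ) : Prop :=
  ∀ t ∈ Icc (ϑ - δ) (ϑ + δ), t ∈ range m ∧ ∀ x, m x = t → ¬ IsCritical (d := d) m x

/-! ### Hestenes operators -/

/-- A simple Hestenes operator: `φ · (f ∘ Φ)` on the domain `V` of the smooth diffeomorphism
`Φ : V → V'` between open sets, where `φ` is smooth with compact support contained in `V`. -/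
structure SimpleH (d : ℕ) (M : Type*) [TopologicalSpace M]
    [ChartedSpace (EuclideanSpace ℝ (Fin d)) M] where
  φ : M → ℝ
  Φ : OpenPartialHomeomorph M M
  smooth_φ : ContMDiff (𝓡 d) 𝓘(ℝ, ℝ) ∞ φ
  hasCompactSupport : HasCompactSupport φ
  tsupport_subset : tsupport φ ⊆ Φ.source
  smooth_Φ : ContMDiffOn (𝓡 d) (𝓡 d) ∞ Φ Φ.source
  smooth_symm : ContMDiffOn (𝓡 d) (𝓡 d) ∞ Φ.symm Φ.target

open Classical in
/-- The action of a simple Hestenes operator on functions. -/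
def SimpleH.act (H : SimpleH d M) (f : M → ℝ) (x : M) : ℝ :=
  if x ∈ H.Φ.source then H.φ x * f (H.Φ x) else 0

/-- `T` is a Hestenes operator localized on `U`: a finite linear combination of simple Hestenes
operators with `V ⊆ U` and `Φ(V) ⊆ U`. -/
def IsLocalizedHOperator (d : ℕ) {M : Type*} [TopologicalSpace M]
    [ChartedSpace (EuclideanSpace ℝ (Fin d)) M] (T : C₀(M, ℝ) →L[ℝ] C₀(M, ℝ)) (U : Set M) : Prop :=
  ∃ (n : ℕ) (c : Fin n → ℝ) (H : Fin n → SimpleH d M),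
    (∀ k, (H k).Φ.source ⊆ U ∧ (H k).Φ.target ⊆ U) ∧
    ∀ (f : C₀(M, ℝ)) (x : M), T f x = ∑ k, c k * (H k).act f x

variable [IsManifold (𝓡 d) ∞ M] [RiemannianBundle (fun x : M ↦ TangentSpace (𝓡 d) x)]

instance instFiniteDimensionalTangent (x : M) : FiniteDimensional ℝ (TangentSpace (𝓡 d) x) :=
  inferInstanceAs (FiniteDimensional ℝ (EuclideanSpace ℝ (Fin d)))

instance instCompleteTangent (x : M) : CompleteSpace (TangentSpace (𝓡 d) x) :=
  FiniteDimensional.complete ℝ _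

/-- The part of the Riemannian measure in the preferred chart at `x₀`: the image under the inverse
chart of the measure with density `√(det g_ij)`, where `g_ij = ⟨∂_i, ∂_j⟩`. -/
def chartVolume [MeasurableSpace M] (x₀ : M) : Measure M :=
  (((volume : Measure (EuclideanSpace ℝ (Fin d))).restrict (extChartAt (𝓡 d) x₀).target).withDensity
    (fun y ↦ ENNReal.ofReal (gramVolume fun i : Fin d ↦
      mfderiv 𝓘(ℝ, EuclideanSpace ℝ (Fin d)) (𝓡 d) (extChartAt (𝓡 d) x₀).symm y
        (EuclideanSpace.basisFun (Fin d) ℝ i)))).map (extChartAt (𝓡 d) x₀).symm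

/-- The Riemannian measure. The measures `chartVolume x₀` are its restrictions to the chart
domains; they agree on overlaps and are glued by taking their least upper bound. -/
def riemannianVolume (d : ℕ) (M : Type*) [TopologicalSpace M]
    [ChartedSpace (EuclideanSpace ℝ (Fin d)) M] [IsManifold (𝓡 d) ∞ M]
    [RiemannianBundle (fun x : M ↦ TangentSpace (𝓡 d) x)] [MeasurableSpace M] : Measure M :=
  ⨆ x₀ : M, chartVolume (d := d) x₀

/-- The differential of `m` at `x`, with values in `ℝ`. -/
def dform (m : M → ℝ) (x : M) : TangentSpace (𝓡 d) x →L[ℝ] ℝ := mfderiv (𝓡 d) 𝓘(ℝ, ℝ) m x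

/-- The Riemannian gradient. -/
def grad (m : M → ℝ) (x : M) : TangentSpace (𝓡 d) x :=
  (InnerProductSpace.toDual ℝ (TangentSpace (𝓡 d) x)).symm (dform m x)

/-- The renormalized gradient field `X = grad m / |grad m|^2`. -/
def normGrad (m : M → ℝ) (x : M) : TangentSpace (𝓡 d) x :=
  (‖grad (d := d) m x‖ ^ 2)⁻¹ • grad (d := d) m x

open Classical in
/-- `levelFlow m I a b x` is the value at time `b` of the integral curve of `X` on the open
interval `I` that passes through `x` at time `a`. For `a, b ∈ I` and `x ∈ m⁻¹(a)` this is
`F_{a,b}(x) ∈ m⁻¹(b)`. -/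
def levelFlow (d : ℕ) {M : Type*} [TopologicalSpace M]
    [ChartedSpace (EuclideanSpace ℝ (Fin d)) M] [IsManifold (𝓡 d) ∞ M]
    [RiemannianBundle (fun x : M ↦ TangentSpace (𝓡 d) x)]
    (m : M → ℝ) (I : Set ℝ) (a b : ℝ) (x : M) : M :=
  if h : ∃ η : ℝ → M, η a = x ∧ IsMIntegralCurveOn (I := 𝓡 d) η (normGrad (d := d) m) I
  then h.choose b else x

/-- The weight `ψ(t, x) = |det DF(t, x)|` of the parametrization `F(t, x) = F_{ϑ,t}(x)` of
`m⁻¹(I)` by `I × J`, where `J = m⁻¹(ϑ)`. The determinant is computed on the orthonormal basis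
`∂_t, e_1, …, e_{d-1}` of `ℝ × T_x J`, where `T_x J` is the kernel of the differential of `m`. -/
def levelWeight (d : ℕ) {M : Type*} [TopologicalSpace M]
    [ChartedSpace (EuclideanSpace ℝ (Fin d)) M] [IsManifold (𝓡 d) ∞ M]
    [RiemannianBundle (fun x : M ↦ TangentSpace (𝓡 d) x)]
    (m : M → ℝ) (I : Set ℝ) (ϑ t : ℝ) (x : M) : ℝ :=
  let TJ : Submodule ℝ (TangentSpace (𝓡 d) x) :=
    LinearMap.ker (dform m x).toLinearMap
  let DF : Option (Fin (Module.finrank ℝ TJ)) → TangentSpace (𝓡 d) (levelFlow d m I ϑ t x) :=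
    fun k ↦ match k with
      | none => mfderiv 𝓘(ℝ, ℝ) (𝓡 d) (fun τ ↦ levelFlow d m I ϑ τ x) t (1 : ℝ)
      | some i => mfderiv (𝓡 d) (𝓡 d) (fun z ↦ levelFlow d m I ϑ t z) x
          (stdOrthonormalBasis ℝ TJ i : TangentSpace (𝓡 d) x)
  gramVolume DF

/-! ### Latitudinal operators -/

/-- The operator on functions `h` on `I × J` with weight `ψ`:
`s²(t-ϑ) h(t,x) + s(t-ϑ) s(ϑ-t) (ψ(2ϑ-t,x)/ψ(t,x))^{1/p} h(2ϑ-t,x)`, where `1/∞ = 0`. -/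
def awwWeighted {X : Type*} (p : ℝ≥0∞) (s : ℝ → ℝ) (ϑ : ℝ) (ψ h : ℝ → X → ℝ) (t : ℝ) (x : X) : ℝ :=
  s (t - ϑ) ^ 2 * h t x +
    s (t - ϑ) * s (ϑ - t) * (ψ (2 * ϑ - t) x / ψ t x) ^ (p.toReal⁻¹) * h (2 * ϑ - t) x

/-- The Auscher-Weiss-Wickerhauser operator `E_ϑ` on `M`. In the window, a point `y` is written as
`y = F_{ϑ,t}(x)` with `t = m y` and `x = F_{t,ϑ}(y)`. -/
def awwOp (d : ℕ) {M : Type*} [TopologicalSpace M]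
    [ChartedSpace (EuclideanSpace ℝ (Fin d)) M] [IsManifold (𝓡 d) ∞ M]
    [RiemannianBundle (fun x : M ↦ TangentSpace (𝓡 d) x)]
    (p : ℝ≥0∞) (m : M → ℝ) (δ : ℝ) (s : ℝ → ℝ) (ϑ : ℝ) (f : M → ℝ) (y : M) : ℝ :=
  let I : Set ℝ := Ioo (ϑ - δ) (ϑ + δ)
  if ϑ + δ ≤ m y then f y
  else if m y ≤ ϑ - δ then 0
  else awwWeighted p s ϑ (levelWeight d m I ϑ) (fun t x ↦ f (levelFlow d m I ϑ t x))
    (m y) (levelFlow d m I (m y) ϑ y)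

/-- `E_ϑ` with the convention `E_0 = I`. -/
def cutOp (d : ℕ) {M : Type*} [TopologicalSpace M]
    [ChartedSpace (EuclideanSpace ℝ (Fin d)) M] [IsManifold (𝓡 d) ∞ M]
    [RiemannianBundle (fun x : M ↦ TangentSpace (𝓡 d) x)]
    (p : ℝ≥0∞) (m : M → ℝ) (δ : ℝ) (s : ℝ → ℝ) (ϑ : ℝ) (f : M → ℝ) : M → ℝ :=
  if ϑ = 0 then f else awwOp d p m δ s ϑ f

/-- `E_ϑ` with the conventions `E_0 = I` and `E_1 = 0`, for functions `m` with values in `[0, 1]`. -/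
def cutOpCompact (d : ℕ) {M : Type*} [TopologicalSpace M]
    [ChartedSpace (EuclideanSpace ℝ (Fin d)) M] [IsManifold (𝓡 d) ∞ M]
    [RiemannianBundle (fun x : M ↦ TangentSpace (𝓡 d) x)]
    (p : ℝ≥0∞) (m : M → ℝ) (δ : ℝ) (s : ℝ → ℝ) (ϑ : ℝ) (f : M → ℝ) : M → ℝ :=
  if ϑ = 1 then 0 else cutOp d p m δ s ϑ f

/-- The standing hypotheses on the function: a Morse function `m : M → [0, ∞)` such that all the
sets `m⁻¹([0, b])` are compact. -/
structure IsMorseExhaustion (d : ℕ) {M : Type*} [TopologicalSpace M]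
    [ChartedSpace (EuclideanSpace ℝ (Fin d)) M] (m : M → ℝ) : Prop where
  isMorse : IsMorse (d := d) m
  nonneg : ∀ x, 0 ≤ m x
  isCompact_preimage : ∀ b : ℝ, IsCompact (m ⁻¹' Icc 0 b)

end Manifold

/-! ### Smooth decompositions of identity -/

/-- `c ‖f‖ ≤ (∑ ‖P i f‖^p)^{1/p} ≤ C ‖f‖` for all `f ∈ L^p`, with a convergent sum. -/
def BoundsLp {ι X : Type*} [MeasurableSpace X] {ν : Measure X} {p : ℝ≥0∞} [Fact (1 ≤ p)]
    (P : ι → Lp ℝ p ν →L[ℝ] Lp ℝ p ν) (c C : ℝ) : Prop :=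
  ∀ f : Lp ℝ p ν, Summable (fun i ↦ ‖P i f‖ ^ p.toReal) ∧
    c * ‖f‖ ≤ (∑' i, ‖P i f‖ ^ p.toReal) ^ p.toReal⁻¹ ∧
    (∑' i, ‖P i f‖ ^ p.toReal) ^ p.toReal⁻¹ ≤ C * ‖f‖

/-- `(‖T i f‖)_i` belongs to `c₀` and `c ‖f‖ ≤ sup ‖T i f‖ ≤ C ‖f‖` for all `f ∈ C₀`. -/
def BoundsC0 {ι X : Type*} [TopologicalSpace X]
    (T : ι → C₀(X, ℝ) →L[ℝ] C₀(X, ℝ)) (c C : ℝ) : Prop :=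
  ∀ f : C₀(X, ℝ), Tendsto (fun i ↦ ‖T i f‖) cofinite (𝓝 0) ∧
    BddAbove (range fun i ↦ ‖T i f‖) ∧ c * ‖f‖ ≤ ⨆ i, ‖T i f‖ ∧ ⨆ i, ‖T i f‖ ≤ C * ‖f‖

/-- `U` is an open and precompact cover, and the operators `T i` are Hestenes operators localized
on the sets `U i` that form a locally finite family. -/
structure IsLocalizedFamily (d : ℕ) {M : Type*} [TopologicalSpace M]
    [ChartedSpace (EuclideanSpace ℝ (Fin d)) M] {ι : Type*}
    (U : ι → Set M) (T : ι → C₀(M, ℝ) →L[ℝ] C₀(M, ℝ)) : Prop where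
  isOpen : ∀ i, IsOpen (U i)
  precompact : ∀ i, IsCompact (closure (U i))
  cover : ⋃ i, U i = univ
  locallyFinite : ∀ K : Set M, IsCompact K → {i | (U i ∩ K).Nonempty ∧ T i ≠ 0}.Finite
  localized : ∀ i, IsLocalizedHOperator d (T i) (U i)

/-- A smooth decomposition of identity in `L^p`, `1 ≤ p < ∞`, subordinate to the cover `U`. The
operators `P i` on `L^p` are the extensions of the Hestenes operators `T i` on `C₀`. -/
structure IsSmoothDecompositionLp (d : ℕ) {M : Type*} [TopologicalSpace M]
    [ChartedSpace (EuclideanSpace ℝ (Fin d)) M] [MeasurableSpace M] {ν : Measure M} {p : ℝ≥0∞}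
    [Fact (1 ≤ p)] {ι : Type*} (U : ι → Set M) (T : ι → C₀(M, ℝ) →L[ℝ] C₀(M, ℝ))
    (P : ι → Lp ℝ p ν →L[ℝ] Lp ℝ p ν) : Prop where
  toLocalized : IsLocalizedFamily d U T
  extend : ∀ i (f : C₀(M, ℝ)) (hf : MemLp f p ν), P i (hf.toLp f) =ᵐ[ν] T i f
  projection : ∀ i, IsIdempotentElem (P i)
  orthogonal : ∀ i j, i ≠ j → (P i).comp (P j) = 0
  hasSum : ∀ f, HasSum (fun i ↦ P i f) f
  bounds : ∃ C : ℝ, 0 < C ∧ (p = 2 → C = 1) ∧ BoundsLp P C⁻¹ C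

/-- A smooth decomposition of identity in `C₀`, subordinate to the cover `U`. -/
structure IsSmoothDecompositionC0 (d : ℕ) {M : Type*} [TopologicalSpace M]
    [ChartedSpace (EuclideanSpace ℝ (Fin d)) M] {ι : Type*}
    (U : ι → Set M) (T : ι → C₀(M, ℝ) →L[ℝ] C₀(M, ℝ)) : Prop where
  toLocalized : IsLocalizedFamily d U T
  projection : ∀ i, IsIdempotentElem (T i)
  orthogonal : ∀ i j, i ≠ j → (T i).comp (T j) = 0
  hasSum : ∀ f, HasSum (fun i ↦ T i f) f
  bounds : ∃ C : ℝ, 0 < C ∧ BoundsC0 T C⁻¹ C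

end Latitudinal

end

open Latitudinal

set_option linter.unusedSectionVars false

noncomputable section

namespace Latitudinal

/-! ### Smooth dependence of flows on the initial condition -/

section Nemytskii

variable {K E : Type} [TopologicalSpace K] [CompactSpace K]
  [NormedAddCommGroup E] [NormedSpace ℝ E]

/-! In the window around `ϑ` the integral curves of grad m / |grad m|² carry the level t to the
level 2ϑ - t. This gives an involution R of the window with m(R y) = 2ϑ - m(y). The quotient ψ(2ϑ -
t, x) / ψ(t, x) is the Jacobian w of R at y = F(t, x) (`IsWindowFlow.levelWeight_ratio`): R maps the
frame ∂_t, e_1, … transported to time t to the same frame transported to time 2ϑ - t, with ∂_t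
reversed, and a change of sign does not affect a Gram determinant. Hence E_ϑ f = a f + b w^{1/p} (f
∘ R) with a = s²(m - ϑ) and b = s(m - ϑ) s(ϑ - m) (`IsWindowFlow.awwOp_eq`), where the
parametrization no longer occurs.

Such a folding operator acts on each pair {y, R y} separately. In the coordinates (f(y), w(y)^{1/p}
f(R y)) its matrix has rows (a, b) and (b, 1 - a) with b² = a(1 - a), so it is A_ξ with ξ = a(y), up
to the sign of the off-diagonal entries. The matrix is idempotent and symmetric, and the change of
variables ∫ w |g ∘ R|^p = ∫ |g|^p passes from the ℓ^p norm of pairs to the L^p norm. So the operator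
is a projection of norm at most B_p (`IsFolding.fold_fold`, `IsFolding.lintegral_fold_le`),
symmetric for p = 2 (`IsFolding.isSymmetricL2`). Conversely a takes all values between 0 and 1 in
the window, and functions concentrated on a small set and its mirror image see matrices close to any
given A_ξ, so the norm is at least B_p (`IsFolding.awwConst_le_norm`, `norm_C0_fold`). The operators
on the line are the case w = 1.

The difference of two cuts with disjoint windows is again a folding operator: on the upper window E₁
is the identity, and I - E₂ has 1 - a in place of a and -b in place of b (`Cut.isFolding_diff`). It
is also a multiplication by a compactly supported smooth function plus two weighted reflections,
hence a Hestenes operator (`Cut.exists_inducesC0_diff`). The composition of two cuts, in either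
order, is the one at the higher level; this makes the differences mutually annihilating, and their
sum telescopes to the identity (`Cut.exists_isPartition`). A point lies in at most two of the bands.
Convexity for two terms gives the lower constant 2^{1/p-1}, the double overlap gives the upper
constant 2^{1/p} B_p, and the remainder of a partial sum is dominated by an integrable function. A
Schur test gives B_p ≤ (1 + √2)/2, whence the constant 3.

Three facts of analysis support this: smooth global flows of compactly supported smooth fields
(`exists_isSmoothFlow`, by the implicit function theorem in a space of curves), smoothness of the
Riemannian gradient (`contMDiff_grad`, by Cramer's rule), and the change of variables formula for
the Riemannian measure (`setLIntegral_jacobian_comp`). -/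

set_option synthInstance.maxHeartbeats 200000 in
/-- Pointwise evaluation of a continuous family of operators on a continuous family of vectors. -/
def pointwiseApply (K E F : Type) [TopologicalSpace K] [CompactSpace K]
    [NormedAddCommGroup E] [NormedSpace ℝ E] [NormedAddCommGroup F] [NormedSpace ℝ F] :
    C(K, E →L[ℝ] F) →L[ℝ] C(K, E) →L[ℝ] C(K, F) :=
  LinearMap.mkContinuous₂
    (LinearMap.mk₂ ℝ (fun (A : C(K, E →L[ℝ] F)) (h : C(K, E)) ↦
        (⟨fun k ↦ A k (h k), by fun_prop⟩ : C(K, F)))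
      (fun A B h ↦ by ext; simp) (fun c A h ↦ by ext; simp)
      (fun A h k ↦ by ext; simp) (fun c A h ↦ by ext; simp)) 1 (fun A h ↦ by
        refine (ContinuousMap.norm_le _ (by positivity)).2 fun k ↦ ?_
        rw [one_mul]
        refine ((A k).le_opNorm (h k)).trans ?_
        gcongr
        · exact A.norm_coe_le_norm k
        · exact h.norm_coe_le_norm k)

/-- The mean value inequality at each point k bounds the remainder by the oscillation of `fderiv ℝ
f` on a ball around `γ k`. Compact support makes `fderiv ℝ f` uniformly continuous, so one radius
serves all k. -/
lemma hasFDerivAt_postcomp {F : Type} [NormedAddCommGroup F] [NormedSpace ℝ F] {f : E → F}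
    (hf : ContDiff ℝ 1 f) (hs : HasCompactSupport f) (γ : C(K, E)) :
    HasFDerivAt (fun γ : C(K, E) ↦ (⟨f, hf.continuous⟩ : C(E, F)).comp γ)
      (pointwiseApply K E F
        ((⟨fderiv ℝ f, hf.continuous_fderiv one_ne_zero⟩ : C(E, E →L[ℝ] F)).comp γ)) γ := by
  have huc : UniformContinuous (fderiv ℝ f) :=
    (hs.fderiv (𝕜 := ℝ)).uniformContinuous_of_continuous (hf.continuous_fderiv one_ne_zero)
  rw [hasFDerivAt_iff_isLittleO_nhds_zero, Asymptotics.isLittleO_iff]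
  intro c hc
  obtain ⟨r, hr, H⟩ := Metric.uniformContinuous_iff.1 huc c hc
  filter_upwards [Metric.ball_mem_nhds (0 : C(K, E)) hr] with h hh
  rw [mem_ball_zero_iff] at hh
  refine (ContinuousMap.norm_le _ (by positivity)).2 fun k ↦ ?_
  have hhk : ‖h k‖ ≤ ‖h‖ := h.norm_coe_le_norm k
  have key := (convex_ball (γ k) r).norm_image_sub_le_of_norm_hasFDerivWithin_le'
    (f := f) (f' := fderiv ℝ f) (φ := fderiv ℝ f (γ k)) (C := c) (x := γ k) (y := γ k + h k)
    (fun x _ ↦ ((hf.differentiable one_ne_zero) x).hasFDerivAt.hasFDerivWithinAt)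
    (fun x hx ↦ by
      have := H (a := x) (b := γ k) (by simpa using hx)
      rw [dist_eq_norm] at this
      exact this.le)
    (by simpa using hr) (by simpa using lt_of_le_of_lt hhk hh)
  simp only [add_sub_cancel_left] at key
  refine key.trans ?_
  gcongr

-- The derivative of postcomposition with `f` is postcomposition with `fderiv ℝ f` followed by the
-- bounded linear map `pointwiseApply`. The target space is quantified inside the induction because
-- `fderiv ℝ f` takes values in a different space.
set_option synthInstance.maxHeartbeats 200000 in
theorem contDiff_postcomp (n : ℕ) : ∀ {F : Type} [NormedAddCommGroup F] [NormedSpace ℝ F]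
    {f : E → F} (hf : ContDiff ℝ ∞ f), HasCompactSupport f →
    ContDiff ℝ n (fun γ : C(K, E) ↦ (⟨f, hf.continuous⟩ : C(E, F)).comp γ) := by
  induction n with
  | zero =>
    intro F _ _ f hf hs
    refine contDiff_zero.2 ?_
    exact ContinuousMap.continuous_postcomp _
  | succ n ih =>
    intro F _ _ f hf hs
    have h1 : ContDiff ℝ 1 f := hf.of_le (by exact_mod_cast le_top)
    have hd : ContDiff ℝ ∞ (fderiv ℝ f) := hf.fderiv_right (by simp)
    have := ih hd (hs.fderiv (𝕜 := ℝ))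
    have h2 : ContDiff ℝ n (pointwiseApply K E F) := ContinuousLinearMap.contDiff _
    push_cast
    rw [contDiff_succ_iff_hasFDerivAt]
    exact ⟨fun γ ↦ pointwiseApply K E F ((⟨fderiv ℝ f, hd.continuous⟩ : C(E, E →L[ℝ] F)).comp γ),
      h2.comp this, fun γ ↦ hasFDerivAt_postcomp h1 hs γ⟩

end Nemytskii

/-! ### Local flows in a normed space, by the implicit function theorem. -/

section LocalFlow

variable {E : Type} [NormedAddCommGroup E]

lemma continuous_comp_projIcc (γ : C(Icc (-1 : ℝ) 1, E)) :
    Continuous fun s ↦ γ (projIcc (-1) 1 (by norm_num) s) :=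
  γ.continuous.comp continuous_projIcc

variable [NormedSpace ℝ E]

/-- The primitive vanishing at `0` of a continuous curve on `[-1, 1]`. -/
def curvePrimitive (γ : C(Icc (-1 : ℝ) 1, E)) (t : ℝ) : E :=
  ∫ s in (0 : ℝ)..t, γ (projIcc (-1) 1 (by norm_num) s)

lemma hasDerivAt_curvePrimitive [CompleteSpace E] (γ : C(Icc (-1 : ℝ) 1, E)) (t : ℝ) :
    HasDerivAt (curvePrimitive γ) (γ (projIcc (-1) 1 (by norm_num) t)) t :=
  (continuous_comp_projIcc γ).integral_hasStrictDerivAt 0 t |>.hasDerivAt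

variable (E) in
/-- Integration from `0` as an operator on the continuous curves on `[-1, 1]`. -/
def primitiveCLM [CompleteSpace E] : C(Icc (-1 : ℝ) 1, E) →L[ℝ] C(Icc (-1 : ℝ) 1, E) :=
  LinearMap.mkContinuous
    { toFun := fun γ ↦ ⟨fun t ↦ curvePrimitive γ t,
        (continuous_iff_continuousAt.2 fun t ↦
          (hasDerivAt_curvePrimitive γ t).continuousAt).comp continuous_subtype_val⟩
      map_add' := fun γ η ↦ by
        ext t
        simp only [curvePrimitive, ContinuousMap.add_apply, ContinuousMap.coe_mk]
        exact intervalIntegral.integral_add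
          ((continuous_comp_projIcc γ).intervalIntegrable _ _)
          ((continuous_comp_projIcc η).intervalIntegrable _ _)
      map_smul' := fun c γ ↦ by
        ext t
        simp [curvePrimitive, intervalIntegral.integral_smul] } 1 (fun γ ↦ by
    refine (ContinuousMap.norm_le _ (by positivity)).2 fun t ↦ ?_
    have h := intervalIntegral.norm_integral_le_of_norm_le_const (a := 0) (b := (t : ℝ))
      (f := fun s ↦ γ (projIcc (-1) 1 (by norm_num) s)) (C := ‖γ‖)
      (fun s _ ↦ γ.norm_coe_le_norm _)
    refine h.trans ?_
    have : |(t : ℝ) - 0| ≤ 1 := by rw [sub_zero]; exact abs_le.2 t.2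
    nlinarith [norm_nonneg γ])

lemma primitiveCLM_apply [CompleteSpace E] (γ : C(Icc (-1 : ℝ) 1, E)) (t : Icc (-1 : ℝ) 1) :
    primitiveCLM E γ t = curvePrimitive γ t := rfl

/-- The equation `γ = y + τ ∫ f ∘ γ` for the integral curves of `τ f` on `[-1, 1]`. -/
def curveEquation [CompleteSpace E] {f : E → E} (hf : Continuous f)
    (u : (E × ℝ) × C(Icc (-1 : ℝ) 1, E)) : C(Icc (-1 : ℝ) 1, E) :=
  u.2 - ContinuousLinearMap.const ℝ (Icc (-1 : ℝ) 1) u.1.1 -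
    u.1.2 • primitiveCLM E ((⟨f, hf⟩ : C(E, E)).comp u.2)

lemma contDiff_curveEquation [CompleteSpace E] {f : E → E} (hf : ContDiff ℝ ∞ f)
    (hs : HasCompactSupport f) : ContDiff ℝ ∞ (curveEquation hf.continuous) := by
  have h : ContDiff ℝ ∞ (fun γ : C(Icc (-1 : ℝ) 1, E) ↦
      (⟨f, hf.continuous⟩ : C(E, E)).comp γ) :=
    contDiff_infty.2 fun n ↦ contDiff_postcomp n hf hs
  unfold curveEquation
  fun_prop

/-- At τ = 0 the nonlinear term is multiplied by zero, so the partial derivative in the curve is the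
identity and the implicit function theorem applies at every starting point. -/
lemma fderiv_curveEquation_inr [CompleteSpace E] {f : E → E} (hf : ContDiff ℝ ∞ f)
    (hs : HasCompactSupport f) (y : E) (γ : C(Icc (-1 : ℝ) 1, E)) :
    fderiv ℝ (curveEquation hf.continuous) ((y, 0), γ) ∘L
      ContinuousLinearMap.inr ℝ (E × ℝ) C(Icc (-1 : ℝ) 1, E) = ContinuousLinearMap.id ℝ _ := by
  have h1 : HasFDerivAt (fun η : C(Icc (-1 : ℝ) 1, E) ↦
      ((y, (0 : ℝ)), η)) (ContinuousLinearMap.inr ℝ (E × ℝ) C(Icc (-1 : ℝ) 1, E)) γ :=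
    hasFDerivAt_prodMk_right (y, (0 : ℝ)) γ
  have h2 := (((contDiff_curveEquation hf hs).differentiable (by simp))
    ((y, (0 : ℝ)), γ)).hasFDerivAt.comp γ h1
  refine h2.unique ?_
  have : (curveEquation hf.continuous ∘ fun η : C(Icc (-1 : ℝ) 1, E) ↦ ((y, (0 : ℝ)), η)) =
      fun η ↦ η - ContinuousLinearMap.const ℝ (Icc (-1 : ℝ) 1) y := by
    funext η
    simp [curveEquation]
  rw [this]
  exact (hasFDerivAt_id γ).sub_const _

/-- Smooth local flows of compactly supported smooth vector fields on a normed space. -/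
theorem exists_local_flow [CompleteSpace E] {f : E → E} (hf : ContDiff ℝ ∞ f)
    (hs : HasCompactSupport f) (y₀ : E) :
    ∃ φ : ℝ → E → E, ContDiffAt ℝ ∞ (Function.uncurry φ) (0, y₀) ∧
      ∃ ε > 0, ∀ᶠ y in 𝓝 y₀, φ 0 y = y ∧
        ∀ t ∈ Ioo (-ε) ε, HasDerivAt (fun t ↦ φ t y) (f (φ t y)) t := by
  set u : (E × ℝ) × C(Icc (-1 : ℝ) 1, E) :=
    ((y₀, 0), ContinuousLinearMap.const ℝ (Icc (-1 : ℝ) 1) y₀) with hu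
  have cdf : ContDiffAt ℝ ∞ (curveEquation hf.continuous) u :=
    (contDiff_curveEquation hf hs).contDiffAt
  have hinv : (fderiv ℝ (curveEquation hf.continuous) u ∘L
      ContinuousLinearMap.inr ℝ (E × ℝ) C(Icc (-1 : ℝ) 1, E)).IsInvertible := by
    rw [hu, fderiv_curveEquation_inr hf hs]
    exact ⟨ContinuousLinearEquiv.refl ℝ _, rfl⟩
  set ψ := cdf.implicitFunction (by simp) hinv
  have hψ : ContDiffAt ℝ ∞ ψ (y₀, 0) := cdf.contDiffAt_implicitFunction (by simp) hinv
  have hev : ∀ᶠ x in 𝓝 (y₀, (0 : ℝ)), curveEquation hf.continuous (x, ψ x) = 0 := by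
    have := cdf.eventually_apply_implicitFunction (by simp) hinv
    have h0 : curveEquation hf.continuous u = 0 := by simp [curveEquation, hu]
    rw [h0] at this
    exact this
  let one : Icc (-1 : ℝ) 1 := ⟨1, by norm_num⟩
  -- The integral curve of t f at time one is that of f at time t, so evaluation at one turns
  -- smoothness in the parameter into smoothness in time.
  refine ⟨fun t y ↦ ψ (y, t) one, ?_, ?_⟩
  · have h1 : ContDiffAt ℝ ∞ (fun x : ℝ × E ↦ ψ (x.2, x.1)) (0, y₀) :=
      ContDiffAt.comp (g := ψ) (f := fun x : ℝ × E ↦ (x.2, x.1)) (0, y₀) hψ (by fun_prop)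
    exact (ContinuousMap.evalCLM ℝ one).contDiff.contDiffAt.comp _ h1
  · rw [nhds_prod_eq, Filter.eventually_prod_iff] at hev
    obtain ⟨p, hp, q, hq, H⟩ := hev
    obtain ⟨ε, hε, hqε⟩ := Metric.eventually_nhds_iff.1 hq
    obtain ⟨L, hL⟩ := ContDiff.lipschitzWith_of_hasCompactSupport hs hf (by simp)
    refine ⟨ε / 2, by positivity, ?_⟩
    filter_upwards [hp] with y hy
    -- the integral curves as functions on the line
    let A : ℝ → ℝ → E := fun τ t ↦
      y + τ • curvePrimitive ((⟨f, hf.continuous⟩ : C(E, E)).comp (ψ (y, τ))) t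
    have hA : ∀ τ, |τ| < ε → ∀ t : Icc (-1 : ℝ) 1, ψ (y, τ) t = A τ t := by
      intro τ hτ t
      have := H hy (hqε (y := τ) (by simpa using hτ))
      have := congrArg (fun g : C(Icc (-1 : ℝ) 1, E) ↦ g t) this
      simp only [curveEquation, ContinuousMap.sub_apply, ContinuousMap.smul_apply,
        ContinuousMap.zero_apply, primitiveCLM_apply] at this
      rw [sub_sub, sub_eq_zero] at this
      exact this
    have hA' : ∀ τ, |τ| < ε → ∀ t ∈ Icc (-1 : ℝ) 1, HasDerivAt (A τ) (τ • f (A τ t)) t := by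
      intro τ hτ t ht
      have h := ((hasDerivAt_curvePrimitive
        ((⟨f, hf.continuous⟩ : C(E, E)).comp (ψ (y, τ))) t).const_smul τ).const_add y
      rw [projIcc_of_mem _ ht] at h
      simp only [ContinuousMap.comp_apply, ContinuousMap.coe_mk, hA τ hτ] at h
      exact h
    set τ₀ := ε / 2 with hτ₀
    have hτ₀p : 0 < τ₀ := by positivity
    have hτ₀ε : |τ₀| < ε := by rw [abs_of_pos hτ₀p]; linarith
    have hA0 : ∀ τ, A τ 0 = y := fun τ ↦ by simp [A, curvePrimitive]
    -- The equation only gives derivatives along a curve with fixed parameter. All parameters s are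
    -- therefore compared with the single parameter τ₀: the curves r ↦ A s r and r ↦ A τ₀ (r s / τ₀)
    -- solve the same equation x' = s f(x) and start at y.
    have key : ∀ s ∈ Ioo (-τ₀) τ₀, ψ (y, s) one = A τ₀ (s / τ₀) := by
      intro s hs'
      have hsε : |s| < ε := by
        have := abs_lt.2 hs'
        linarith
      rw [hA s hsε]
      have hst : ∀ r ∈ Icc (0 : ℝ) 1, r * (s / τ₀) ∈ Icc (-1 : ℝ) 1 := by
        intro r hr
        have h1 : |s / τ₀| ≤ 1 := by
          rw [abs_div, abs_of_pos hτ₀p, div_le_one hτ₀p]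
          exact (abs_lt.2 hs').le
        rw [mem_Icc, ← abs_le, abs_mul, abs_of_nonneg hr.1]
        nlinarith [hr.1, hr.2, abs_nonneg (s / τ₀)]
      have hd1 : ∀ r ∈ Icc (0 : ℝ) 1, HasDerivAt (A s) (s • f (A s r)) r := fun r hr ↦
        hA' s hsε r ⟨by linarith [hr.1], hr.2⟩
      have hd2 : ∀ r ∈ Icc (0 : ℝ) 1, HasDerivAt (fun r ↦ A τ₀ (r * (s / τ₀)))
          (s • f (A τ₀ (r * (s / τ₀)))) r := by
        intro r hr
        have h := (hA' τ₀ hτ₀ε _ (hst r hr)).scomp r ((hasDerivAt_id r).mul_const (s / τ₀))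
        rw [one_mul, smul_smul, div_mul_cancel₀ _ hτ₀p.ne'] at h
        exact h
      have := ODE_solution_unique (v := fun _ x ↦ s • f x) (K := ‖s‖₊ * L) (a := 0) (b := 1)
        (f := A s) (g := fun r ↦ A τ₀ (r * (s / τ₀)))
        (fun _ ↦ (lipschitzWith_smul s).comp hL)
        (fun r hr ↦ (hd1 r hr).continuousAt.continuousWithinAt)
        (fun r hr ↦ (hd1 r ⟨hr.1, hr.2.le⟩).hasDerivWithinAt)
        (fun r hr ↦ (hd2 r hr).continuousAt.continuousWithinAt)
        (fun r hr ↦ (hd2 r ⟨hr.1, hr.2.le⟩).hasDerivWithinAt)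
        (by simp [hA0])
      simpa using this (show (1 : ℝ) ∈ Icc (0 : ℝ) 1 by simp)
    refine ⟨by rw [key 0 ⟨by linarith, by linarith⟩, zero_div, hA0], fun t ht ↦ ?_⟩
    have hmem : t / τ₀ ∈ Icc (-1 : ℝ) 1 := by
      rw [mem_Icc, ← abs_le, abs_div, abs_of_pos hτ₀p, div_le_one hτ₀p]
      exact (abs_lt.2 ht).le
    have h := (hA' τ₀ hτ₀ε _ hmem).scomp t ((hasDerivAt_id t).div_const τ₀)
    rw [smul_smul, one_div, inv_mul_cancel₀ hτ₀p.ne', one_smul] at h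
    change HasDerivAt _ (f (A τ₀ (t / τ₀))) t at h
    rw [← key t ht] at h
    refine h.congr_of_eventuallyEq ?_
    filter_upwards [Ioo_mem_nhds ht.1 ht.2] with s hs'
    exact key s hs'

end LocalFlow

/-! ### Local flows on a manifold. -/

section ManifoldFlow

variable {d : ℕ} {M : Type*} [TopologicalSpace M] [ChartedSpace (EuclideanSpace ℝ (Fin d)) M]
  [IsManifold (𝓡 d) ∞ M]

/-- The coordinate expression of a vector field in the preferred chart at `x₀`. -/
def chartField (v : (x : M) → TangentSpace (𝓡 d) x) (x₀ : M) (y : EuclideanSpace ℝ (Fin d)) :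
    EuclideanSpace ℝ (Fin d) :=
  tangentCoordChange (𝓡 d) ((extChartAt (𝓡 d) x₀).symm y) x₀ ((extChartAt (𝓡 d) x₀).symm y)
    (v ((extChartAt (𝓡 d) x₀).symm y))

lemma contDiffOn_chartField {v : (x : M) → TangentSpace (𝓡 d) x}
    (hv : ContMDiff (𝓡 d) (𝓡 d).tangent ∞ (fun x ↦ (⟨x, v x⟩ : TangentBundle (𝓡 d) M))) (x₀ : M) :
    ContDiffOn ℝ ∞ (chartField v x₀) (extChartAt (𝓡 d) x₀).target := by
  have h := (Trivialization.contMDiffOn_section_baseSet_iff (IB := 𝓡 d) (n := ∞)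
    (trivializationAt (EuclideanSpace ℝ (Fin d)) (TangentSpace (𝓡 d)) x₀) (s := v)).1 hv.contMDiffOn
  have h2 := h.comp (contMDiffOn_extChartAt_symm (I := 𝓡 d) (n := ∞) x₀) (fun y hy ↦ by
    have := (extChartAt (𝓡 d) x₀).map_target hy
    rw [extChartAt_source] at this
    simpa using this)
  rw [contMDiffOn_iff_contDiffOn] at h2
  refine h2.congr fun y hy ↦ ?_
  rfl

/-- The derivative must be read in the preferred chart of the current point. The coordinate change
from `x₀` to that chart undoes the one in `chartField`, which leaves the value of `v`. -/
lemma isMIntegralCurveOn_symm_comp {v : (x : M) → TangentSpace (𝓡 d) x} {x₀ : M}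
    {γ : ℝ → EuclideanSpace ℝ (Fin d)} {s : Set ℝ}
    (h : ∀ t ∈ s, γ t ∈ (extChartAt (𝓡 d) x₀).target ∧
      HasDerivAt γ (chartField v x₀ (γ t)) t) :
    IsMIntegralCurveOn (I := 𝓡 d) (fun t ↦ (extChartAt (𝓡 d) x₀).symm (γ t)) v s := by
  intro t ht
  obtain ⟨hm, h⟩ := h t ht
  set xₜ : M := (extChartAt (𝓡 d) x₀).symm (γ t) with hxt
  have hft1 : xₜ ∈ (extChartAt (𝓡 d) x₀).source := (extChartAt (𝓡 d) x₀).map_target hm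
  have hft2 := mem_extChartAt_source (I := 𝓡 d) xₜ
  apply HasMFDerivAt.hasMFDerivWithinAt
  have key : HasDerivAt ((extChartAt (𝓡 d) xₜ ∘ (extChartAt (𝓡 d) x₀).symm) ∘ γ)
      (tangentCoordChange (𝓡 d) x₀ xₜ xₜ (chartField v x₀ (γ t))) t := by
    apply HasFDerivAt.comp_hasDerivAt _ _ h
    apply HasFDerivWithinAt.hasFDerivAt (s := range (𝓡 d)) _ (by simp)
    rw [← (extChartAt (𝓡 d) x₀).right_inv hm]
    exact hasFDerivWithinAt_tangentCoordChange ⟨hft1, hft2⟩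
  have hv : tangentCoordChange (𝓡 d) x₀ xₜ xₜ (chartField v x₀ (γ t)) = v xₜ :=
    (tangentCoordChange_comp (I := 𝓡 d) (x := x₀) (v := v xₜ) ⟨⟨hft2, hft1⟩, hft2⟩).trans
      (tangentCoordChange_self (I := 𝓡 d) (x := xₜ) (z := xₜ) (v := v xₜ) hft2)
  rw [hv] at key
  refine ⟨(continuousAt_extChartAt_symm'' hm).comp (f := γ) h.continuousAt, ?_⟩
  exact key.hasDerivWithinAt.hasFDerivWithinAt

/-- Smooth local flows of smooth vector fields on manifolds. -/
theorem exists_local_mflow {v : (x : M) → TangentSpace (𝓡 d) x}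
    (hv : ContMDiff (𝓡 d) (𝓡 d).tangent ∞ (fun x ↦ (⟨x, v x⟩ : TangentBundle (𝓡 d) M))) (x₀ : M) :
    ∃ φ : ℝ → M → M,
      ContMDiffAt (𝓘(ℝ, ℝ).prod (𝓡 d)) (𝓡 d) ∞ (Function.uncurry φ) (0, x₀) ∧
      ∃ ε > 0, ∀ᶠ x in 𝓝 x₀, φ 0 x = x ∧
        IsMIntegralCurveOn (I := 𝓡 d) (fun t ↦ φ t x) v (Ioo (-ε) ε) := by
  set y₀ := extChartAt (𝓡 d) x₀ x₀ with hy₀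
  have hopen : IsOpen (extChartAt (𝓡 d) x₀).target := isOpen_extChartAt_target x₀
  have hy₀t : y₀ ∈ (extChartAt (𝓡 d) x₀).target := mem_extChartAt_target x₀
  obtain ⟨r, hr, hrt⟩ := Metric.isOpen_iff.1 hopen y₀ hy₀t
  -- The bump makes the coordinate field globally smooth with compact support. It equals one on the
  -- ball of radius r / 4, where the curves are kept below by shrinking time and neighbourhood.
  let χ : ContDiffBump y₀ := ⟨r / 4, r / 2, by positivity, by linarith⟩
  have hχ : tsupport χ ⊆ (extChartAt (𝓡 d) x₀).target := by
    rw [χ.tsupport_eq]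
    exact (Metric.closedBall_subset_ball (by change r / 2 < r; linarith)).trans hrt
  let f : EuclideanSpace ℝ (Fin d) → EuclideanSpace ℝ (Fin d) :=
    fun y ↦ χ y • chartField v x₀ y
  have hf : ContDiff ℝ ∞ f := by
    rw [contDiff_iff_contDiffAt]
    intro y
    by_cases hy : y ∈ tsupport χ
    · exact χ.contDiff.contDiffAt.smul
        ((contDiffOn_chartField hv x₀).contDiffAt (hopen.mem_nhds (hχ hy)))
    · have : f =ᶠ[𝓝 y] fun _ ↦ 0 := by
        filter_upwards [(isClosed_tsupport χ).isOpen_compl.mem_nhds hy] with z hz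
        simp [f, image_eq_zero_of_notMem_tsupport hz]
      exact contDiffAt_const.congr_of_eventuallyEq this
  have hs : HasCompactSupport f := χ.hasCompactSupport.smul_right
  obtain ⟨φ, hφ, ε, hε, H⟩ := exists_local_flow hf hs y₀
  have hφ0 : φ 0 y₀ = y₀ := H.self_of_nhds.1
  refine ⟨fun t x ↦ (extChartAt (𝓡 d) x₀).symm (φ t (extChartAt (𝓡 d) x₀ x)), ?_, ?_⟩
  · have h1 : ContMDiffAt (𝓘(ℝ, ℝ).prod (𝓡 d)) (𝓘(ℝ, ℝ).prod 𝓘(ℝ, EuclideanSpace ℝ (Fin d))) ∞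
        (fun p : ℝ × M ↦ (p.1, extChartAt (𝓡 d) x₀ p.2)) (0, x₀) :=
      contMDiffAt_fst.prodMk (ContMDiffAt.comp (g := extChartAt (𝓡 d) x₀) (f := Prod.snd)
        (0, x₀) (contMDiffAt_extChartAt (n := ∞)) contMDiffAt_snd)
    have h2 : ContMDiffAt (𝓘(ℝ, ℝ).prod 𝓘(ℝ, EuclideanSpace ℝ (Fin d)))
        𝓘(ℝ, EuclideanSpace ℝ (Fin d)) ∞ (Function.uncurry φ) (0, y₀) := by
      have := hφ.contMDiffAt
      rw [modelWithCornersSelf_prod, ← chartedSpaceSelf_prod] at this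
      exact this
    have h3 : ContMDiffAt 𝓘(ℝ, EuclideanSpace ℝ (Fin d)) (𝓡 d) ∞
        (extChartAt (𝓡 d) x₀).symm (φ 0 y₀) := by
      rw [hφ0]
      exact (contMDiffOn_extChartAt_symm x₀).contMDiffAt (hopen.mem_nhds hy₀t)
    exact ContMDiffAt.comp (g := (extChartAt (𝓡 d) x₀).symm)
      (f := Function.uncurry φ ∘ fun p : ℝ × M ↦ (p.1, extChartAt (𝓡 d) x₀ p.2)) (0, x₀) h3
      (ContMDiffAt.comp (0, x₀) h2 h1)
  · have hc : ∀ᶠ p in 𝓝 ((0 : ℝ), y₀), φ p.1 p.2 ∈ Metric.ball y₀ (r / 4) := by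
      have := hφ.continuousAt
      refine this.eventually_mem (Metric.isOpen_ball.mem_nhds ?_)
      simp only [Function.uncurry_apply_pair, hφ0]
      exact Metric.mem_ball_self (by positivity)
    rw [nhds_prod_eq, Filter.eventually_prod_iff] at hc
    obtain ⟨p, hp, q, hq, hpq⟩ := hc
    obtain ⟨ε', hε', hp'⟩ := Metric.eventually_nhds_iff.1 hp
    refine ⟨min ε ε', lt_min hε hε', ?_⟩
    have hcont : ContinuousAt (extChartAt (𝓡 d) x₀) x₀ := continuousAt_extChartAt x₀
    filter_upwards [hcont.eventually (H.and hq), extChartAt_source_mem_nhds (I := 𝓡 d) x₀]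
      with x hx hxs
    refine ⟨by rw [hx.1.1, (extChartAt (𝓡 d) x₀).left_inv hxs],
      isMIntegralCurveOn_symm_comp fun t ht ↦ ?_⟩
    have ht1 : t ∈ Ioo (-ε) ε :=
      ⟨by linarith [ht.1, min_le_left ε ε'], by linarith [ht.2, min_le_left ε ε']⟩
    have ht2 : |t| < ε' := abs_lt.2
      ⟨by linarith [ht.1, min_le_right ε ε'], by linarith [ht.2, min_le_right ε ε']⟩
    have hb := hpq (hp' (y := t) (by simpa using ht2)) hx.2
    have hd := hx.1.2 t ht1
    have hχ1 : χ (φ t (extChartAt (𝓡 d) x₀ x)) = 1 :=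
      χ.one_of_mem_closedBall (Metric.ball_subset_closedBall hb)
    simp only [f, hχ1, one_smul] at hd
    exact ⟨hrt (Metric.ball_subset_ball (by linarith) hb), hd⟩

end ManifoldFlow

/-! ### Completeness and joint smoothness of flows. -/

section GlobalFlow

variable {d : ℕ} {M : Type*} [TopologicalSpace M] [T2Space M]
  [ChartedSpace (EuclideanSpace ℝ (Fin d)) M] [IsManifold (𝓡 d) ∞ M]

/-- `θ` is the smooth global flow of the vector field `v`. -/
structure IsSmoothFlow (v : (x : M) → TangentSpace (𝓡 d) x) (θ : ℝ → M → M) : Prop where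
  zero : ∀ x, θ 0 x = x
  curve : ∀ x, IsMIntegralCurve (I := 𝓡 d) (fun t ↦ θ t x) v
  add : ∀ s t x, θ (s + t) x = θ s (θ t x)
  smooth : ContMDiff (𝓘(ℝ, ℝ).prod (𝓡 d)) (𝓡 d) ∞ (Function.uncurry θ)

/-- Compactly supported smooth vector fields have smooth global flows. -/
theorem exists_isSmoothFlow {v : (x : M) → TangentSpace (𝓡 d) x}
    (hv : ContMDiff (𝓡 d) (𝓡 d).tangent ∞ (fun x ↦ (⟨x, v x⟩ : TangentBundle (𝓡 d) M)))
    {K : Set M} (hK : IsCompact K) (hvK : ∀ x ∉ K, v x = 0) : ∃ θ, IsSmoothFlow v θ := by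
  have : IsManifold (𝓡 d) 1 M := IsManifold.of_le (n := ∞) (by simp)
  have hv1 : ContMDiff (𝓡 d) (𝓡 d).tangent 1
      (fun x ↦ (⟨x, v x⟩ : TangentBundle (𝓡 d) M)) := hv.of_le (by simp)
  -- A lifespan common to all points of K, by compactness. Off K the field vanishes and constant
  -- curves serve, so all points share this lifespan and every curve extends to the whole line.
  obtain ⟨ε, hε, hcurve⟩ : ∃ ε > 0, ∀ x ∈ K, ∃ γ : ℝ → M, γ 0 = x ∧
      IsMIntegralCurveOn (I := 𝓡 d) γ v (Ioo (-ε) ε) := by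
    refine hK.induction_on (p := fun s ↦ ∃ ε > 0, ∀ x ∈ s, ∃ γ : ℝ → M, γ 0 = x ∧
      IsMIntegralCurveOn (I := 𝓡 d) γ v (Ioo (-ε) ε)) ⟨1, one_pos, by simp⟩ ?_ ?_ ?_
    · rintro s t hst ⟨ε, hε, H⟩
      exact ⟨ε, hε, fun x hx ↦ H x (hst hx)⟩
    · rintro s t ⟨ε, hε, H⟩ ⟨ε', hε', H'⟩
      refine ⟨min ε ε', lt_min hε hε', fun x hx ↦ ?_⟩
      rcases hx with hx | hx
      · obtain ⟨γ, h0, h⟩ := H x hx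
        exact ⟨γ, h0, h.mono (Ioo_subset_Ioo (neg_le_neg (min_le_left _ _)) (min_le_left _ _))⟩
      · obtain ⟨γ, h0, h⟩ := H' x hx
        exact ⟨γ, h0, h.mono (Ioo_subset_Ioo (neg_le_neg (min_le_right _ _)) (min_le_right _ _))⟩
    · intro x _
      obtain ⟨φ, -, ε, hε, H⟩ := exists_local_mflow hv x
      exact ⟨_, mem_nhdsWithin_of_mem_nhds H, ε, hε, fun y hy ↦ ⟨fun t ↦ φ t y, hy.1, hy.2⟩⟩
  have hglob : ∀ x, ∃ γ : ℝ → M, γ 0 = x ∧ IsMIntegralCurve (I := 𝓡 d) γ v := by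
    refine exists_isMIntegralCurve_of_isMIntegralCurveOn hv1 hε fun x ↦ ?_
    by_cases hx : x ∈ K
    · exact hcurve x hx
    · exact ⟨fun _ ↦ x, rfl, (isMIntegralCurve_const (hvK x hx)).isMIntegralCurveOn _⟩
  choose γ hγ0 hγ using hglob
  let θ : ℝ → M → M := fun t x ↦ γ x t
  have hadd : ∀ s t x, θ (s + t) x = θ s (θ t x) := by
    intro s t x
    have h1 : IsMIntegralCurve (I := 𝓡 d) (γ x ∘ (· + t)) v := (hγ x).comp_add t
    have h2 := isMIntegralCurve_Ioo_eq_of_contMDiff_boundaryless (t₀ := 0) hv1 h1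
      (hγ (γ x t)) (by simp [hγ0])
    exact congrFun h2 s
  have hloc : ∀ x₀, ContMDiffAt (𝓘(ℝ, ℝ).prod (𝓡 d)) (𝓡 d) ∞ (Function.uncurry θ) (0, x₀) := by
    intro x₀
    obtain ⟨φ, hφ, ε, hε, H⟩ := exists_local_mflow hv x₀
    refine hφ.congr_of_eventuallyEq ?_
    rw [nhds_prod_eq]
    filter_upwards [prod_mem_prod (Ioo_mem_nhds (neg_lt_zero.2 hε) hε) H]
    rintro ⟨t, x⟩ ⟨ht, hx⟩
    exact isMIntegralCurveOn_Ioo_eqOn_of_contMDiff_boundaryless (t₀ := 0)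
      ⟨neg_lt_zero.2 hε, hε⟩ hv1 ((hγ x).isMIntegralCurveOn _) hx.2 (by rw [hγ0, hx.1]) ht
  refine ⟨θ, hγ0, hγ, hadd, ?_⟩
  rintro ⟨t₁, x₀⟩
  -- One finite order at a time: being C^n at a point persists nearby for finite n, whereas for all
  -- orders together the neighbourhoods may shrink with n.
  rw [contMDiffAt_infty]
  intro n
  -- the set of times at which the flow is `C^n` near `x₀` is open and closed
  let S : Set ℝ := {t | ContMDiffAt (𝓘(ℝ, ℝ).prod (𝓡 d)) (𝓡 d) n (Function.uncurry θ) (t, x₀)}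
  have hlocn : ∀ z, ContMDiffAt (𝓘(ℝ, ℝ).prod (𝓡 d)) (𝓡 d) n (Function.uncurry θ) (0, z) :=
    fun z ↦ (hloc z).of_le (by exact_mod_cast le_top)
  have : IsManifold (𝓡 d) n M := IsManifold.of_le (n := ∞) (by exact_mod_cast le_top)
  have hev : ∀ t z, ContMDiffAt (𝓘(ℝ, ℝ).prod (𝓡 d)) (𝓡 d) n (Function.uncurry θ) (t, z) →
      ∀ᶠ p in 𝓝 (t, z), ContMDiffAt (𝓘(ℝ, ℝ).prod (𝓡 d)) (𝓡 d) n (Function.uncurry θ) p :=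
    fun t z h ↦ (contMDiffAt_iff_contMDiffAt_nhds (by simp)).1 h
  have hSo : IsOpen S := by
    rw [isOpen_iff_mem_nhds]
    intro t ht
    exact (Continuous.prodMk_left x₀).continuousAt.eventually (hev t x₀ ht)
  -- The group law θ_r = θ_{r-s} ∘ θ_s carries smoothness from a good time s close to t over to t,
  -- since the remaining time t - s is within reach of the local flow at θ_t x₀.
  have hSc : IsClosed S := by
    rw [← isOpen_compl_iff, isOpen_iff_mem_nhds]
    intro t ht
    have hz := hev 0 (θ t x₀) (hlocn _)
    -- for `s` near `t`, the flow is smooth at `(t - s, θ s x₀)`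
    have hc : ContinuousAt (fun s ↦ (t - s, θ s x₀)) t :=
      (continuousAt_const.sub continuousAt_id).prodMk (hγ x₀).continuous.continuousAt
    have hc' : Tendsto (fun s ↦ (t - s, θ s x₀)) (𝓝 t) (𝓝 (0, θ t x₀)) := by
      simpa [ContinuousAt] using hc
    filter_upwards [hc'.eventually hz] with s hs hsS
    apply ht
    change ContMDiffAt _ _ n _ _ at hsS
    have hx : ContMDiffAt (𝓡 d) (𝓡 d) n (fun x ↦ θ s x) x₀ :=
      ContMDiffAt.comp (g := Function.uncurry θ) (f := fun x : M ↦ (s, x)) x₀ hsS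
        (contMDiffAt_const.prodMk contMDiffAt_id)
    have h1 : ContMDiffAt (𝓘(ℝ, ℝ).prod (𝓡 d)) (𝓘(ℝ, ℝ).prod (𝓡 d)) n
        (fun p : ℝ × M ↦ (p.1 - s, θ s p.2)) (t, x₀) := by
      refine ContMDiffAt.prodMk ?_ ?_
      · exact contMDiffAt_fst.sub contMDiffAt_const
      · exact ContMDiffAt.comp (g := fun x ↦ θ s x) (f := Prod.snd) (t, x₀) hx contMDiffAt_snd
    have h2 := ContMDiffAt.comp (g := Function.uncurry θ)
      (f := fun p : ℝ × M ↦ (p.1 - s, θ s p.2)) (t, x₀) hs h1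
    refine h2.congr_of_eventuallyEq (Eventually.of_forall fun p ↦ ?_)
    simp only [Function.uncurry, Function.comp, ← hadd, sub_add_cancel]
  have hS : S = univ := IsClopen.eq_univ ⟨hSc, hSo⟩ ⟨0, hlocn x₀⟩
  have ht₁ : t₁ ∈ S := hS ▸ mem_univ t₁
  exact ht₁

end GlobalFlow

/-! ### Gram determinants -/

section Gram

variable {ι U V : Type*} [Fintype ι] [DecidableEq ι]
  [NormedAddCommGroup U] [InnerProductSpace ℝ U] [NormedAddCommGroup V] [InnerProductSpace ℝ V]

lemma gramVolume_comp_orthonormalBasis [FiniteDimensional ℝ U] (f : U →ₗ[ℝ] V) (b : OrthonormalBasis ι ℝ U) :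
    gramVolume (fun i ↦ f (b i)) = f.normDet := by
  rw [gramVolume, ← f.normDet_sq_eq_det_gram b]
  exact Real.sqrt_sq f.normDet_nonneg

/-- The family is the image of an orthonormal basis of Euclidean space under a linear map g. Both
volumes are then values of `normDet`, which is multiplicative when the source and middle dimensions
agree; this is the role of `h`. -/
lemma gramVolume_comp [FiniteDimensional ℝ U] (f : U →ₗ[ℝ] V) (w : ι → U)
    (h : Fintype.card ι = Module.finrank ℝ U) :
    gramVolume (fun i ↦ f (w i)) = f.normDet * gramVolume w := by
  let b := EuclideanSpace.basisFun ι ℝ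
  let g : EuclideanSpace ℝ ι →ₗ[ℝ] U := b.toBasis.constr ℝ w
  have hg : ∀ i, g (b i) = w i := fun i ↦ by
    have := b.toBasis.constr_basis ℝ w i
    rwa [OrthonormalBasis.coe_toBasis] at this
  have h1 : gramVolume w = g.normDet := by
    rw [← gramVolume_comp_orthonormalBasis g b]
    simp only [hg]
  have h2 : gramVolume (fun i ↦ f (w i)) = (f ∘ₗ g).normDet := by
    rw [← gramVolume_comp_orthonormalBasis (f ∘ₗ g) b]
    simp only [LinearMap.comp_apply, hg]
  rw [h1, h2, LinearMap.normDet_comp_of_finrank_eq _ _ (by simp [h])]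

lemma gramVolume_pos {w : ι → U} (h : LinearIndependent ℝ w) : 0 < gramVolume w :=
  Real.sqrt_pos.2 (Matrix.posDef_gram_of_linearIndependent h).det_pos

/-- The Gram matrix is multiplied on both sides by a diagonal matrix of signs, whose determinant has
square one. This absorbs the reversal of ∂_t under the reflection. -/
lemma gramVolume_smul (c : ι → ℝ) (hc : ∀ i, c i ^ 2 = 1) (w : ι → U) :
    gramVolume (fun i ↦ c i • w i) = gramVolume w := by
  have : Matrix.gram ℝ (fun i ↦ c i • w i) =
      Matrix.diagonal c * Matrix.gram ℝ w * Matrix.diagonal c := by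
    ext i j
    simp [Matrix.gram_apply, inner_smul_left, inner_smul_right]
    ring
  have h2 : (∏ i, c i) * (∏ i, c i) = 1 := by
    rw [← Finset.prod_mul_distrib]
    exact Finset.prod_eq_one fun i _ ↦ by rw [← sq, hc]
  rw [gramVolume, gramVolume, this, Matrix.det_mul, Matrix.det_mul, Matrix.det_diagonal,
    mul_right_comm, h2, one_mul]

end Gram

section SmoothDet

variable {ι : Type*} [Fintype ι] [DecidableEq ι] {n : WithTop ℕ∞}
  {E H N : Type*} [NormedAddCommGroup E] [NormedSpace ℝ E] [TopologicalSpace H]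
  {I : ModelWithCorners ℝ E H} [TopologicalSpace N] [ChartedSpace H N]

lemma contDiff_det : ContDiff ℝ n (fun A : ι → ι → ℝ ↦ (Matrix.of A).det) := by
  simp only [Matrix.det_apply', Matrix.of_apply]
  refine ContDiff.sum fun σ _ ↦ contDiff_const.mul (contDiff_prod fun i _ ↦ ?_)
  exact contDiff_apply_apply ℝ ℝ _ _

lemma contMDiffAt_det {A : N → ι → ι → ℝ} {x : N}
    (h : ∀ i j, ContMDiffAt I 𝓘(ℝ, ℝ) n (fun y ↦ A y i j) x) :
    ContMDiffAt I 𝓘(ℝ, ℝ) n (fun y ↦ (Matrix.of (A y)).det) x :=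
  (contDiff_det (ι := ι)).contMDiff.contMDiffAt.comp x
    (contMDiffAt_pi_space.2 fun i ↦ contMDiffAt_pi_space.2 fun j ↦ h i j)

end SmoothDet

/-! ### Smoothness of the Riemannian gradient -/

section Gradient

variable {d : ℕ} {M : Type*} [TopologicalSpace M] [ChartedSpace (EuclideanSpace ℝ (Fin d)) M]
  [IsManifold (𝓡 d) ∞ M] [RiemannianBundle (fun x : M ↦ TangentSpace (𝓡 d) x)]
  [IsContMDiffRiemannianBundle (𝓡 d) ∞ (EuclideanSpace ℝ (Fin d))
      (fun x : M ↦ TangentSpace (𝓡 d) x)]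

lemma inner_grad (m : M → ℝ) (x : M) (v : TangentSpace (𝓡 d) x) :
    inner ℝ (grad (d := d) m x) v = dform m x v := by
  unfold grad
  exact InnerProductSpace.toDual_symm_apply

/-- The coordinate frame of the preferred chart at `x₀`. -/
def chartFrame (d : ℕ) {M : Type*} [TopologicalSpace M]
    [ChartedSpace (EuclideanSpace ℝ (Fin d)) M] [IsManifold (𝓡 d) ∞ M] (x₀ : M) (i : Fin d)
    (x : M) : TangentSpace (𝓡 d) x :=
  (trivializationAt (EuclideanSpace ℝ (Fin d)) (TangentSpace (𝓡 d)) x₀).localFrame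
    (EuclideanSpace.basisFun (Fin d) ℝ).toBasis i x

lemma isLocalFrameOn_chartFrame (x₀ : M) :
    IsLocalFrameOn (𝓡 d) (EuclideanSpace ℝ (Fin d)) ∞ (chartFrame d x₀)
      (chartAt (EuclideanSpace ℝ (Fin d)) x₀).source :=
  (trivializationAt (EuclideanSpace ℝ (Fin d)) (TangentSpace (𝓡 d))
    x₀).isLocalFrameOn_localFrame_baseSet (𝓡 d) ∞ (EuclideanSpace.basisFun (Fin d) ℝ).toBasis

lemma contMDiffAt_chartFrame {x₀ x : M} (hx : x ∈ (chartAt (EuclideanSpace ℝ (Fin d)) x₀).source)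
    (i : Fin d) : ContMDiffAt (𝓡 d) (𝓡 d).tangent ∞
      (fun x ↦ (⟨x, chartFrame d x₀ i x⟩ : TangentBundle (𝓡 d) M)) x :=
  (isLocalFrameOn_chartFrame x₀).contMDiffAt (chartAt _ x₀).open_source hx i

lemma contMDiffAt_dform {m : M → ℝ} (hm : ContMDiff (𝓡 d) 𝓘(ℝ, ℝ) ∞ m)
    {v : (x : M) → TangentSpace (𝓡 d) x} {x : M}
    (hv : ContMDiffAt (𝓡 d) (𝓡 d).tangent ∞ (fun x ↦ (⟨x, v x⟩ : TangentBundle (𝓡 d) M)) x) :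
    ContMDiffAt (𝓡 d) 𝓘(ℝ, ℝ) ∞ (fun x ↦ dform (d := d) m x (v x)) x := by
  have h1 : ContMDiff (𝓡 d).tangent 𝓘(ℝ, ℝ).tangent ∞ (tangentMap (𝓡 d) 𝓘(ℝ, ℝ) m) :=
    hm.contMDiff_tangentMap (by simp)
  exact (contMDiff_snd_tangentBundle_modelSpace ℝ 𝓘(ℝ, ℝ)).contMDiffAt.comp x
    (h1.contMDiffAt.comp x hv)

/-- The coefficients of `v` in the frame solve a linear system with the Gram matrix of the frame.
Cramer's rule writes them as quotients of smooth determinants, with positive denominator. -/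
lemma contMDiffAt_of_inner_chartFrame {v : (x : M) → TangentSpace (𝓡 d) x} (x₀ : M)
    (h : ∀ i, ContMDiffAt (𝓡 d) 𝓘(ℝ, ℝ) ∞ (fun x ↦ inner ℝ (chartFrame d x₀ i x) (v x)) x₀) :
    ContMDiffAt (𝓡 d) (𝓡 d).tangent ∞ (fun x ↦ (⟨x, v x⟩ : TangentBundle (𝓡 d) M)) x₀ := by
  have hs := isLocalFrameOn_chartFrame (d := d) x₀
  have hx₀ := mem_chart_source (EuclideanSpace ℝ (Fin d)) x₀
  have hU := (chartAt (EuclideanSpace ℝ (Fin d)) x₀).open_source.mem_nhds hx₀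
  refine hs.contMDiffAt_of_coeff (fun j ↦ ?_) hU
  let G : M → Fin d → Fin d → ℝ := fun x i k ↦ inner ℝ (chartFrame d x₀ i x) (chartFrame d x₀ k x)
  have hG : ∀ i k, ContMDiffAt (𝓡 d) 𝓘(ℝ, ℝ) ∞ (fun x ↦ G x i k) x₀ := fun i k ↦
    (contMDiffAt_chartFrame hx₀ i).inner_bundle (contMDiffAt_chartFrame hx₀ k)
  have hdet : ∀ x ∈ (chartAt (EuclideanSpace ℝ (Fin d)) x₀).source,
      (Matrix.of (G x)).det ≠ 0 := fun x hx ↦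
    (Matrix.posDef_gram_of_linearIndependent (hs.linearIndependent hx)).det_pos.ne'
  have hsm : ContMDiffAt (𝓡 d) 𝓘(ℝ, ℝ) ∞ (fun x ↦ (Matrix.of fun i k ↦
      if k = j then inner ℝ (chartFrame d x₀ i x) (v x) else G x i k).det /
        (Matrix.of (G x)).det) x₀ := by
    refine ContMDiffAt.div₀ (contMDiffAt_det fun i k ↦ ?_) (contMDiffAt_det hG) (hdet x₀ hx₀)
    by_cases hk : k = j
    · simpa [hk] using h i
    · simpa [hk] using hG i k
  refine hsm.congr_of_eventuallyEq ?_
  filter_upwards [hU] with x hx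
  rw [eq_div_iff (hdet x hx)]
  have hsum := hs.coeff_sum_eq v hx
  let c : Fin d → ℝ := fun k ↦ hs.coeff k x (v x)
  have hGc : (Matrix.of (G x)).mulVec c = fun i ↦ inner ℝ (chartFrame d x₀ i x) (v x) := by
    funext i
    conv_rhs => rw [hsum, inner_sum]
    simp only [Matrix.mulVec, dotProduct, Matrix.of_apply, inner_smul_right, G, c]
    exact Finset.sum_congr rfl fun k _ ↦ mul_comm _ _
  have h2 : Matrix.cramer (Matrix.of (G x)) ((Matrix.of (G x)).mulVec c) =
      (Matrix.of (G x)).det • c := by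
    rw [Matrix.cramer_eq_adjugate_mulVec, Matrix.mulVec_mulVec, Matrix.adjugate_mul,
      Matrix.smul_mulVec, Matrix.one_mulVec]
  have h3 := congrFun h2 j
  rw [Matrix.cramer_apply, hGc] at h3
  simp only [Pi.smul_apply, smul_eq_mul] at h3
  rw [mul_comm]
  refine h3.symm.trans (congrArg Matrix.det ?_)
  ext i k
  simp [Matrix.updateCol_apply]

lemma contMDiff_grad {m : M → ℝ} (hm : ContMDiff (𝓡 d) 𝓘(ℝ, ℝ) ∞ m) :
    ContMDiff (𝓡 d) (𝓡 d).tangent ∞ (fun x ↦ (⟨x, grad m x⟩ : TangentBundle (𝓡 d) M)) := by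
  intro x₀
  refine contMDiffAt_of_inner_chartFrame x₀ fun i ↦ ?_
  have := contMDiffAt_dform hm (contMDiffAt_chartFrame (mem_chart_source _ x₀) i)
  exact this.congr_of_eventuallyEq
    (Eventually.of_forall fun x ↦ (real_inner_comm _ _).trans (inner_grad m x _))

end Gradient

/-! ### The flow of the renormalized gradient field near a regular window -/

section WindowFlow

variable {d : ℕ} {M : Type*} [TopologicalSpace M] [T2Space M]
  [ChartedSpace (EuclideanSpace ℝ (Fin d)) M]
  [IsManifold (𝓡 d) ∞ M] [RiemannianBundle (fun x : M ↦ TangentSpace (𝓡 d) x)]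
  [IsContMDiffRiemannianBundle (𝓡 d) ∞ (EuclideanSpace ℝ (Fin d))
      (fun x : M ↦ TangentSpace (𝓡 d) x)]

lemma dform_grad (m : M → ℝ) (x : M) :
    dform (d := d) m x (grad m x) = ‖grad (d := d) m x‖ ^ 2 := by
  rw [← inner_grad, real_inner_self_eq_norm_sq]

lemma isCritical_iff (m : M → ℝ) (x : M) : IsCritical (d := d) m x ↔ grad (d := d) m x = 0 := by
  unfold grad
  rw [LinearIsometryEquiv.map_eq_zero_iff]
  rfl

/-- |grad m|² is written as dm(grad m) here and below, because its smoothness then follows from that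
of the tangent map of m. -/
lemma isCritical_iff_dform (m : M → ℝ) (x : M) :
    IsCritical (d := d) m x ↔ dform (d := d) m x (grad m x) = 0 := by
  rw [isCritical_iff, dform_grad]
  simp

lemma contMDiff_normSq_grad {m : M → ℝ} (hm : ContMDiff (𝓡 d) 𝓘(ℝ, ℝ) ∞ m) :
    ContMDiff (𝓡 d) 𝓘(ℝ, ℝ) ∞ (fun x ↦ dform (d := d) m x (grad m x)) :=
  fun x ↦ contMDiffAt_dform hm (contMDiff_grad hm x)

lemma isClosed_critical {m : M → ℝ} (hm : ContMDiff (𝓡 d) 𝓘(ℝ, ℝ) ∞ m) :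
    IsClosed {x | IsCritical (d := d) m x} := by
  simp only [isCritical_iff_dform]
  exact isClosed_singleton.preimage (contMDiff_normSq_grad hm).continuous

lemma normGrad_eq (m : M → ℝ) (x : M) :
    normGrad (d := d) m x = (dform (d := d) m x (grad m x))⁻¹ • grad m x := by
  rw [normGrad, dform_grad]

lemma dform_normGrad {m : M → ℝ} {x : M} (hx : ¬ IsCritical (d := d) m x) :
    dform (d := d) m x (normGrad m x) = 1 := by
  rw [isCritical_iff_dform] at hx
  rw [normGrad_eq, map_smul, smul_eq_mul, inv_mul_cancel₀ hx]

lemma contMDiffAt_normGrad {m : M → ℝ} (hm : ContMDiff (𝓡 d) 𝓘(ℝ, ℝ) ∞ m) {x : M}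
    (hx : ¬ IsCritical (d := d) m x) : ContMDiffAt (𝓡 d) (𝓡 d).tangent ∞
      (fun x ↦ (⟨x, normGrad m x⟩ : TangentBundle (𝓡 d) M)) x := by
  simp only [normGrad_eq]
  rw [isCritical_iff_dform] at hx
  exact ContMDiffAt.smul_section ((contMDiff_normSq_grad hm x).inv₀ hx) (contMDiff_grad hm x)

/-- The critical values attained in a sublevel set form a compact set, so the compact window keeps a
positive distance from them. -/
lemma exists_regular_margin {m : M → ℝ} (hm : IsMorseExhaustion d m) {ϑ δ : ℝ} (hδ : 0 < δ)
    (hreg : IsRegularWindow d m ϑ δ) :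
    ∃ η > 0, ∀ x, m x ∈ Icc (ϑ - δ - 2 * η) (ϑ + δ + 2 * η) → ¬ IsCritical (d := d) m x := by
  have hms := hm.isMorse.smooth
  have hK : IsCompact (m '' (m ⁻¹' Icc 0 (ϑ + δ + 1) ∩ {x | IsCritical (d := d) m x})) :=
    ((hm.isCompact_preimage _).inter_right (isClosed_critical hms)).image hms.continuous
  have hsub : Icc (ϑ - δ) (ϑ + δ) ⊆
      (m '' (m ⁻¹' Icc 0 (ϑ + δ + 1) ∩ {x | IsCritical (d := d) m x}))ᶜ := by
    rintro t ht ⟨x, ⟨-, hx⟩, rfl⟩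
    exact (hreg _ ht).2 x rfl hx
  obtain ⟨ε, hε, H⟩ := isCompact_Icc.exists_thickening_subset_open hK.isClosed.isOpen_compl hsub
  -- Then 2η is less than ε, the distance to the critical values, and less than one, which keeps x
  -- in the sublevel set used above.
  refine ⟨min ε 1 / 4, by positivity, fun x hx hc ↦ ?_⟩
  have h1 : min ε 1 ≤ ε := min_le_left _ _
  have h2 : min ε 1 ≤ 1 := min_le_right _ _
  have hx0 := hm.nonneg x
  refine H (a := m x) ?_ ⟨x, ⟨⟨hx0, by linarith [hx.2]⟩, hc⟩, rfl⟩
  rw [Metric.mem_thickening_iff]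
  refine ⟨max (ϑ - δ) (min (m x) (ϑ + δ)),
    ⟨le_max_left _ _, max_le (by linarith) (min_le_right _ _)⟩, ?_⟩
  rw [Real.dist_eq, abs_lt]
  constructor <;> rcases max_cases (ϑ - δ) (min (m x) (ϑ + δ)) with h | h <;>
    rcases min_cases (m x) (ϑ + δ) with h' | h' <;> linarith [hx.1, hx.2]

/-- `θ` is a smooth flow on `M` that follows the renormalized gradient field of `m` over the window
`[ϑ - δ, ϑ + δ]` and a margin `η` around it. -/
structure IsWindowFlow (m : M → ℝ) (ϑ δ η : ℝ) (θ : ℝ → M → M) : Prop where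
  pos : 0 < η
  regular : ∀ x, m x ∈ Ioo (ϑ - δ - η) (ϑ + δ + η) → ¬ IsCritical (d := d) m x
  smooth : ContMDiff (𝓘(ℝ, ℝ).prod (𝓡 d)) (𝓡 d) ∞ (Function.uncurry θ)
  zero : ∀ x, θ 0 x = x
  add : ∀ s t x, θ (s + t) x = θ s (θ t x)
  level : ∀ x t, m x ∈ Ioo (ϑ - δ - η) (ϑ + δ + η) → m x + t ∈ Ioo (ϑ - δ - η) (ϑ + δ + η) →
    m (θ t x) = m x + t
  curve : ∀ x, m x ∈ Ioo (ϑ - δ - η) (ϑ + δ + η) → IsMIntegralCurveOn (I := 𝓡 d)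
    (fun t ↦ θ t x) (normGrad (d := d) m) (Ioo (ϑ - δ - η - m x) (ϑ + δ + η - m x))

/-- Multiplying the renormalized gradient by a cut-off of m removes the critical points and gives
compact support, hence a global flow. Along it the value of m solves u' = χ(u), as does m x + t as
long as it stays where χ = 1; uniqueness identifies the two. -/
theorem exists_isWindowFlow {m : M → ℝ} (hm : IsMorseExhaustion d m) {ϑ δ : ℝ} (hδ : 0 < δ)
    (hreg : IsRegularWindow d m ϑ δ) : ∃ η θ, IsWindowFlow (d := d) m ϑ δ η θ := by
  have hms := hm.isMorse.smooth
  obtain ⟨η, hη, hcrit⟩ := exists_regular_margin hm hδ hreg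
  let χ : ContDiffBump ϑ := ⟨δ + η, δ + 2 * η, by positivity, by linarith⟩
  have hχ1 : ∀ t ∈ Ioo (ϑ - δ - η) (ϑ + δ + η), χ t = 1 := fun t ht ↦
    χ.one_of_mem_closedBall (by
      rw [Metric.mem_closedBall, Real.dist_eq, abs_le]
      change -(δ + η) ≤ _ ∧ _ ≤ δ + η
      constructor <;> linarith [ht.1, ht.2])
  have hχ0 : ∀ t, t ∉ Icc (ϑ - δ - 2 * η) (ϑ + δ + 2 * η) → χ t = 0 := fun t ht ↦
    χ.zero_of_le_dist (by
      change δ + 2 * η ≤ _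
      rw [Real.dist_eq]
      by_contra hlt
      rw [not_le, abs_lt] at hlt
      exact ht ⟨by linarith [hlt.1], by linarith [hlt.2]⟩)
  let v : (x : M) → TangentSpace (𝓡 d) x := fun x ↦ χ (m x) • normGrad (d := d) m x
  have hv : ContMDiff (𝓡 d) (𝓡 d).tangent ∞ (fun x ↦ (⟨x, v x⟩ : TangentBundle (𝓡 d) M)) := by
    intro x
    have hχm : ContMDiffAt (𝓡 d) 𝓘(ℝ, ℝ) ∞ (fun x ↦ χ (m x)) x :=
      (χ.contDiff (n := (⊤ : ℕ∞))).contMDiff.contMDiffAt.comp x (hms x)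
    by_cases hx : IsCritical (d := d) m x
    · have hnot : m x ∉ Icc (ϑ - δ - 2 * η) (ϑ + δ + 2 * η) := fun h ↦ hcrit x h hx
      have h0 : ContMDiffAt (𝓡 d) (𝓡 d).tangent ∞
          (fun x ↦ (⟨x, (fun _ ↦ (0 : ℝ)) x • grad (d := d) m x⟩ : TangentBundle (𝓡 d) M)) x :=
        ContMDiffAt.smul_section contMDiffAt_const (contMDiff_grad hms x)
      refine h0.congr_of_eventuallyEq ?_
      filter_upwards [hms.continuous.continuousAt.eventually
        (isClosed_Icc.isOpen_compl.mem_nhds hnot)] with y hy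
      simp [v, hχ0 (m y) hy]
    · exact ContMDiffAt.smul_section hχm (contMDiffAt_normGrad hms hx)
  have hdv : ∀ x, dform (d := d) m x (v x) = χ (m x) := by
    intro x
    simp only [v, map_smul, smul_eq_mul]
    by_cases hx : IsCritical (d := d) m x
    · rw [hχ0 (m x) fun h ↦ hcrit x h hx, zero_mul]
    · rw [dform_normGrad hx, mul_one]
  obtain ⟨θ, hθ⟩ := exists_isSmoothFlow hv (hm.isCompact_preimage (ϑ + δ + 2 * η)) (fun x hx ↦ by
    have : m x ∉ Icc (ϑ - δ - 2 * η) (ϑ + δ + 2 * η) := fun h ↦ hx ⟨hm.nonneg x, h.2⟩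
    simp [v, hχ0 _ this])
  have hlevel : ∀ x t, m x ∈ Ioo (ϑ - δ - η) (ϑ + δ + η) →
      m x + t ∈ Ioo (ϑ - δ - η) (ϑ + δ + η) → m (θ t x) = m x + t := by
    intro x t hx ht
    have hder : ∀ s, HasDerivAt (fun s ↦ m (θ s x)) (χ (m (θ s x))) s := by
      intro s
      have h1 : HasMFDerivAt (𝓡 d) 𝓘(ℝ, ℝ) m (θ s x) (dform (d := d) m (θ s x)) :=
        ((hms _).mdifferentiableAt (by simp)).hasMFDerivAt
      have h2 : HasFDerivAt (fun s ↦ m (θ s x))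
          ((dform (d := d) m (θ s x)).comp ((1 : ℝ →L[ℝ] ℝ).smulRight (v (θ s x)))) s :=
        hasMFDerivAt_iff_hasFDerivAt.1 (h1.comp s (hθ.curve x s))
      refine h2.hasDerivAt.congr_deriv ?_
      rw [← hdv]
      exact congrArg (dform (d := d) m (θ s x)) (one_smul ℝ (v (θ s x)))
    obtain ⟨L, hL⟩ := ContDiff.lipschitzWith_of_hasCompactSupport χ.hasCompactSupport
      (χ.contDiff (n := 1)) (by simp)
    have := ODE_solution_unique_of_mem_Ioo (v := fun _ ↦ χ) (s := fun _ ↦ univ) (K := L)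
      (t₀ := 0) (f := fun s ↦ m (θ s x)) (g := fun s ↦ m x + s)
      (a := ϑ - δ - η - m x) (b := ϑ + δ + η - m x)
      (fun _ _ ↦ hL.lipschitzOnWith) ⟨by linarith [hx.1], by linarith [hx.2]⟩
      (fun s _ ↦ ⟨hder s, trivial⟩)
      (fun s hs ↦ ⟨by
        rw [hχ1 (m x + s) ⟨by linarith [hs.1], by linarith [hs.2]⟩]
        exact (hasDerivAt_id s).const_add (m x), trivial⟩)
      (by simp [hθ.zero])
    exact this ⟨by linarith [ht.1], by linarith [ht.2]⟩
  refine ⟨η, θ, hη, fun x hx ↦ hcrit x ⟨by linarith [hx.1], by linarith [hx.2]⟩,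
    hθ.smooth, hθ.zero, hθ.add, hlevel, fun x hx t ht ↦ ?_⟩
  have hmt : m x + t ∈ Ioo (ϑ - δ - η) (ϑ + δ + η) := ⟨by linarith [ht.1], by linarith [ht.2]⟩
  have hvt : v (θ t x) = normGrad (d := d) m (θ t x) := by
    simp only [v]
    rw [hlevel x t hx hmt, hχ1 _ hmt, one_smul]
  have h := hθ.curve x t
  simp only [hvt] at h
  exact h.hasMFDerivWithinAt

/-- Smoothness of the field is required only along `γ`, since the renormalized gradient need not be
smooth at critical points. Agreement is an open condition by local uniqueness and a closed one in
the interval, which is connected. -/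
lemma eqOn_of_integralCurves {v : (x : M) → TangentSpace (𝓡 d) x} {γ γ' : ℝ → M} {a b t₀ : ℝ}
    (ht₀ : t₀ ∈ Ioo a b)
    (hv : ∀ t ∈ Ioo a b, ContMDiffAt (𝓡 d) (𝓡 d).tangent 1
      (fun x ↦ (⟨x, v x⟩ : TangentBundle (𝓡 d) M)) (γ t))
    (hγ : IsMIntegralCurveOn (I := 𝓡 d) γ v (Ioo a b))
    (hγ' : IsMIntegralCurveOn (I := 𝓡 d) γ' v (Ioo a b)) (h : γ t₀ = γ' t₀) :
    EqOn γ γ' (Ioo a b) := by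
  have : IsManifold (𝓡 d) 1 M := IsManifold.of_le (n := ∞) (by simp)
  let s := {t | t ∈ Ioo a b ∧ γ t = γ' t}
  have hsub : Ioo a b ⊆ s := by
    refine isPreconnected_Ioo.subset_of_closure_inter_subset (u := s) ?_ ⟨t₀, ht₀, ht₀, h⟩ ?_
    · rw [isOpen_iff_mem_nhds]
      rintro t ⟨ht, hteq⟩
      filter_upwards [Ioo_mem_nhds ht.1 ht.2,
        isMIntegralCurveAt_eventuallyEq_of_contMDiffAt_boundaryless (hv t ht)
          (hγ.isMIntegralCurveAt (Ioo_mem_nhds ht.1 ht.2))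
          (hγ'.isMIntegralCurveAt (Ioo_mem_nhds ht.1 ht.2)) hteq] with r hr hr'
      exact ⟨hr, hr'⟩
    · rintro t ⟨htc, ht⟩
      refine ⟨ht, ?_⟩
      have hnhds := Ioo_mem_nhds ht.1 ht.2
      exact tendsto_nhds_unique_of_frequently_eq (hγ.isMIntegralCurveAt hnhds).continuousAt
        (hγ'.isMIntegralCurveAt hnhds).continuousAt
        ((mem_closure_iff_frequently.1 htc).mono fun r hr ↦ hr.2)
  exact fun t ht ↦ (hsub ht).2

/-- The point may lie off the level `a` by less than the margin η. This is needed because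
`levelWeight` differentiates the level flow on M, not just on the level set, so a full neighbourhood
must avoid the default value of `levelFlow`. -/
lemma IsWindowFlow.levelFlow_eq {m : M → ℝ} (hms : ContMDiff (𝓡 d) 𝓘(ℝ, ℝ) ∞ m) {ϑ δ η : ℝ}
    {θ : ℝ → M → M} (hθ : IsWindowFlow (d := d) m ϑ δ η θ) {a b : ℝ} {x : M}
    (ha : a ∈ Ioo (ϑ - δ) (ϑ + δ)) (hb : b ∈ Ioo (ϑ - δ) (ϑ + δ)) (hx : |m x - a| < η) :
    levelFlow d m (Ioo (ϑ - δ) (ϑ + δ)) a b x = θ (b - a) x := by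
  rw [abs_lt] at hx
  have hmx : m x ∈ Ioo (ϑ - δ - η) (ϑ + δ + η) :=
    ⟨by linarith [ha.1, hx.1], by linarith [ha.2, hx.2]⟩
  have hcurve : IsMIntegralCurveOn (I := 𝓡 d) (fun t ↦ θ (t - a) x) (normGrad (d := d) m)
      (Ioo (ϑ - δ) (ϑ + δ)) := by
    have := (isMIntegralCurveOn_comp_sub (dt := a)).2 (hθ.curve x hmx)
    exact this.mono fun t ht ↦ ⟨by linarith [ht.1, hx.1], by linarith [ht.2, hx.2]⟩
  have hex : ∃ γ : ℝ → M, γ a = x ∧ IsMIntegralCurveOn (I := 𝓡 d) γ (normGrad (d := d) m)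
      (Ioo (ϑ - δ) (ϑ + δ)) := ⟨_, by simp [hθ.zero], hcurve⟩
  rw [levelFlow, dif_pos hex]
  refine (eqOn_of_integralCurves ha (fun t ht ↦ ?_) hcurve hex.choose_spec.2
    (by simp [hθ.zero, hex.choose_spec.1]) hb).symm
  refine (contMDiffAt_normGrad hms (hθ.regular _ ?_)).of_le (by simp)
  rw [hθ.level x (t - a) hmx ⟨by linarith [ht.1, hx.1], by linarith [ht.2, hx.2]⟩]
  exact ⟨by linarith [ht.1, hx.1], by linarith [ht.2, hx.2]⟩

end WindowFlow

/-! ### The reflection across a regular level set -/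

section Reflection

variable {d : ℕ} {M : Type*} [TopologicalSpace M] [T2Space M]
  [ChartedSpace (EuclideanSpace ℝ (Fin d)) M]
  [IsManifold (𝓡 d) ∞ M] [RiemannianBundle (fun x : M ↦ TangentSpace (𝓡 d) x)]
  [IsContMDiffRiemannianBundle (𝓡 d) ∞ (EuclideanSpace ℝ (Fin d))
      (fun x : M ↦ TangentSpace (𝓡 d) x)]

/-- Reflection of the levels of `m` across the level `ϑ` along the flow `θ`. -/
def flowReflection (m : M → ℝ) (ϑ : ℝ) (θ : ℝ → M → M) (y : M) : M := θ (2 * (ϑ - m y)) y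

/-- The frame `∂_t, e_1, …, e_{d-1}` of `T_x M` that underlies `levelWeight`. -/
def levelFrame (d : ℕ) {M : Type*} [TopologicalSpace M]
    [ChartedSpace (EuclideanSpace ℝ (Fin d)) M] [IsManifold (𝓡 d) ∞ M]
    [RiemannianBundle (fun x : M ↦ TangentSpace (𝓡 d) x)] (m : M → ℝ) (x : M) :
    Option (Fin (Module.finrank ℝ (LinearMap.ker (dform (d := d) m x).toLinearMap))) →
      TangentSpace (𝓡 d) x
  | none => normGrad (d := d) m x
  | some i => (stdOrthonormalBasis ℝ (LinearMap.ker (dform (d := d) m x).toLinearMap) i :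
      TangentSpace (𝓡 d) x)

lemma finrank_tangentSpace (x : M) : Module.finrank ℝ (TangentSpace (𝓡 d) x) = d := by
  change Module.finrank ℝ (EuclideanSpace ℝ (Fin d)) = d
  simp

lemma linearIndependent_levelFrame {m : M → ℝ} {x : M} (hx : ¬ IsCritical (d := d) m x) :
    LinearIndependent ℝ (levelFrame d m x) := by
  rw [linearIndependent_option]
  have hspan : ∀ v ∈ Submodule.span ℝ (range (levelFrame d m x ∘ some)),
      dform (d := d) m x v = 0 := by
    intro v hv
    have hle : Submodule.span ℝ (range (levelFrame d m x ∘ some)) ≤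
        LinearMap.ker (dform (d := d) m x).toLinearMap := by
      rw [Submodule.span_le]
      rintro _ ⟨i, rfl⟩
      exact (stdOrthonormalBasis ℝ (LinearMap.ker (dform (d := d) m x).toLinearMap) i).2
    exact hle hv
  refine ⟨?_, fun h ↦ ?_⟩
  · exact (stdOrthonormalBasis ℝ (LinearMap.ker
      (dform (d := d) m x).toLinearMap)).orthonormal.linearIndependent.map' (Submodule.subtype _)
      (Submodule.ker_subtype _)
  · have h1 := hspan _ h
    rw [levelFrame, dform_normGrad hx] at h1
    exact one_ne_zero h1

lemma card_levelFrame {m : M → ℝ} {x : M} (hx : ¬ IsCritical (d := d) m x) :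
    Fintype.card (Option (Fin (Module.finrank ℝ (LinearMap.ker (dform (d := d) m x).toLinearMap))))
      = Module.finrank ℝ (TangentSpace (𝓡 d) x) := by
  have h := LinearMap.finrank_range_add_finrank_ker (dform (d := d) m x).toLinearMap
  have hr : LinearMap.range (dform (d := d) m x).toLinearMap = ⊤ := by
    rw [LinearMap.range_eq_top]
    intro c
    refine ⟨c • normGrad m x, ?_⟩
    change dform (d := d) m x (c • normGrad m x) = c
    rw [map_smul, dform_normGrad hx, smul_eq_mul, mul_one]
  rw [hr, finrank_top, Module.finrank_self] at h
  rw [Fintype.card_option, Fintype.card_fin, ← h, add_comm]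

lemma dform_levelFrame_some (m : M → ℝ) (x : M) (i) :
    dform (d := d) m x (levelFrame d m x (some i)) = 0 :=
  (stdOrthonormalBasis ℝ (LinearMap.ker (dform (d := d) m x).toLinearMap) i).2

/-- The Gram volume at `p` of vectors given in coordinates. -/
def pointVolume {ι : Type*} [Fintype ι] [DecidableEq ι] (p : M)
    (w : ι → TangentSpace (𝓡 d) p) : ℝ := gramVolume w

namespace IsWindowFlow

variable {m : M → ℝ} {ϑ δ η : ℝ} {θ : ℝ → M → M}

lemma contMDiff_time (hθ : IsWindowFlow (d := d) m ϑ δ η θ) (t : ℝ) :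
    ContMDiff (𝓡 d) (𝓡 d) ∞ (θ t) :=
  hθ.smooth.comp (contMDiff_const.prodMk contMDiff_id)

lemma mdifferentiableAt (hθ : IsWindowFlow (d := d) m ϑ δ η θ) (t : ℝ) (x : M) :
    MDifferentiableAt (𝓡 d) (𝓡 d) (θ t) x :=
  (hθ.contMDiff_time t).mdifferentiable (by simp) x

lemma hasMFDerivAt_curve (hθ : IsWindowFlow (d := d) m ϑ δ η θ) {x : M} {t : ℝ}
    (hx : m x ∈ Ioo (ϑ - δ - η) (ϑ + δ + η)) (ht : m x + t ∈ Ioo (ϑ - δ - η) (ϑ + δ + η)) :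
    HasMFDerivAt 𝓘(ℝ, ℝ) (𝓡 d) (fun t ↦ θ t x) t
      ((1 : ℝ →L[ℝ] ℝ).smulRight (normGrad (d := d) m (θ t x))) := by
  have hmem : t ∈ Ioo (ϑ - δ - η - m x) (ϑ + δ + η - m x) :=
    ⟨by linarith [ht.1], by linarith [ht.2]⟩
  exact (hθ.curve x hx t hmem).hasMFDerivAt (Ioo_mem_nhds hmem.1 hmem.2)

lemma mfderiv_add (hθ : IsWindowFlow (d := d) m ϑ δ η θ) (s t : ℝ) (x : M)
    (u : TangentSpace (𝓡 d) x) :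
    (mfderiv (𝓡 d) (𝓡 d) (θ (s + t)) x u : EuclideanSpace ℝ (Fin d)) =
      mfderiv (𝓡 d) (𝓡 d) (θ s) (θ t x) (mfderiv (𝓡 d) (𝓡 d) (θ t) x u) := by
  have h : θ (s + t) = θ s ∘ θ t := funext fun x ↦ hθ.add s t x
  rw [h]
  exact congrArg (fun L ↦ L u) (mfderiv_comp x (hθ.mdifferentiableAt s _) (hθ.mdifferentiableAt t x))

lemma mfderiv_injective (hθ : IsWindowFlow (d := d) m ϑ δ η θ) (t : ℝ) (x : M) :
    Function.Injective (mfderiv (𝓡 d) (𝓡 d) (θ t) x) := by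
  have h0 : θ (-t + t) = id := funext fun x ↦ by rw [neg_add_cancel, hθ.zero, id]
  have h : ∀ u : TangentSpace (𝓡 d) x, (mfderiv (𝓡 d) (𝓡 d) (θ (-t)) (θ t x)
      (mfderiv (𝓡 d) (𝓡 d) (θ t) x u) : EuclideanSpace ℝ (Fin d)) = u := by
    intro u
    rw [← hθ.mfderiv_add (-t) t x u, h0, mfderiv_id]
    rfl
  intro u v huv
  have hu := h u
  rw [huv, h v] at hu
  exact hu.symm

/-- The field is invariant under its own flow: differentiate θ_t(θ_r x) = θ_r(θ_t x) at r = 0. -/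
lemma mfderiv_normGrad (hθ : IsWindowFlow (d := d) m ϑ δ η θ) {x : M} {t : ℝ}
    (hx : m x ∈ Ioo (ϑ - δ - η) (ϑ + δ + η)) (ht : m x + t ∈ Ioo (ϑ - δ - η) (ϑ + δ + η)) :
    mfderiv (𝓡 d) (𝓡 d) (θ t) x (normGrad m x) = normGrad m (θ t x) := by
  have h1 : HasMFDerivAt 𝓘(ℝ, ℝ) (𝓡 d) (fun t ↦ θ t x) 0
      ((1 : ℝ →L[ℝ] ℝ).smulRight (normGrad (d := d) m (θ 0 x))) :=
    hθ.hasMFDerivAt_curve hx (by simpa using hx)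
  have h2 : HasMFDerivAt (𝓡 d) (𝓡 d) (θ t) (θ 0 x) (mfderiv (𝓡 d) (𝓡 d) (θ t) (θ 0 x)) :=
    (hθ.mdifferentiableAt t _).hasMFDerivAt
  have h3 := h2.comp (0 : ℝ) h1
  have hxt : m (θ t x) = m x + t := hθ.level x t hx ht
  have h4 : HasMFDerivAt 𝓘(ℝ, ℝ) (𝓡 d) (fun r ↦ θ r (θ t x)) 0
      ((1 : ℝ →L[ℝ] ℝ).smulRight (normGrad (d := d) m (θ 0 (θ t x)))) :=
    hθ.hasMFDerivAt_curve (by rw [hxt]; exact ht) (by rw [hxt, add_zero]; exact ht)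
  have h5 : (θ t ∘ fun r ↦ θ r x) = fun r ↦ θ r (θ t x) :=
    funext fun r ↦ by simp only [Function.comp, ← hθ.add, add_comm]
  rw [h5] at h3
  have h6 := congrArg (fun L : ℝ →L[ℝ] EuclideanSpace ℝ (Fin d) ↦ L 1) (hasMFDerivAt_unique h3 h4)
  have e0 := hθ.zero x
  have e1 := hθ.zero (θ t x)
  have h7 : (mfderiv (𝓡 d) (𝓡 d) (θ t) (θ 0 x) ((1 : ℝ) • normGrad m (θ 0 x)) :
      EuclideanSpace ℝ (Fin d)) = (1 : ℝ) • normGrad m (θ 0 (θ t x)) := h6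
  rw [e0, e1, one_smul, one_smul] at h7
  exact h7

/-- Differentiate m ∘ θ_t = m + t, which holds near x because the conditions on the levels are open.
In particular the flow preserves the tangent spaces of the levels. -/
lemma dform_mfderiv (hms : ContMDiff (𝓡 d) 𝓘(ℝ, ℝ) ∞ m) (hθ : IsWindowFlow (d := d) m ϑ δ η θ)
    {x : M} {t : ℝ}
    (hx : m x ∈ Ioo (ϑ - δ - η) (ϑ + δ + η)) (ht : m x + t ∈ Ioo (ϑ - δ - η) (ϑ + δ + η))
    (u : TangentSpace (𝓡 d) x) :
    dform (d := d) m (θ t x) (mfderiv (𝓡 d) (𝓡 d) (θ t) x u) = dform (d := d) m x u := by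
  have hmd : ∀ y, MDifferentiableAt (𝓡 d) 𝓘(ℝ, ℝ) m y := hms.mdifferentiable (by simp)
  have h1 : HasMFDerivAt (𝓡 d) 𝓘(ℝ, ℝ) (m ∘ θ t) x
      ((mfderiv (𝓡 d) 𝓘(ℝ, ℝ) m (θ t x)).comp (mfderiv (𝓡 d) (𝓡 d) (θ t) x)) :=
    (hmd _).hasMFDerivAt.comp x (hθ.mdifferentiableAt t x).hasMFDerivAt
  have h2 : HasMFDerivAt (𝓡 d) 𝓘(ℝ, ℝ) (fun y ↦ m y + t) x (mfderiv (𝓡 d) 𝓘(ℝ, ℝ) m x) := by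
    have h := (hmd x).hasMFDerivAt.add
      (hasMFDerivAt_const (I := 𝓡 d) (I' := 𝓘(ℝ, ℝ)) (M := M) t x)
    exact h.congr_mfderiv (ContinuousLinearMap.ext fun v ↦
      add_zero (mfderiv (𝓡 d) 𝓘(ℝ, ℝ) m x v : ℝ))
  have h3 : (m ∘ θ t) =ᶠ[𝓝 x] fun y ↦ m y + t := by
    filter_upwards [hms.continuous.continuousAt.eventually (isOpen_Ioo.mem_nhds hx),
      (hms.continuous.add continuous_const).continuousAt.eventually (isOpen_Ioo.mem_nhds ht)]
      with y hy hy'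
    exact hθ.level y t hy hy'
  exact congrArg (fun L : TangentSpace (𝓡 d) x →L[ℝ] ℝ ↦ L u)
    (hasMFDerivAt_unique h1 (h2.congr_of_eventuallyEq h3))

end IsWindowFlow
end Reflection

/-! ### The Jacobian of the reflection and the weight ψ. -/

section ReflectionJacobian

variable {d : ℕ} {M : Type*} [TopologicalSpace M] [T2Space M]
  [ChartedSpace (EuclideanSpace ℝ (Fin d)) M]
  [IsManifold (𝓡 d) ∞ M] [RiemannianBundle (fun x : M ↦ TangentSpace (𝓡 d) x)]
  [IsContMDiffRiemannianBundle (𝓡 d) ∞ (EuclideanSpace ℝ (Fin d))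
      (fun x : M ↦ TangentSpace (𝓡 d) x)]

/-- The Jacobian `√det(DRᵀ DR)` of a self-map of `M`. -/
def jacobian (d : ℕ) {M : Type*} [TopologicalSpace M]
    [ChartedSpace (EuclideanSpace ℝ (Fin d)) M] [IsManifold (𝓡 d) ∞ M]
    [RiemannianBundle (fun x : M ↦ TangentSpace (𝓡 d) x)] (R : M → M) (y : M) : ℝ :=
  (mfderiv (𝓡 d) (𝓡 d) R y).toLinearMap.normDet

/-- A tangent vector, as a vector of the model space. -/
def modelVec {x : M} (v : TangentSpace (𝓡 d) x) : EuclideanSpace ℝ (Fin d) := v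

lemma pointVolume_congr {ι : Type*} [Fintype ι] [DecidableEq ι] {p q : M} (h : p = q)
    (w w' : ι → EuclideanSpace ℝ (Fin d)) (hw : w = w') :
    pointVolume (d := d) p w = pointVolume (d := d) q w' := by
  subst h hw; rfl

lemma jacobian_mul_pointVolume {ι : Type*} [Fintype ι] [DecidableEq ι] (R : M → M) (y : M)
    (hι : Fintype.card ι = d) (w : ι → TangentSpace (𝓡 d) y) :
    pointVolume (d := d) (R y) (fun k ↦ mfderiv (𝓡 d) (𝓡 d) R y (w k)) =
      jacobian d R y * pointVolume (d := d) y w :=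
  gramVolume_comp (mfderiv (𝓡 d) (𝓡 d) R y).toLinearMap w (hι.trans (finrank_tangentSpace y).symm)

namespace IsWindowFlow

variable {m : M → ℝ} {ϑ δ η : ℝ} {θ : ℝ → M → M}

lemma contMDiff_flowReflection (hms : ContMDiff (𝓡 d) 𝓘(ℝ, ℝ) ∞ m)
    (hθ : IsWindowFlow (d := d) m ϑ δ η θ) :
    ContMDiff (𝓡 d) (𝓡 d) ∞ (flowReflection m ϑ θ) :=
  hθ.smooth.comp ((contMDiff_const.mul (contMDiff_const.sub hms)).prodMk contMDiff_id)

lemma level_flowReflection (hθ : IsWindowFlow (d := d) m ϑ δ η θ) {y : M}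
    (hy : m y ∈ Ioo (ϑ - δ) (ϑ + δ)) : m (flowReflection m ϑ θ y) = 2 * ϑ - m y := by
  have := hθ.pos
  rw [flowReflection, hθ.level y _ ⟨by linarith [hy.1], by linarith [hy.2]⟩
    ⟨by linarith [hy.2], by linarith [hy.1]⟩]
  ring

lemma flowReflection_mem (hθ : IsWindowFlow (d := d) m ϑ δ η θ) {y : M}
    (hy : m y ∈ Ioo (ϑ - δ) (ϑ + δ)) : m (flowReflection m ϑ θ y) ∈ Ioo (ϑ - δ) (ϑ + δ) := by
  rw [hθ.level_flowReflection hy]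
  exact ⟨by linarith [hy.2], by linarith [hy.1]⟩

lemma flowReflection_flowReflection (hθ : IsWindowFlow (d := d) m ϑ δ η θ) {y : M}
    (hy : m y ∈ Ioo (ϑ - δ) (ϑ + δ)) :
    flowReflection m ϑ θ (flowReflection m ϑ θ y) = y := by
  rw [flowReflection, hθ.level_flowReflection hy, flowReflection, ← hθ.add]
  have : 2 * (ϑ - (2 * ϑ - m y)) + 2 * (ϑ - m y) = 0 := by ring
  rw [this, hθ.zero]

/-- Chain rule for θ(τ(y), y) with τ = 2(ϑ - m): the time variable contributes -2 dm(u) times the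
renormalized gradient at the image. -/
lemma mfderiv_flowReflection (hms : ContMDiff (𝓡 d) 𝓘(ℝ, ℝ) ∞ m)
    (hθ : IsWindowFlow (d := d) m ϑ δ η θ) {y : M} (hy : m y ∈ Ioo (ϑ - δ) (ϑ + δ))
    (u : TangentSpace (𝓡 d) y) :
    modelVec (mfderiv (𝓡 d) (𝓡 d) (flowReflection m ϑ θ) y u) =
      modelVec (mfderiv (𝓡 d) (𝓡 d) (θ (2 * (ϑ - m y))) y u) -
        (2 * dform (d := d) m y u) • modelVec (normGrad (d := d) m (flowReflection m ϑ θ y)) := by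
  have hη := hθ.pos
  have hmd : MDifferentiableAt (𝓡 d) 𝓘(ℝ, ℝ) m y := hms.mdifferentiable (by simp) y
  have hτ : HasMFDerivAt (𝓡 d) 𝓘(ℝ, ℝ) (fun z ↦ 2 * (ϑ - m z)) y
      ((-2 : ℝ) • dform (d := d) m y) := by
    have h1 : HasMFDerivAt 𝓘(ℝ, ℝ) 𝓘(ℝ, ℝ) (fun t : ℝ ↦ 2 * (ϑ - t)) (m y)
        ((1 : ℝ →L[ℝ] ℝ).smulRight (-2 : ℝ)) := by
      apply HasFDerivAt.hasMFDerivAt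
      have : HasDerivAt (fun t : ℝ ↦ 2 * (ϑ - t)) (-2) (m y) := by
        simpa using ((hasDerivAt_id (m y)).const_sub ϑ).const_mul 2
      exact this.hasFDerivAt
    refine (h1.comp y hmd.hasMFDerivAt).congr_mfderiv (ContinuousLinearMap.ext fun v ↦ ?_)
    change dform (d := d) m y v * (-2) = -2 * dform (d := d) m y v
    ring
  have hU : MDifferentiableAt (𝓘(ℝ, ℝ).prod (𝓡 d)) (𝓡 d) (Function.uncurry θ)
      (2 * (ϑ - m y), y) := hθ.smooth.mdifferentiable (by simp) _
  have hc := hU.hasMFDerivAt.comp (f := fun z ↦ (2 * (ϑ - m z), id z)) y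
    (hτ.prodMk (hasMFDerivAt_id y))
  have h2 : modelVec (mfderiv (𝓡 d) (𝓡 d) (flowReflection m ϑ θ) y u) =
      modelVec (mfderiv (𝓘(ℝ, ℝ).prod (𝓡 d)) (𝓡 d) (Function.uncurry θ) (2 * (ϑ - m y), y)
        ((-2 : ℝ) * dform (d := d) m y u, u)) :=
    congrArg (fun L : EuclideanSpace ℝ (Fin d) →L[ℝ] EuclideanSpace ℝ (Fin d) ↦ L u) hc.mfderiv
  have h3 := mfderiv_prod_eq_add_apply (I := 𝓘(ℝ, ℝ)) (I' := 𝓡 d) (I'' := 𝓡 d) hU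
    (v := ((-2 : ℝ) * dform (d := d) m y u, u))
  have h4 := (hθ.hasMFDerivAt_curve (x := y) (t := 2 * (ϑ - m y))
    ⟨by linarith [hy.1], by linarith [hy.2]⟩ ⟨by linarith [hy.2], by linarith [hy.1]⟩).mfderiv
  have h5 : modelVec (mfderiv 𝓘(ℝ, ℝ) (𝓡 d) (fun t ↦ θ t y) (2 * (ϑ - m y))
      ((-2 : ℝ) * dform (d := d) m y u)) =
      ((-2 : ℝ) * dform (d := d) m y u) • modelVec (normGrad (d := d) m (θ (2 * (ϑ - m y)) y)) :=
    congrArg (fun L : ℝ →L[ℝ] EuclideanSpace ℝ (Fin d) ↦ L ((-2 : ℝ) * dform (d := d) m y u)) h4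
  have h6 : modelVec (mfderiv (𝓡 d) (𝓡 d) (flowReflection m ϑ θ) y u) =
      modelVec (mfderiv 𝓘(ℝ, ℝ) (𝓡 d) (fun t ↦ θ t y) (2 * (ϑ - m y))
        ((-2 : ℝ) * dform (d := d) m y u)) +
      modelVec (mfderiv (𝓡 d) (𝓡 d) (θ (2 * (ϑ - m y))) y u) := h2.trans h3
  rw [h6, h5, neg_mul, neg_smul, neg_add_eq_sub]
  rfl

/-- The flow expression of `levelWeight`. -/
lemma levelWeight_eq (hms : ContMDiff (𝓡 d) 𝓘(ℝ, ℝ) ∞ m) (hδ : 0 < δ)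
    (hθ : IsWindowFlow (d := d) m ϑ δ η θ) {x : M} (hx : m x = ϑ) {t : ℝ}
    (ht : t ∈ Ioo (ϑ - δ) (ϑ + δ)) :
    levelWeight d m (Ioo (ϑ - δ) (ϑ + δ)) ϑ t x =
      pointVolume (d := d) (θ (t - ϑ) x)
        (fun k ↦ mfderiv (𝓡 d) (𝓡 d) (θ (t - ϑ)) x (levelFrame d m x k)) := by
  have hη := hθ.pos
  have hϑ : ϑ ∈ Ioo (ϑ - δ) (ϑ + δ) := ⟨by linarith, by linarith⟩
  have hmx : m x ∈ Ioo (ϑ - δ - η) (ϑ + δ + η) := ⟨by linarith, by linarith⟩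
  have hmt : m x + (t - ϑ) ∈ Ioo (ϑ - δ - η) (ϑ + δ + η) :=
    ⟨by linarith [ht.1], by linarith [ht.2]⟩
  have hF : ∀ τ ∈ Ioo (ϑ - δ) (ϑ + δ), ∀ z, |m z - ϑ| < η →
      levelFlow d m (Ioo (ϑ - δ) (ϑ + δ)) ϑ τ z = θ (τ - ϑ) z :=
    fun τ hτ z hz ↦ hθ.levelFlow_eq hms hϑ hτ hz
  have hxη : |m x - ϑ| < η := by rw [hx, sub_self, abs_zero]; exact hη
  refine pointVolume_congr (hF t ht x hxη) _ _ (funext fun k ↦ ?_)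
  cases k with
  | none =>
    have h1 : (fun τ ↦ levelFlow d m (Ioo (ϑ - δ) (ϑ + δ)) ϑ τ x) =ᶠ[𝓝 t]
        fun τ ↦ θ (τ - ϑ) x := by
      filter_upwards [isOpen_Ioo.mem_nhds ht] with τ hτ using hF τ hτ x hxη
    have h2 := hθ.hasMFDerivAt_curve hmx hmt
    have h3 : HasMFDerivAt 𝓘(ℝ, ℝ) 𝓘(ℝ, ℝ) (fun τ : ℝ ↦ τ - ϑ) t (1 : ℝ →L[ℝ] ℝ) :=
      ((hasFDerivAt_id t).sub_const ϑ).hasMFDerivAt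
    have h4 := ((h2.comp t h3).congr_of_eventuallyEq h1).mfderiv
    have h5 : (mfderiv 𝓘(ℝ, ℝ) (𝓡 d) (fun τ ↦ levelFlow d m (Ioo (ϑ - δ) (ϑ + δ)) ϑ τ x) t
        (1 : ℝ) : EuclideanSpace ℝ (Fin d)) =
        (1 : ℝ) • (normGrad (d := d) m (θ (t - ϑ) x) : EuclideanSpace ℝ (Fin d)) :=
      congrArg (fun L : ℝ →L[ℝ] EuclideanSpace ℝ (Fin d) ↦ L 1) h4
    rw [one_smul] at h5
    exact h5.trans (hθ.mfderiv_normGrad hmx hmt).symm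
  | some i =>
    have h1 : (fun z ↦ levelFlow d m (Ioo (ϑ - δ) (ϑ + δ)) ϑ t z) =ᶠ[𝓝 x] θ (t - ϑ) := by
      have : ∀ᶠ z in 𝓝 x, |m z - ϑ| < η :=
        (hms.continuous.sub continuous_const).abs.continuousAt.eventually (gt_mem_nhds hxη)
      filter_upwards [this] with z hz using hF t ht z hz
    exact congrArg (fun L : EuclideanSpace ℝ (Fin d) →L[ℝ] EuclideanSpace ℝ (Fin d) ↦
      L (levelFrame d m x (some i))) h1.mfderiv_eq

lemma levelWeight_pos (hms : ContMDiff (𝓡 d) 𝓘(ℝ, ℝ) ∞ m) (hδ : 0 < δ)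
    (hθ : IsWindowFlow (d := d) m ϑ δ η θ) {x : M} (hx : m x = ϑ) {t : ℝ}
    (ht : t ∈ Ioo (ϑ - δ) (ϑ + δ)) :
    0 < levelWeight d m (Ioo (ϑ - δ) (ϑ + δ)) ϑ t x := by
  have hη := hθ.pos
  rw [hθ.levelWeight_eq hms hδ hx ht]
  refine gramVolume_pos ((linearIndependent_levelFrame (hθ.regular x ?_)).map'
    (mfderiv (𝓡 d) (𝓡 d) (θ (t - ϑ)) x).toLinearMap
    (LinearMap.ker_eq_bot.2 (hθ.mfderiv_injective _ x)))
  exact ⟨by linarith, by linarith⟩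

/-- The ratio of the weights is the Jacobian of the reflection. -/
lemma levelWeight_reflect (hms : ContMDiff (𝓡 d) 𝓘(ℝ, ℝ) ∞ m) (hδ : 0 < δ)
    (hθ : IsWindowFlow (d := d) m ϑ δ η θ) {x : M} (hx : m x = ϑ) {t : ℝ}
    (ht : t ∈ Ioo (ϑ - δ) (ϑ + δ)) :
    levelWeight d m (Ioo (ϑ - δ) (ϑ + δ)) ϑ (2 * ϑ - t) x =
      jacobian d (flowReflection m ϑ θ) (θ (t - ϑ) x) *
        levelWeight d m (Ioo (ϑ - δ) (ϑ + δ)) ϑ t x := by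
  have hη := hθ.pos
  have ht' : 2 * ϑ - t ∈ Ioo (ϑ - δ) (ϑ + δ) := ⟨by linarith [ht.2], by linarith [ht.1]⟩
  have hmx : m x ∈ Ioo (ϑ - δ - η) (ϑ + δ + η) := ⟨by linarith, by linarith⟩
  have hmt : m x + (t - ϑ) ∈ Ioo (ϑ - δ - η) (ϑ + δ + η) :=
    ⟨by linarith [ht.1], by linarith [ht.2]⟩
  have hmt' : m x + (2 * ϑ - t - ϑ) ∈ Ioo (ϑ - δ - η) (ϑ + δ + η) :=
    ⟨by linarith [ht.2], by linarith [ht.1]⟩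
  have hmy : m (θ (t - ϑ) x) = t := by rw [hθ.level x _ hmx hmt]; linarith
  have hy : m (θ (t - ϑ) x) ∈ Ioo (ϑ - δ) (ϑ + δ) := by rw [hmy]; exact ht
  rw [hθ.levelWeight_eq hms hδ hx ht, hθ.levelWeight_eq hms hδ hx ht',
    ← jacobian_mul_pointVolume _ _ ((card_levelFrame (hθ.regular x hmx)).trans
      (finrank_tangentSpace x))]
  have hs : 2 * (ϑ - m (θ (t - ϑ) x)) + (t - ϑ) = 2 * ϑ - t - ϑ := by rw [hmy]; ring
  have hR : flowReflection m ϑ θ (θ (t - ϑ) x) = θ (2 * ϑ - t - ϑ) x := by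
    rw [flowReflection, ← hθ.add, hs]
  -- On the transported frame the reflection reverses ∂_t, because one copy of the field comes from
  -- the flow and two are subtracted by the varying time, and it fixes the directions e_i, on which
  -- dm vanishes.
  let c : Option (Fin (Module.finrank ℝ (LinearMap.ker (dform (d := d) m x).toLinearMap))) → ℝ :=
    fun k ↦ match k with
      | none => -1
      | some _ => 1
  have hkey : ∀ k, modelVec (mfderiv (𝓡 d) (𝓡 d) (flowReflection m ϑ θ) (θ (t - ϑ) x)
      (mfderiv (𝓡 d) (𝓡 d) (θ (t - ϑ)) x (levelFrame d m x k))) =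
      c k • modelVec (mfderiv (𝓡 d) (𝓡 d) (θ (2 * ϑ - t - ϑ)) x (levelFrame d m x k)) := by
    intro k
    have h0 : modelVec (mfderiv (𝓡 d) (𝓡 d) (θ (2 * (ϑ - m (θ (t - ϑ) x)))) (θ (t - ϑ) x)
        (mfderiv (𝓡 d) (𝓡 d) (θ (t - ϑ)) x (levelFrame d m x k))) =
        modelVec (mfderiv (𝓡 d) (𝓡 d) (θ (2 * ϑ - t - ϑ)) x (levelFrame d m x k)) := by
      rw [← hs]
      exact (hθ.mfderiv_add _ _ x _).symm
    have h1 := hθ.mfderiv_flowReflection hms hy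
      (mfderiv (𝓡 d) (𝓡 d) (θ (t - ϑ)) x (levelFrame d m x k))
    rw [hθ.dform_mfderiv hms hmx hmt, h0, hR] at h1
    refine h1.trans ?_
    cases k with
    | none =>
      have h2 : dform (d := d) m x (levelFrame d m x none) = 1 :=
        dform_normGrad (hθ.regular x hmx)
      have h3 : modelVec (mfderiv (𝓡 d) (𝓡 d) (θ (2 * ϑ - t - ϑ)) x (levelFrame d m x none)) =
          modelVec (normGrad (d := d) m (θ (2 * ϑ - t - ϑ) x)) :=
        hθ.mfderiv_normGrad hmx hmt'
      rw [h2, ← h3]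
      simp only [c]
      module
    | some i =>
      rw [dform_levelFrame_some, mul_zero, zero_smul, sub_zero]
      exact (one_smul ℝ _).symm
  refine Eq.trans ?_ (pointVolume_congr hR.symm _ _ (funext fun k ↦ (hkey k).symm))
  refine (gramVolume_smul c (fun k ↦ ?_) _).symm
  cases k <;> simp [c]

end IsWindowFlow
end ReflectionJacobian

/-! ### Smoothness of the Jacobian, and the cut-off operator in terms of the reflection. -/

section ReflectionOperator

variable {d : ℕ} {M : Type*} [TopologicalSpace M] [T2Space M]
  [ChartedSpace (EuclideanSpace ℝ (Fin d)) M]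
  [IsManifold (𝓡 d) ∞ M] [RiemannianBundle (fun x : M ↦ TangentSpace (𝓡 d) x)]
  [IsContMDiffRiemannianBundle (𝓡 d) ∞ (EuclideanSpace ℝ (Fin d))
      (fun x : M ↦ TangentSpace (𝓡 d) x)]

/-- The square root is smooth where the Gram determinant is positive. Fields along a map are
allowed, so that the lemma also covers the image of a frame under a differential. -/
lemma contMDiffAt_gramVolume {f : M → M} {v : Fin d → (x : M) → TangentSpace (𝓡 d) (f x)} {x₀ : M}
    (hv : ∀ i, ContMDiffAt (𝓡 d) (𝓡 d).tangent ∞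
      (fun x ↦ (⟨f x, v i x⟩ : TangentBundle (𝓡 d) M)) x₀)
    (h : 0 < gramVolume fun i ↦ v i x₀) :
    ContMDiffAt (𝓡 d) 𝓘(ℝ, ℝ) ∞ (fun x ↦ gramVolume fun i ↦ v i x) x₀ := by
  have hdet : ContMDiffAt (𝓡 d) 𝓘(ℝ, ℝ) ∞
      (fun x ↦ (Matrix.of fun i j ↦ inner ℝ (v i x) (v j x)).det) x₀ :=
    contMDiffAt_det fun i j ↦ (hv i).inner_bundle (hv j)
  have hpos : 0 < (Matrix.of fun i j ↦ inner ℝ (v i x₀) (v j x₀)).det := Real.sqrt_pos.1 h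
  exact (Real.contDiffAt_sqrt hpos.ne').contMDiffAt.comp x₀ hdet

lemma gramVolume_chartFrame_pos {x₀ x : M}
    (hx : x ∈ (chartAt (EuclideanSpace ℝ (Fin d)) x₀).source) :
    0 < gramVolume fun i ↦ chartFrame d x₀ i x :=
  gramVolume_pos ((isLocalFrameOn_chartFrame x₀).linearIndependent hx)

/-- The Jacobian is the volume of the image of the chart frame divided by the volume of the frame;
both are smooth and the second is positive. -/
lemma contMDiffAt_jacobian {R : M → M} (hR : ContMDiff (𝓡 d) (𝓡 d) ∞ R) {x₀ : M}
    (h : 0 < jacobian d R x₀) : ContMDiffAt (𝓡 d) 𝓘(ℝ, ℝ) ∞ (jacobian d R) x₀ := by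
  have hx₀ := mem_chart_source (EuclideanSpace ℝ (Fin d)) x₀
  have hprod : ∀ x, (gramVolume fun i ↦ mfderiv (𝓡 d) (𝓡 d) R x (chartFrame d x₀ i x)) =
      jacobian d R x * gramVolume fun i ↦ chartFrame d x₀ i x := fun x ↦
    jacobian_mul_pointVolume R x (Fintype.card_fin d) _
  have h1 : ContMDiffAt (𝓡 d) 𝓘(ℝ, ℝ) ∞
      (fun x ↦ gramVolume fun i ↦ mfderiv (𝓡 d) (𝓡 d) R x (chartFrame d x₀ i x)) x₀ := by
    refine contMDiffAt_gramVolume (f := R)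
      (v := fun i x ↦ mfderiv (𝓡 d) (𝓡 d) R x (chartFrame d x₀ i x)) (fun i ↦ ?_) ?_
    · exact (hR.contMDiff_tangentMap (by simp)).contMDiffAt.comp x₀ (contMDiffAt_chartFrame hx₀ i)
    · rw [hprod]
      exact mul_pos h (gramVolume_chartFrame_pos hx₀)
  have h2 : ContMDiffAt (𝓡 d) 𝓘(ℝ, ℝ) ∞ (fun x ↦ gramVolume fun i ↦ chartFrame d x₀ i x) x₀ :=
    contMDiffAt_gramVolume (f := id) (v := fun i x ↦ chartFrame d x₀ i x)
      (fun i ↦ contMDiffAt_chartFrame hx₀ i) (gramVolume_chartFrame_pos hx₀)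
  refine (h1.div₀ h2 (gramVolume_chartFrame_pos hx₀).ne').congr_of_eventuallyEq ?_
  filter_upwards [(chartAt (EuclideanSpace ℝ (Fin d)) x₀).open_source.mem_nhds hx₀] with x hx
  exact (eq_div_iff (gramVolume_chartFrame_pos hx).ne').2 (hprod x).symm

namespace IsWindowFlow

variable {m : M → ℝ} {ϑ δ η : ℝ} {θ : ℝ → M → M}

lemma level_projection (hθ : IsWindowFlow (d := d) m ϑ δ η θ) {y : M}
    (hy : m y ∈ Ioo (ϑ - δ) (ϑ + δ)) : m (θ (ϑ - m y) y) = ϑ := by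
  have := hθ.pos
  rw [hθ.level y _ ⟨by linarith [hy.1], by linarith [hy.2]⟩
    ⟨by linarith [hy.1, hy.2], by linarith [hy.2, hy.1]⟩]
  ring

/-- Replaces the weights of the parametrization, evaluated at the projection of y to the level ϑ, by
a quantity attached to y alone. -/
lemma levelWeight_ratio (hms : ContMDiff (𝓡 d) 𝓘(ℝ, ℝ) ∞ m) (hδ : 0 < δ)
    (hθ : IsWindowFlow (d := d) m ϑ δ η θ) {y : M} (hy : m y ∈ Ioo (ϑ - δ) (ϑ + δ)) :
    levelWeight d m (Ioo (ϑ - δ) (ϑ + δ)) ϑ (2 * ϑ - m y) (θ (ϑ - m y) y) /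
      levelWeight d m (Ioo (ϑ - δ) (ϑ + δ)) ϑ (m y) (θ (ϑ - m y) y) =
      jacobian d (flowReflection m ϑ θ) y := by
  have hx := hθ.level_projection hy
  have h := hθ.levelWeight_reflect hms hδ hx hy
  have h0 : m y - ϑ + (ϑ - m y) = 0 := by ring
  rw [← hθ.add, h0, hθ.zero] at h
  rw [h, mul_div_cancel_right₀ _ (hθ.levelWeight_pos hms hδ hx hy).ne']

lemma jacobian_pos (hms : ContMDiff (𝓡 d) 𝓘(ℝ, ℝ) ∞ m) (hδ : 0 < δ)
    (hθ : IsWindowFlow (d := d) m ϑ δ η θ) {y : M} (hy : m y ∈ Ioo (ϑ - δ) (ϑ + δ)) :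
    0 < jacobian d (flowReflection m ϑ θ) y := by
  rw [← hθ.levelWeight_ratio hms hδ hy]
  have hx := hθ.level_projection hy
  exact div_pos (hθ.levelWeight_pos hms hδ hx ⟨by linarith [hy.2], by linarith [hy.1]⟩)
    (hθ.levelWeight_pos hms hδ hx hy)

/-- The points y and R y lie on the same integral curve, so their ratios of weights are reciprocal.
-/
lemma jacobian_mul_jacobian (hms : ContMDiff (𝓡 d) 𝓘(ℝ, ℝ) ∞ m) (hδ : 0 < δ)
    (hθ : IsWindowFlow (d := d) m ϑ δ η θ) {y : M} (hy : m y ∈ Ioo (ϑ - δ) (ϑ + δ)) :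
    jacobian d (flowReflection m ϑ θ) y *
      jacobian d (flowReflection m ϑ θ) (flowReflection m ϑ θ y) = 1 := by
  have hx := hθ.level_projection hy
  have h := hθ.levelWeight_ratio hms hδ (hθ.flowReflection_mem hy)
  have h1 : 2 * ϑ - (2 * ϑ - m y) = m y := by ring
  have h2 : ϑ - (2 * ϑ - m y) + 2 * (ϑ - m y) = ϑ - m y := by ring
  have h3 : θ (ϑ - (2 * ϑ - m y)) (flowReflection m ϑ θ y) = θ (ϑ - m y) y := by
    rw [flowReflection, ← hθ.add, h2]
  rw [hθ.level_flowReflection hy, h1, h3] at h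
  rw [← h, ← hθ.levelWeight_ratio hms hδ hy, div_mul_div_cancel₀
    (hθ.levelWeight_pos hms hδ hx hy).ne', div_self
    (hθ.levelWeight_pos hms hδ hx ⟨by linarith [hy.2], by linarith [hy.1]⟩).ne']

/-- The cut-off operator in the window, in terms of the reflection. -/
lemma awwOp_eq (hms : ContMDiff (𝓡 d) 𝓘(ℝ, ℝ) ∞ m) (hδ : 0 < δ)
    (hθ : IsWindowFlow (d := d) m ϑ δ η θ) (p : ℝ≥0∞) (s : ℝ → ℝ) (f : M → ℝ) {y : M}
    (hy : m y ∈ Ioo (ϑ - δ) (ϑ + δ)) :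
    awwOp d p m δ s ϑ f y = s (m y - ϑ) ^ 2 * f y + s (m y - ϑ) * s (ϑ - m y) *
      jacobian d (flowReflection m ϑ θ) y ^ p.toReal⁻¹ * f (flowReflection m ϑ θ y) := by
  have hη := hθ.pos
  have hϑ : ϑ ∈ Ioo (ϑ - δ) (ϑ + δ) := ⟨by linarith, by linarith⟩
  have hy' : 2 * ϑ - m y ∈ Ioo (ϑ - δ) (ϑ + δ) := ⟨by linarith [hy.2], by linarith [hy.1]⟩
  have hx := hθ.level_projection hy
  have hF : ∀ τ ∈ Ioo (ϑ - δ) (ϑ + δ), levelFlow d m (Ioo (ϑ - δ) (ϑ + δ)) ϑ τ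
      (θ (ϑ - m y) y) = θ (τ - m y) y := by
    intro τ hτ
    rw [hθ.levelFlow_eq hms hϑ hτ (by rw [hx, sub_self, abs_zero]; exact hη), ← hθ.add]
    congr 1
    ring
  have h2 : levelFlow d m (Ioo (ϑ - δ) (ϑ + δ)) (m y) ϑ y = θ (ϑ - m y) y :=
    hθ.levelFlow_eq hms hy hϑ (by rw [sub_self, abs_zero]; exact hη)
  have h3 : 2 * ϑ - m y - m y = 2 * (ϑ - m y) := by ring
  rw [awwOp, if_neg (not_le.2 hy.2), if_neg (not_le.2 hy.1), awwWeighted, h2, hF _ hy, hF _ hy',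
    sub_self, hθ.zero, hθ.levelWeight_ratio hms hδ hy, h3]
  rfl

end IsWindowFlow
end ReflectionOperator

/-! ### The Riemannian measure -/

section ChartVolume

variable {d : ℕ} {M : Type*} [TopologicalSpace M] [T2Space M]
  [ChartedSpace (EuclideanSpace ℝ (Fin d)) M]
  [IsManifold (𝓡 d) ∞ M] [RiemannianBundle (fun x : M ↦ TangentSpace (𝓡 d) x)]

/-- The density `√(det g_ij)` of the Riemannian measure in the preferred chart at `x₀`. -/
def chartDensity (d : ℕ) {M : Type*} [TopologicalSpace M]
    [ChartedSpace (EuclideanSpace ℝ (Fin d)) M] [IsManifold (𝓡 d) ∞ M]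
    [RiemannianBundle (fun x : M ↦ TangentSpace (𝓡 d) x)] (x₀ : M)
    (y : EuclideanSpace ℝ (Fin d)) : ℝ :=
  gramVolume fun i : Fin d ↦ mfderiv 𝓘(ℝ, EuclideanSpace ℝ (Fin d)) (𝓡 d)
    (extChartAt (𝓡 d) x₀).symm y (EuclideanSpace.basisFun (Fin d) ℝ i)

lemma mdifferentiableAt_extChartAt_symm' {x₀ : M} {y : EuclideanSpace ℝ (Fin d)}
    (hy : y ∈ (extChartAt (𝓡 d) x₀).target) :
    MDifferentiableAt 𝓘(ℝ, EuclideanSpace ℝ (Fin d)) (𝓡 d) (extChartAt (𝓡 d) x₀).symm y := by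
  have h := (contMDiffOn_extChartAt_symm (I := 𝓡 d) (n := ∞) x₀).contMDiffAt
    ((isOpen_extChartAt_target x₀).mem_nhds hy)
  exact h.mdifferentiableAt (by simp)

lemma mfderiv_extChartAt_symm_basisFun {x₀ : M} {y : EuclideanSpace ℝ (Fin d)}
    (hy : y ∈ (extChartAt (𝓡 d) x₀).target) (i : Fin d) :
    mfderiv 𝓘(ℝ, EuclideanSpace ℝ (Fin d)) (𝓡 d) (extChartAt (𝓡 d) x₀).symm y
      (EuclideanSpace.basisFun (Fin d) ℝ i) =
        chartFrame d x₀ i ((extChartAt (𝓡 d) x₀).symm y) := by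
  have hx : (extChartAt (𝓡 d) x₀).symm y ∈ (chartAt (EuclideanSpace ℝ (Fin d)) x₀).source := by
    rw [← extChartAt_source (𝓡 d)]
    exact (extChartAt (𝓡 d) x₀).map_target hy
  have h := TangentBundle.symmL_trivializationAt (I := 𝓡 d) hx
  rw [(extChartAt (𝓡 d) x₀).right_inv hy] at h
  have hr : range (𝓡 d) = univ := by simp
  rw [hr, mfderivWithin_univ] at h
  have h2 : chartFrame d x₀ i ((extChartAt (𝓡 d) x₀).symm y) =
      (trivializationAt (EuclideanSpace ℝ (Fin d)) (TangentSpace (𝓡 d)) x₀).symmL ℝ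
        ((extChartAt (𝓡 d) x₀).symm y) (EuclideanSpace.basisFun (Fin d) ℝ i) := by
    have hx' : (extChartAt (𝓡 d) x₀).symm y ∈
      (trivializationAt (EuclideanSpace ℝ (Fin d)) (TangentSpace (𝓡 d)) x₀).baseSet := hx
    rw [chartFrame, Trivialization.localFrame_apply_of_mem_baseSet _ _ hx', Trivialization.basisAt,
      Module.Basis.map_apply, OrthonormalBasis.coe_toBasis, Trivialization.symmL_apply]
    · rfl
    · exact hx'
  rw [h2]
  exact congrArg (fun L : EuclideanSpace ℝ (Fin d) →L[ℝ] EuclideanSpace ℝ (Fin d) ↦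
    L (EuclideanSpace.basisFun (Fin d) ℝ i)) h.symm

lemma chartDensity_eq {x₀ : M} {y : EuclideanSpace ℝ (Fin d)}
    (hy : y ∈ (extChartAt (𝓡 d) x₀).target) :
    chartDensity d x₀ y = gramVolume fun i ↦ chartFrame d x₀ i ((extChartAt (𝓡 d) x₀).symm y) := by
  simp only [chartDensity, mfderiv_extChartAt_symm_basisFun hy]

variable [IsContMDiffRiemannianBundle (𝓡 d) ∞ (EuclideanSpace ℝ (Fin d))
      (fun x : M ↦ TangentSpace (𝓡 d) x)]

lemma chartDensity_pos {x₀ : M} {y : EuclideanSpace ℝ (Fin d)}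
    (hy : y ∈ (extChartAt (𝓡 d) x₀).target) : 0 < chartDensity d x₀ y := by
  rw [chartDensity_eq hy]
  apply gramVolume_chartFrame_pos
  rw [← extChartAt_source (𝓡 d)]
  exact (extChartAt (𝓡 d) x₀).map_target hy

lemma continuousOn_chartDensity (x₀ : M) :
    ContinuousOn (chartDensity d x₀) (extChartAt (𝓡 d) x₀).target := by
  have h : ContinuousOn (fun x ↦ gramVolume fun i ↦ chartFrame d x₀ i x)
      (extChartAt (𝓡 d) x₀).source := by
    intro x hx
    rw [extChartAt_source] at hx
    exact (contMDiffAt_gramVolume (f := id) (v := fun i x ↦ chartFrame d x₀ i x)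
      (fun i ↦ contMDiffAt_chartFrame hx i)
      (gramVolume_chartFrame_pos hx)).continuousAt.continuousWithinAt
  exact (h.comp (continuousOn_extChartAt_symm x₀) (extChartAt (𝓡 d) x₀).mapsTo_symm).congr
    fun y hy ↦ chartDensity_eq hy

/-- The density transforms by the Jacobian under maps. -/
lemma chartDensity_comp {R : M → M} {x₀ y₀ : M} {y : EuclideanSpace ℝ (Fin d)}
    (hy : y ∈ (extChartAt (𝓡 d) x₀).target)
    (hR : MDifferentiableAt (𝓡 d) (𝓡 d) R ((extChartAt (𝓡 d) x₀).symm y))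
    (hRy : R ((extChartAt (𝓡 d) x₀).symm y) ∈ (extChartAt (𝓡 d) y₀).source) :
    DifferentiableAt ℝ (extChartAt (𝓡 d) y₀ ∘ R ∘ (extChartAt (𝓡 d) x₀).symm) y ∧
    chartDensity d y₀ (extChartAt (𝓡 d) y₀ (R ((extChartAt (𝓡 d) x₀).symm y))) *
      |(fderiv ℝ (extChartAt (𝓡 d) y₀ ∘ R ∘ (extChartAt (𝓡 d) x₀).symm) y).det| =
      jacobian d R ((extChartAt (𝓡 d) x₀).symm y) * chartDensity d x₀ y := by
  set h := extChartAt (𝓡 d) y₀ ∘ R ∘ (extChartAt (𝓡 d) x₀).symm with hh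
  have hsymm := mdifferentiableAt_extChartAt_symm' hy
  have hRs : MDifferentiableAt 𝓘(ℝ, EuclideanSpace ℝ (Fin d)) (𝓡 d)
      (R ∘ (extChartAt (𝓡 d) x₀).symm) y := hR.comp y hsymm
  have hmd : MDifferentiableAt 𝓘(ℝ, EuclideanSpace ℝ (Fin d)) 𝓘(ℝ, EuclideanSpace ℝ (Fin d)) h y :=
    (mdifferentiableAt_extChartAt (by rwa [← extChartAt_source (𝓡 d)])).comp y hRs
  have hhy : h y ∈ (extChartAt (𝓡 d) y₀).target := (extChartAt (𝓡 d) y₀).map_source hRy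
  refine ⟨mdifferentiableAt_iff_differentiableAt.1 hmd, ?_⟩
  -- Near y the inverse chart composed with the coordinate expression h is R composed with the
  -- inverse chart. Evaluating the volume of the image of the standard basis along both sides gives
  -- the identity.
  have hev : (extChartAt (𝓡 d) y₀).symm ∘ h =ᶠ[𝓝 y] R ∘ (extChartAt (𝓡 d) x₀).symm := by
    filter_upwards [hRs.continuousAt.eventually ((isOpen_extChartAt_source y₀).mem_nhds hRy)]
      with z hz
    exact (extChartAt (𝓡 d) y₀).left_inv hz
  have h1 := (mdifferentiableAt_extChartAt_symm' hhy).hasMFDerivAt.comp y hmd.hasMFDerivAt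
  have h2 := hR.hasMFDerivAt.comp y hsymm.hasMFDerivAt
  have h3 := hasMFDerivAt_unique h1 (h2.congr_of_eventuallyEq hev)
  have h4 : pointVolume (d := d) ((extChartAt (𝓡 d) y₀).symm (h y)) (fun i : Fin d ↦
      mfderiv 𝓘(ℝ, EuclideanSpace ℝ (Fin d)) (𝓡 d) (extChartAt (𝓡 d) y₀).symm (h y)
        (fderiv ℝ h y (EuclideanSpace.basisFun (Fin d) ℝ i))) =
      chartDensity d y₀ (h y) * |(fderiv ℝ h y).det| := by
    have e1 := gramVolume_comp (U := EuclideanSpace ℝ (Fin d))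
      (mfderiv 𝓘(ℝ, EuclideanSpace ℝ (Fin d)) (𝓡 d) (extChartAt (𝓡 d) y₀).symm (h y)).toLinearMap
      (fun i : Fin d ↦ fderiv ℝ h y (EuclideanSpace.basisFun (Fin d) ℝ i)) (by simp)
    have e2 := gramVolume_comp_orthonormalBasis (fderiv ℝ h y).toLinearMap
      (EuclideanSpace.basisFun (Fin d) ℝ)
    have e3 := gramVolume_comp_orthonormalBasis (U := EuclideanSpace ℝ (Fin d))
      (mfderiv 𝓘(ℝ, EuclideanSpace ℝ (Fin d)) (𝓡 d) (extChartAt (𝓡 d) y₀).symm (h y)).toLinearMap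
      (EuclideanSpace.basisFun (Fin d) ℝ)
    rw [LinearMap.normDet_eq_abs_det] at e2
    refine e1.trans ?_
    rw [← e3]
    exact congrArg _ e2
  have h5 := jacobian_mul_pointVolume R ((extChartAt (𝓡 d) x₀).symm y) (Fintype.card_fin d)
    (fun i ↦ mfderiv 𝓘(ℝ, EuclideanSpace ℝ (Fin d)) (𝓡 d)
    (extChartAt (𝓡 d) x₀).symm y (EuclideanSpace.basisFun (Fin d) ℝ i))
  refine h4.symm.trans (Eq.trans ?_ h5)
  refine pointVolume_congr ((extChartAt (𝓡 d) y₀).left_inv hRy) _ _ (funext fun i ↦ ?_)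
  rw [← mfderiv_eq_fderiv]
  exact congrArg (fun L : EuclideanSpace ℝ (Fin d) →L[ℝ] EuclideanSpace ℝ (Fin d) ↦
    L (EuclideanSpace.basisFun (Fin d) ℝ i)) h3

variable [MeasurableSpace M] [BorelSpace M]

lemma lintegral_chartVolume (x₀ : M) {g : M → ℝ≥0∞} (hg : Measurable g) :
    ∫⁻ x, g x ∂chartVolume (d := d) x₀ = ∫⁻ y in (extChartAt (𝓡 d) x₀).target,
      ENNReal.ofReal (chartDensity d x₀ y) * g ((extChartAt (𝓡 d) x₀).symm y) := by
  have hT := (isOpen_extChartAt_target (I := 𝓡 d) x₀).measurableSet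
  have hρ : AEMeasurable (fun y ↦ ENNReal.ofReal (chartDensity d x₀ y))
      (volume.restrict (extChartAt (𝓡 d) x₀).target) :=
    ((continuousOn_chartDensity x₀).aemeasurable hT).ennreal_ofReal
  have hφ : AEMeasurable (extChartAt (𝓡 d) x₀).symm
      (volume.restrict (extChartAt (𝓡 d) x₀).target) :=
    (continuousOn_extChartAt_symm x₀).aemeasurable hT
  rw [chartVolume, lintegral_map' hg.aemeasurable
    (hφ.mono_ac (withDensity_absolutelyContinuous _ _))]
  exact lintegral_withDensity_eq_lintegral_mul₀ hρ (hg.comp_aemeasurable hφ)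

lemma chartVolume_compl_source (x₀ : M) :
    chartVolume (d := d) x₀ (extChartAt (𝓡 d) x₀).sourceᶜ = 0 := by
  have hS := (isOpen_extChartAt_source (I := 𝓡 d) x₀).measurableSet.compl
  rw [← lintegral_indicator_one hS, lintegral_chartVolume x₀ (measurable_one.indicator hS)]
  have h0 : ∀ y ∈ (extChartAt (𝓡 d) x₀).target, ENNReal.ofReal (chartDensity d x₀ y) *
      (extChartAt (𝓡 d) x₀).sourceᶜ.indicator 1 ((extChartAt (𝓡 d) x₀).symm y) = 0 := by
    intro y hy
    rw [indicator_of_notMem (not_not_intro ((extChartAt (𝓡 d) x₀).map_target hy)), mul_zero]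
  rw [setLIntegral_congr_fun (isOpen_extChartAt_target x₀).measurableSet h0, lintegral_zero]

/-- The change of variables formula in charts. -/
lemma setLIntegral_chartVolume_comp {R : M → M} {x₀ y₀ : M} {A B : Set M}
    (hA : MeasurableSet A) (hB : MeasurableSet B) (hAx : A ⊆ (extChartAt (𝓡 d) x₀).source)
    (hBy : B ⊆ (extChartAt (𝓡 d) y₀).source) (hRB : R '' A = B) (hinj : InjOn R A)
    (hR : ∀ x ∈ A, MDifferentiableAt (𝓡 d) (𝓡 d) R x) (hRm : Measurable R)
    (hJ : Measurable (A.indicator (jacobian d R))) {g : M → ℝ≥0∞} (hg : Measurable g) :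
    ∫⁻ x in A, ENNReal.ofReal (jacobian d R x) * g (R x) ∂chartVolume (d := d) x₀ =
      ∫⁻ z in B, g z ∂chartVolume (d := d) y₀ := by
  set φ := extChartAt (𝓡 d) x₀
  set ψ := extChartAt (𝓡 d) y₀
  have hTx := (isOpen_extChartAt_target (I := 𝓡 d) x₀).measurableSet
  have hTy := (isOpen_extChartAt_target (I := 𝓡 d) y₀).measurableSet
  have hpre : ∀ (z₀ : M) (S : Set M), MeasurableSet S →
      MeasurableSet ((extChartAt (𝓡 d) z₀).target ∩ (extChartAt (𝓡 d) z₀).symm ⁻¹' S) := by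
    intro z₀ S hS
    have hT := (isOpen_extChartAt_target (I := 𝓡 d) z₀).measurableSet
    have h1 : Measurable (fun y : (extChartAt (𝓡 d) z₀).target ↦ (extChartAt (𝓡 d) z₀).symm y) :=
      (continuousOn_iff_continuous_domRestrict.1 (continuousOn_extChartAt_symm z₀)).measurable
    have h2 := (MeasurableEmbedding.subtype_coe hT).measurableSet_image.2 (h1 hS)
    convert h2 using 1
    ext y
    exact ⟨fun hy ↦ ⟨⟨y, hy.1⟩, hy.2, rfl⟩, by rintro ⟨z, hz, rfl⟩; exact ⟨z.2, hz⟩⟩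
  set A' := φ.target ∩ φ.symm ⁻¹' A
  set B' := ψ.target ∩ ψ.symm ⁻¹' B
  set h := ψ ∘ R ∘ φ.symm
  have hRy : ∀ y ∈ A', R (φ.symm y) ∈ ψ.source := fun y hy ↦
    hBy (hRB ▸ mem_image_of_mem R hy.2)
  have hd := fun y (hy : y ∈ A') ↦ chartDensity_comp hy.1 (hR _ hy.2) (hRy y hy)
  have hinj' : InjOn h A' := by
    intro y hy z hz hyz
    have h1 := ψ.injOn (hRy y hy) (hRy z hz) hyz
    exact φ.symm.injOn hy.1 hz.1 (hinj hy.2 hz.2 h1)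
  have himg : h '' A' = B' := by
    ext z
    constructor
    · rintro ⟨y, hy, rfl⟩
      refine ⟨ψ.map_source (hRy y hy), ?_⟩
      change ψ.symm (ψ (R (φ.symm y))) ∈ B
      rw [ψ.left_inv (hRy y hy), ← hRB]
      exact mem_image_of_mem R hy.2
    · rintro ⟨hz, hzB⟩
      rw [mem_preimage, ← hRB] at hzB
      obtain ⟨x, hx, hxz⟩ := hzB
      refine ⟨φ x, ⟨φ.map_source (hAx hx), ?_⟩, ?_⟩
      · rw [mem_preimage, φ.left_inv (hAx hx)]; exact hx
      · change ψ (R (φ.symm (φ x))) = z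
        rw [φ.left_inv (hAx hx), hxz, ψ.right_inv hz]
  have hL : ∀ (z₀ : M) (S : Set M) (k : M → ℝ≥0∞), MeasurableSet S → Measurable (S.indicator k) →
      ∫⁻ x in S, k x ∂chartVolume (d := d) z₀ =
        ∫⁻ y in (extChartAt (𝓡 d) z₀).target ∩ (extChartAt (𝓡 d) z₀).symm ⁻¹' S,
          ENNReal.ofReal (chartDensity d z₀ y) * k ((extChartAt (𝓡 d) z₀).symm y) := by
    intro z₀ S k hS hk
    have hT := (isOpen_extChartAt_target (I := 𝓡 d) z₀).measurableSet
    rw [← lintegral_indicator hS, lintegral_chartVolume z₀ hk, ← lintegral_indicator hT,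
      ← lintegral_indicator (hpre z₀ S hS)]
    refine lintegral_congr fun y ↦ ?_
    by_cases h1 : y ∈ (extChartAt (𝓡 d) z₀).target <;>
      by_cases h2 : (extChartAt (𝓡 d) z₀).symm y ∈ S <;>
        simp only [indicator, mem_inter_iff, mem_preimage, h1, h2, if_true, if_false, mul_zero,
          and_true, and_false, and_self]
  have hk1 : Measurable (A.indicator fun x ↦ ENNReal.ofReal (jacobian d R x) * g (R x)) := by
    have : (A.indicator fun x ↦ ENNReal.ofReal (jacobian d R x) * g (R x)) =
        fun x ↦ ENNReal.ofReal (A.indicator (jacobian d R) x) * g (R x) := by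
      funext x
      by_cases hx : x ∈ A <;> simp [hx]
    rw [this]
    exact hJ.ennreal_ofReal.mul (hg.comp hRm)
  rw [hL x₀ A _ hA hk1, hL y₀ B g hB (hg.indicator hB)]
  change ∫⁻ y in A', _ = ∫⁻ z in B', _
  rw [← himg, lintegral_image_eq_lintegral_abs_det_fderiv_mul volume (hpre x₀ A hA)
    (fun y hy ↦ (hd y hy).1.hasFDerivAt.hasFDerivWithinAt) hinj']
  refine setLIntegral_congr_fun (hpre x₀ A hA) fun y hy ↦ ?_
  have h6 : ψ.symm (h y) = R (φ.symm y) := ψ.left_inv (hRy y hy)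
  have h7 := (hd y hy).2
  change ENNReal.ofReal (chartDensity d x₀ y) *
      (ENNReal.ofReal (jacobian d R (φ.symm y)) * g (R (φ.symm y))) =
    ENNReal.ofReal |(fderiv ℝ h y).det| *
      (ENNReal.ofReal (chartDensity d y₀ (h y)) * g (ψ.symm (h y)))
  have hρ0 : 0 ≤ chartDensity d x₀ y := Real.sqrt_nonneg _
  rw [h6, ← mul_assoc, ← mul_assoc, ← ENNReal.ofReal_mul (abs_nonneg _),
    ← ENNReal.ofReal_mul hρ0,
    mul_comm (chartDensity d x₀ y), ← h7, mul_comm |_|]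
  rfl

end ChartVolume

/-! ### Gluing of the chart measures and change of variables. -/

section RiemannianVolume

variable {d : ℕ} {M : Type*} [TopologicalSpace M] [T2Space M]
  [ChartedSpace (EuclideanSpace ℝ (Fin d)) M]
  [IsManifold (𝓡 d) ∞ M] [RiemannianBundle (fun x : M ↦ TangentSpace (𝓡 d) x)]
  [IsContMDiffRiemannianBundle (𝓡 d) ∞ (EuclideanSpace ℝ (Fin d))
      (fun x : M ↦ TangentSpace (𝓡 d) x)]

lemma jacobian_id (x : M) : jacobian d (id : M → M) x = 1 := by
  rw [jacobian, mfderiv_id]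
  exact LinearMap.normDet_id

variable [MeasurableSpace M] [BorelSpace M]

lemma measurableSet_source (x : M) : MeasurableSet (extChartAt (𝓡 d) x).source :=
  (isOpen_extChartAt_source (I := 𝓡 d) x).measurableSet

lemma chartVolume_eq_of_subset {x₀ y₀ : M} {A : Set M} (hA : MeasurableSet A)
    (hx : A ⊆ (extChartAt (𝓡 d) x₀).source) (hy : A ⊆ (extChartAt (𝓡 d) y₀).source) :
    chartVolume (d := d) x₀ A = chartVolume (d := d) y₀ A := by
  have h := setLIntegral_chartVolume_comp (R := id) hA hA hx hy (image_id A) (injOn_id A)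
    (fun x _ ↦ mdifferentiableAt_id) measurable_id
    (by
      have : A.indicator (jacobian d (id : M → M)) = A.indicator 1 := by
        congr 1; funext x; exact jacobian_id x
      rw [this]
      exact measurable_one.indicator hA) (g := 1) measurable_one
  simpa [jacobian_id] using h

/-- A supremum of measures is not computed set by set, so an upper bound is exhibited: `chartVolume
x₀` plus infinity times the counting measure off the chart domain. It dominates every chart measure,
since these agree on overlaps and any set that leaves the domain gets infinite mass, and on the
domain it reduces to `chartVolume x₀`. -/
lemma restrict_riemannianVolume (x₀ : M) :
    (riemannianVolume d M).restrict (extChartAt (𝓡 d) x₀).source = chartVolume (d := d) x₀ := by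
  set S := (extChartAt (𝓡 d) x₀).source
  have hS : MeasurableSet S := measurableSet_source x₀
  refine le_antisymm ?_ ?_
  · have hκ : riemannianVolume d M ≤ chartVolume (d := d) x₀ +
        (⊤ : ℝ≥0∞) • (Measure.count : Measure M).restrict Sᶜ := by
      refine iSup_le fun x ↦ Measure.le_iff.2 fun A hA ↦ ?_
      by_cases hAS : A ⊆ S
      · rw [Measure.add_apply]
        refine le_add_right ?_
        rw [← measure_inter_add_sdiff A (measurableSet_source (d := d) x), sdiff_eq,
          measure_mono_null inter_subset_right (chartVolume_compl_source x), add_zero,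
          chartVolume_eq_of_subset (hA.inter (measurableSet_source (d := d) x)) inter_subset_right
            (inter_subset_left.trans hAS)]
        exact measure_mono inter_subset_left
      · obtain ⟨z, hzA, hzS⟩ := not_subset.1 hAS
        have : (⊤ : ℝ≥0∞) ≤ ((⊤ : ℝ≥0∞) • (Measure.count : Measure M).restrict Sᶜ) A := by
          rw [Measure.smul_apply, Measure.restrict_apply hA, smul_eq_mul, ENNReal.top_mul]
          exact fun h0 ↦ (Measure.count_eq_zero_iff.1 h0).subset ⟨hzA, hzS⟩
        rw [Measure.add_apply]
        exact le_top.trans (le_add_left this)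
    refine Measure.le_iff.2 fun A hA ↦ ?_
    rw [Measure.restrict_apply hA]
    refine (hκ _).trans ?_
    rw [Measure.add_apply, Measure.smul_apply, Measure.restrict_apply (hA.inter hS),
      inter_assoc, inter_compl_self, inter_empty, measure_empty, smul_zero, add_zero]
    exact measure_mono inter_subset_left
  · refine Measure.le_iff.2 fun A hA ↦ ?_
    rw [Measure.restrict_apply hA, ← measure_inter_add_sdiff A hS, sdiff_eq,
      measure_mono_null inter_subset_right (chartVolume_compl_source x₀), add_zero]
    exact le_iSup (fun x₀ : M ↦ chartVolume (d := d) x₀) x₀ _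

lemma setLIntegral_riemannianVolume (x₀ : M) {A : Set M} (hA : MeasurableSet A)
    (hAx : A ⊆ (extChartAt (𝓡 d) x₀).source) (g : M → ℝ≥0∞) :
    ∫⁻ x in A, g x ∂riemannianVolume d M = ∫⁻ x in A, g x ∂chartVolume (d := d) x₀ := by
  rw [← restrict_riemannianVolume x₀, Measure.restrict_restrict hA, inter_eq_left.2 hAx]

lemma riemannianVolume_inter_source (x₀ : M) {A : Set M} (hA : MeasurableSet A) :
    riemannianVolume d M (A ∩ (extChartAt (𝓡 d) x₀).source) =
      ∫⁻ y in (extChartAt (𝓡 d) x₀).target, ENNReal.ofReal (chartDensity d x₀ y) *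
        A.indicator 1 ((extChartAt (𝓡 d) x₀).symm y) := by
  rw [← Measure.restrict_apply hA, restrict_riemannianVolume, ← lintegral_indicator_one hA,
    lintegral_chartVolume x₀ (measurable_one.indicator hA)]

/-- With positivity on nonempty open sets, this provides test sets of positive finite measure for
the lower bound of the norms. -/
instance : IsLocallyFiniteMeasure (riemannianVolume d M) := by
  refine ⟨fun x₀ ↦ ?_⟩
  have hT := (isOpen_extChartAt_target (I := 𝓡 d) x₀).mem_nhds (mem_extChartAt_target x₀)
  have hc : ContinuousAt (chartDensity d x₀) (extChartAt (𝓡 d) x₀ x₀) :=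
    (continuousOn_chartDensity x₀).continuousAt hT
  have hb : ∀ᶠ y in 𝓝 (extChartAt (𝓡 d) x₀ x₀),
      chartDensity d x₀ y < chartDensity d x₀ (extChartAt (𝓡 d) x₀ x₀) + 1 :=
    hc.eventually (gt_mem_nhds (by linarith))
  obtain ⟨r, hr, hball⟩ := Metric.eventually_nhds_iff_ball.1 hb
  let U := (extChartAt (𝓡 d) x₀).source ∩
    extChartAt (𝓡 d) x₀ ⁻¹' Metric.ball (extChartAt (𝓡 d) x₀ x₀) r
  have hU : IsOpen U := isOpen_extChartAt_preimage' x₀ Metric.isOpen_ball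
  refine ⟨U, hU.mem_nhds ⟨mem_extChartAt_source x₀, Metric.mem_ball_self hr⟩, ?_⟩
  have hUU : U = U ∩ (extChartAt (𝓡 d) x₀).source := (inter_eq_left.2 inter_subset_left).symm
  rw [hUU, riemannianVolume_inter_source x₀ hU.measurableSet]
  set c := ENNReal.ofReal (chartDensity d x₀ (extChartAt (𝓡 d) x₀ x₀) + 1)
  have hle : ∀ y ∈ (extChartAt (𝓡 d) x₀).target, ENNReal.ofReal (chartDensity d x₀ y) *
      U.indicator 1 ((extChartAt (𝓡 d) x₀).symm y) ≤
        (Metric.ball (extChartAt (𝓡 d) x₀ x₀) r).indicator (fun _ ↦ c) y := by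
    intro y hy
    by_cases hyU : (extChartAt (𝓡 d) x₀).symm y ∈ U
    · have hyb : y ∈ Metric.ball (extChartAt (𝓡 d) x₀ x₀) r := by
        have := hyU.2
        rwa [mem_preimage, (extChartAt (𝓡 d) x₀).right_inv hy] at this
      rw [indicator_of_mem hyU, indicator_of_mem hyb, Pi.one_apply, mul_one]
      exact ENNReal.ofReal_le_ofReal (hball y hyb).le
    · rw [indicator_of_notMem hyU, mul_zero]
      exact zero_le
  refine (setLIntegral_mono' (isOpen_extChartAt_target x₀).measurableSet hle).trans_lt ?_
  refine (setLIntegral_le_lintegral _ _).trans_lt ?_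
  rw [lintegral_indicator Metric.isOpen_ball.measurableSet, setLIntegral_const]
  exact ENNReal.mul_lt_top ENNReal.ofReal_lt_top measure_ball_lt_top

instance : (riemannianVolume d M).IsOpenPosMeasure := by
  refine ⟨fun U hU hne h0 ↦ ?_⟩
  obtain ⟨x₀, hx₀⟩ := hne
  have h1 : riemannianVolume d M (U ∩ (extChartAt (𝓡 d) x₀).source) = 0 :=
    measure_mono_null inter_subset_left h0
  rw [riemannianVolume_inter_source x₀ hU.measurableSet] at h1
  set T := (extChartAt (𝓡 d) x₀).target
  have hT : IsOpen T := isOpen_extChartAt_target x₀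
  set W := T ∩ (extChartAt (𝓡 d) x₀).symm ⁻¹' U
  have hW : IsOpen W := (continuousOn_extChartAt_symm x₀).isOpen_inter_preimage hT hU
  have hWne : W.Nonempty := ⟨extChartAt (𝓡 d) x₀ x₀, mem_extChartAt_target x₀, by
    rw [mem_preimage, extChartAt_to_inv]; exact hx₀⟩
  have h2 : ∫⁻ y in W, ENNReal.ofReal (chartDensity d x₀ y) = 0 := by
    refine le_antisymm ?_ zero_le
    rw [← h1, ← lintegral_indicator hW.measurableSet, ← lintegral_indicator hT.measurableSet]
    refine lintegral_mono fun y ↦ ?_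
    by_cases hy : y ∈ W
    · rw [indicator_of_mem hy, indicator_of_mem hy.1,
        indicator_of_mem (by exact hy.2 : (extChartAt (𝓡 d) x₀).symm y ∈ U), Pi.one_apply, mul_one]
    · rw [indicator_of_notMem hy]
      exact zero_le
  have h3 : volume W = 0 := by
    have hm : AEMeasurable (fun y ↦ ENNReal.ofReal (chartDensity d x₀ y)) (volume.restrict W) :=
      (((continuousOn_chartDensity x₀).mono inter_subset_left).aemeasurable
        hW.measurableSet).ennreal_ofReal
    have h4 := (lintegral_eq_zero_iff' hm).1 h2
    have h5 : ∀ᵐ y ∂(volume.restrict W), False := by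
      filter_upwards [h4, ae_restrict_mem hW.measurableSet] with y hy hyW
      have := chartDensity_pos (d := d) hyW.1
      simp only [Pi.zero_apply, ENNReal.ofReal_eq_zero] at hy
      linarith
    simpa using h5
  exact (hW.measure_pos volume hWne).ne' h3

variable [SecondCountableTopology M]

/-- The change of variables formula for an involution of an open set. -/
theorem setLIntegral_jacobian_comp {R : M → M} (hR : ContMDiff (𝓡 d) (𝓡 d) ∞ R) {V : Set M}
    (hV : IsOpen V) (hRV : ∀ x ∈ V, R x ∈ V) (hRR : ∀ x ∈ V, R (R x) = x)
    (hJ : ∀ x ∈ V, 0 < jacobian d R x) {g : M → ℝ≥0∞} (hg : Measurable g) :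
    ∫⁻ x in V, ENNReal.ofReal (jacobian d R x) * g (R x) ∂riemannianVolume d M =
      ∫⁻ x in V, g x ∂riemannianVolume d M := by
  -- Each piece lies in one chart domain and its image in another, which is what the formula in
  -- charts requires. A countable subcover is made disjoint, and the images of the pieces again
  -- partition V because R is an involution of V.
  let W : V → Set M := fun x ↦ V ∩ (extChartAt (𝓡 d) (x : M)).source ∩
    R ⁻¹' (extChartAt (𝓡 d) (R x)).source
  have hW : ∀ x, IsOpen (W x) := fun x ↦ (hV.inter (isOpen_extChartAt_source (x : M))).inter
    ((isOpen_extChartAt_source (R x)).preimage hR.continuous)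
  obtain ⟨s, hs, hsW⟩ := TopologicalSpace.isOpen_iUnion_countable W hW
  have hWV : ⋃ x, W x = V := by
    refine subset_antisymm (iUnion_subset fun x ↦ inter_subset_left.trans inter_subset_left) ?_
    exact fun x hx ↦ mem_iUnion.2 ⟨⟨x, hx⟩, ⟨hx, mem_extChartAt_source x⟩,
      mem_extChartAt_source (R x)⟩
  rcases V.eq_empty_or_nonempty with rfl | hne
  · simp
  have hsne : s.Nonempty := by
    by_contra h
    rw [not_nonempty_iff_eq_empty] at h
    rw [hWV, h] at hsW
    simp only [mem_empty_iff_false, iUnion_of_empty, iUnion_empty] at hsW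
    exact hne.ne_empty hsW.symm
  obtain ⟨e, he⟩ := hs.exists_eq_range hsne
  have hcov : ⋃ n, W (e n) = V := by
    rw [← hWV, ← hsW, he, biUnion_range]
  let A : ℕ → Set M := disjointed fun n ↦ W (e n)
  have hAW : ∀ n, A n ⊆ W (e n) := disjointed_subset _
  have hAm : ∀ n, MeasurableSet (A n) := MeasurableSet.disjointed fun n ↦ (hW (e n)).measurableSet
  have hAd : Pairwise (Function.onFun Disjoint A) := disjoint_disjointed _
  have hAV : ⋃ n, A n = V := (iUnion_disjointed).trans hcov
  have hAsub : ∀ n, A n ⊆ V := fun n ↦ (subset_iUnion A n).trans hAV.subset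
  have himg : ∀ n, R '' A n = V ∩ R ⁻¹' A n := by
    intro n
    ext z
    constructor
    · rintro ⟨x, hx, rfl⟩
      exact ⟨hRV x (hAsub n hx), by rw [mem_preimage, hRR x (hAsub n hx)]; exact hx⟩
    · rintro ⟨hz, hzA⟩
      exact ⟨R z, hzA, hRR z hz⟩
  have hBm : ∀ n, MeasurableSet (R '' A n) := fun n ↦ by
    rw [himg]
    exact hV.measurableSet.inter (hR.continuous.measurable (hAm n))
  have hBd : Pairwise (Function.onFun Disjoint fun n ↦ R '' A n) := by
    intro i j hij
    simp only [Function.onFun, himg]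
    exact ((hAd hij).preimage R).mono inter_subset_right inter_subset_right
  have hBV : ⋃ n, R '' A n = V := by
    rw [← image_iUnion, hAV]
    exact subset_antisymm (image_subset_iff.2 hRV) fun x hx ↦ ⟨R x, hRV x hx, hRR x hx⟩
  have hJm : ∀ n, Measurable ((A n).indicator (jacobian d R)) := by
    intro n
    have hc : ContinuousOn (jacobian d R) V := fun x hx ↦
      (contMDiffAt_jacobian hR (hJ x hx)).continuousAt.continuousWithinAt
    have h1 : Measurable (V.indicator (jacobian d R)) := by
      classical
      rw [← piecewise_eq_indicator]
      exact hc.measurable_piecewise continuousOn_const hV.measurableSet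
    have h2 : (A n).indicator (jacobian d R) = (A n).indicator (V.indicator (jacobian d R)) := by
      rw [indicator_indicator, inter_eq_left.2 (hAsub n)]
    rw [h2]
    exact h1.indicator (hAm n)
  conv_lhs => rw [← hAV]
  conv_rhs => rw [← hBV]
  rw [lintegral_iUnion hAm hAd, lintegral_iUnion hBm hBd]
  refine tsum_congr fun n ↦ ?_
  have hB : R '' A n ⊆ (extChartAt (𝓡 d) (R (e n))).source :=
    image_subset_iff.2 fun x hx ↦ (hAW n hx).2
  have hA : A n ⊆ (extChartAt (𝓡 d) ((e n : V) : M)).source := fun x hx ↦ (hAW n hx).1.2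
  rw [setLIntegral_riemannianVolume _ (hAm n) hA, setLIntegral_riemannianVolume _ (hBm n) hB]
  refine setLIntegral_chartVolume_comp (hAm n) (hBm n) hA hB rfl ?_
    (fun x _ ↦ hR.mdifferentiable (by simp) x) hR.continuous.measurable (hJm n) hg
  intro x hx y hy hxy
  rw [← hRR x (hAsub n hx), hxy, hRR y (hAsub n hy)]

end RiemannianVolume

/-! ### The constant `B_p` -/

section Const

variable {p : ℝ≥0∞} [Fact (1 ≤ p)]

/-- `A_ξ` as an operator on `ℓ^p({1, 2})`. -/
def awwCLM (p : ℝ≥0∞) [Fact (1 ≤ p)] (ξ : ℝ) :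
    PiLp p (fun _ : Fin 2 ↦ ℝ) →L[ℝ] PiLp p (fun _ : Fin 2 ↦ ℝ) :=
  LinearMap.toContinuousLinearMap (Matrix.toLpLin p p (awwMatrix ξ))

lemma awwCLM_apply_zero (ξ : ℝ) (x : PiLp p (fun _ : Fin 2 ↦ ℝ)) :
    awwCLM p ξ x 0 = ξ * x 0 + √(ξ * (1 - ξ)) * x 1 := by
  simp [awwCLM, awwMatrix, Matrix.toLpLin_apply, dotProduct, Fin.sum_univ_two]

lemma awwCLM_apply_one (ξ : ℝ) (x : PiLp p (fun _ : Fin 2 ↦ ℝ)) :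
    awwCLM p ξ x 1 = √(ξ * (1 - ξ)) * x 0 + (1 - ξ) * x 1 := by
  simp [awwCLM, awwMatrix, Matrix.toLpLin_apply, dotProduct, Fin.sum_univ_two]

lemma one_le_toReal (hp : p ≠ ⊤) : 1 ≤ p.toReal := by
  have h := ENNReal.toReal_mono hp (Fact.out : 1 ≤ p)
  simpa using h

lemma norm_piLp_two (hp : p ≠ ⊤) (x : PiLp p (fun _ : Fin 2 ↦ ℝ)) :
    ‖x‖ = (|x 0| ^ p.toReal + |x 1| ^ p.toReal) ^ p.toReal⁻¹ := by
  rw [PiLp.norm_eq_sum (by linarith [one_le_toReal (p := p) hp]), Fin.sum_univ_two, one_div]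
  rfl

lemma norm_piLp_two_top (x : PiLp ⊤ (fun _ : Fin 2 ↦ ℝ)) : ‖x‖ = max |x 0| |x 1| := by
  rw [PiLp.norm_eq_ciSup]
  refine le_antisymm (ciSup_le fun i ↦ ?_) (max_le ?_ ?_)
  · fin_cases i
    · exact le_max_left _ _
    · exact le_max_right _ _
  · exact le_ciSup (f := fun i ↦ ‖x i‖) (Set.finite_range _).bddAbove 0
  · exact le_ciSup (f := fun i ↦ ‖x i‖) (Set.finite_range _).bddAbove 1

/-- The `r`-th power of the `ℓ^r` norm of the image of `(u, v)` under the matrix with rows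
`(ξ, β)` and `(β, 1 - ξ)`. -/
def awwForm (r ξ β u v : ℝ) : ℝ := |ξ * u + β * v| ^ r + |β * u + (1 - ξ) * v| ^ r

lemma awwForm_nonneg (r ξ β u v : ℝ) : 0 ≤ awwForm r ξ β u v := by
  unfold awwForm; positivity

lemma norm_awwCLM_apply (hp : p ≠ ⊤) (ξ : ℝ) (x : PiLp p (fun _ : Fin 2 ↦ ℝ)) :
    ‖awwCLM p ξ x‖ = awwForm p.toReal ξ √(ξ * (1 - ξ)) (x 0) (x 1) ^ p.toReal⁻¹ := by
  rw [norm_piLp_two hp, awwCLM_apply_zero, awwCLM_apply_one, awwForm]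

/-- The maximum is attained at ξ = (2 + √2)/4. With S = (1 + √2)/2 one has (S - ξ)² - ξ(1 - ξ) = 2(ξ
- (2 + √2)/4)². -/
lemma row_sum_le {ξ β : ℝ} (hβ : β ^ 2 = ξ * (1 - ξ)) : ξ + |β| ≤ (1 + √2) / 2 := by
  have h2 : √2 ^ 2 = 2 := Real.sq_sqrt (by norm_num)
  have h3 : 0 ≤ √2 := Real.sqrt_nonneg 2
  have hξ : ξ ≤ 1 := by nlinarith [sq_nonneg β]
  have h4 : 1 ≤ √2 := by nlinarith
  have : |β| ≤ (1 + √2) / 2 - ξ := by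
    refine abs_le_of_sq_le_sq ?_ (by linarith)
    rw [hβ]
    nlinarith [sq_nonneg (ξ - (2 + √2) / 4)]
  linarith

/-- Jensen's inequality for the r-th power with the weights α/σ and |β|/σ, where σ = α + |β|; if σ =
0 the row vanishes. -/
lemma abs_pow_le_of_sum_le {r S α β u v : ℝ} (hr : 1 ≤ r) (hα : 0 ≤ α) (hS : α + |β| ≤ S) :
    |α * u + β * v| ^ r ≤ S ^ (r - 1) * (α * |u| ^ r + |β| * |v| ^ r) := by
  have hr0 : r ≠ 0 := by linarith
  have habs : |α * u + β * v| ≤ α * |u| + |β| * |v| := by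
    refine (abs_add_le _ _).trans ?_
    rw [abs_mul, abs_mul, abs_of_nonneg hα]
  have hβ0 := abs_nonneg β
  rcases (add_nonneg hα hβ0).eq_or_lt with h0 | h0
  · have h1 : α = 0 := by linarith
    have h2 : |β| = 0 := by linarith
    have h3 : β = 0 := abs_eq_zero.1 h2
    simp [h1, h3, Real.zero_rpow hr0]
  have hS0 : 0 < S := h0.trans_le hS
  set σ := α + |β|
  have h1 := (convexOn_rpow hr).2 (mem_Ici.2 (abs_nonneg u)) (mem_Ici.2 (abs_nonneg v))
    (show 0 ≤ α / σ by positivity) (show 0 ≤ |β| / σ by positivity)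
    (by rw [← add_div, div_self h0.ne'])
  simp only [smul_eq_mul] at h1
  have h2 : α * |u| + |β| * |v| = σ * (α / σ * |u| + |β| / σ * |v|) := by
    field_simp
  calc |α * u + β * v| ^ r ≤ (α * |u| + |β| * |v|) ^ r :=
        Real.rpow_le_rpow (abs_nonneg _) habs (by linarith)
    _ = σ ^ r * (α / σ * |u| + |β| / σ * |v|) ^ r := by
        rw [h2, Real.mul_rpow h0.le (by positivity)]
    _ ≤ σ ^ r * (α / σ * |u| ^ r + |β| / σ * |v| ^ r) := by gcongr
    _ = σ ^ (r - 1) * (α * |u| ^ r + |β| * |v| ^ r) := by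
        rw [Real.rpow_sub_one h0.ne']
        field_simp
    _ ≤ S ^ (r - 1) * (α * |u| ^ r + |β| * |v| ^ r) := by
        have : σ ^ (r - 1) ≤ S ^ (r - 1) := Real.rpow_le_rpow h0.le hS (by linarith)
        gcongr

/-- Schur's test: the matrix is symmetric, so the bound for the row sums is also one for the column
sums. The estimate makes the supremum in `awwConst` finite and later yields the constant 3. -/
lemma awwForm_le_schur {r ξ β : ℝ} (hr : 1 ≤ r) (hξ : ξ ∈ Icc (0 : ℝ) 1)
    (hβ : β ^ 2 = ξ * (1 - ξ)) (u v : ℝ) :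
    awwForm r ξ β u v ≤ ((1 + √2) / 2) ^ r * (|u| ^ r + |v| ^ r) := by
  set S := (1 + √2) / 2
  have hS : 0 < S := by positivity
  have h1 : ξ + |β| ≤ S := row_sum_le hβ
  have h2 : 1 - ξ + |β| ≤ S := row_sum_le (by rw [hβ]; ring)
  have h3 := abs_pow_le_of_sum_le (u := u) (v := v) hr hξ.1 h1
  have h4 := abs_pow_le_of_sum_le (u := v) (v := u) hr (sub_nonneg.2 hξ.2) h2
  have h5 : awwForm r ξ β u v ≤ S ^ (r - 1) * (S * |u| ^ r + S * |v| ^ r) := by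
    rw [awwForm, add_comm (β * u)]
    refine (add_le_add h3 h4).trans ?_
    rw [← mul_add]
    refine mul_le_mul_of_nonneg_left ?_ (by positivity)
    have hu : 0 ≤ |u| ^ r := by positivity
    have hv : 0 ≤ |v| ^ r := by positivity
    nlinarith
  refine h5.trans (le_of_eq ?_)
  rw [Real.rpow_sub_one hS.ne']
  field_simp

lemma norm_awwCLM_le_schur {ξ : ℝ} (hξ : ξ ∈ Icc (0 : ℝ) 1) : ‖awwCLM p ξ‖ ≤ (1 + √2) / 2 := by
  have hξ' : 0 ≤ ξ * (1 - ξ) := mul_nonneg hξ.1 (sub_nonneg.2 hξ.2)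
  refine ContinuousLinearMap.opNorm_le_bound _ (by positivity) fun x ↦ ?_
  by_cases hp : p = ⊤
  · subst hp
    rw [norm_piLp_two_top, norm_piLp_two_top, awwCLM_apply_zero, awwCLM_apply_one]
    have key : ∀ a b u v : ℝ, 0 ≤ a → 0 ≤ b → a + b ≤ (1 + √2) / 2 →
        |a * u + b * v| ≤ (1 + √2) / 2 * max |u| |v| := by
      intro a b u v ha hb hab
      have hu := le_max_left |u| |v|
      have hv := le_max_right |u| |v|
      have hm : 0 ≤ max |u| |v| := (abs_nonneg u).trans hu
      calc |a * u + b * v| ≤ a * |u| + b * |v| := by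
            refine (abs_add_le _ _).trans ?_
            rw [abs_mul, abs_mul, abs_of_nonneg ha, abs_of_nonneg hb]
        _ ≤ a * max |u| |v| + b * max |u| |v| := by gcongr
        _ ≤ (1 + √2) / 2 * max |u| |v| := by rw [← add_mul]; gcongr
    have h1 := row_sum_le (Real.sq_sqrt hξ')
    have h2 := row_sum_le (ξ := 1 - ξ) ((Real.sq_sqrt hξ').trans (by ring))
    rw [abs_of_nonneg (Real.sqrt_nonneg _)] at h1 h2
    exact max_le (key _ _ _ _ hξ.1 (Real.sqrt_nonneg _) h1)
      (key _ _ _ _ (Real.sqrt_nonneg _) (sub_nonneg.2 hξ.2) (by linarith))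
  · have hr := one_le_toReal (p := p) hp
    rw [norm_awwCLM_apply hp, norm_piLp_two hp]
    refine (Real.rpow_le_rpow (awwForm_nonneg _ _ _ _ _)
      (awwForm_le_schur hr hξ (Real.sq_sqrt hξ') (x 0) (x 1)) (by positivity)).trans (le_of_eq ?_)
    rw [Real.mul_rpow (by positivity) (by positivity), Real.rpow_rpow_inv (by positivity)
      (by linarith)]

lemma norm_awwCLM_le {ξ : ℝ} (hξ : ξ ∈ Icc (0 : ℝ) 1) : ‖awwCLM p ξ‖ ≤ awwConst p :=
  le_ciSup (f := fun ξ : Icc (0 : ℝ) 1 ↦ ‖awwCLM p ξ‖)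
    ⟨(1 + √2) / 2, by rintro _ ⟨ξ, rfl⟩; exact norm_awwCLM_le_schur ξ.2⟩ ⟨ξ, hξ⟩

lemma awwConst_le_of_norm {C : ℝ} (h : ∀ ξ ∈ Icc (0 : ℝ) 1, ‖awwCLM p ξ‖ ≤ C) :
    awwConst p ≤ C :=
  haveI : Nonempty (Icc (0 : ℝ) 1) := ⟨0, by simp⟩
  ciSup_le (f := fun ξ : Icc (0 : ℝ) 1 ↦ ‖awwCLM p ξ‖) fun ξ ↦ h ξ ξ.2

lemma awwConst_le_schur : awwConst p ≤ (1 + √2) / 2 :=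
  awwConst_le_of_norm fun _ ↦ norm_awwCLM_le_schur

lemma one_le_awwConst : 1 ≤ awwConst p := by
  refine le_trans ?_ (norm_awwCLM_le (p := p) (ξ := 1) (by simp))
  set e : PiLp p (fun _ : Fin 2 ↦ ℝ) := WithLp.toLp p ![1, 0]
  have h1 : awwCLM p 1 e = e := by
    ext i
    fin_cases i
    · exact (awwCLM_apply_zero 1 e).trans (by simp [e])
    · exact (awwCLM_apply_one 1 e).trans (by simp [e])
  have he : e ≠ 0 := fun h ↦ by
    have h0 := congrArg (fun x : PiLp p (fun _ : Fin 2 ↦ ℝ) ↦ x 0) h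
    simp [e] at h0
  have h2 := (awwCLM p 1).le_opNorm e
  rw [h1] at h2
  exact le_of_mul_le_mul_right (by rwa [one_mul]) (norm_pos_iff.2 he)

lemma awwConst_nonneg : 0 ≤ awwConst p := zero_le_one.trans one_le_awwConst

lemma eq_sqrt_or_of_sq {ξ β : ℝ} (hβ : β ^ 2 = ξ * (1 - ξ)) :
    β = √(ξ * (1 - ξ)) ∨ β = -√(ξ * (1 - ξ)) := by
  rw [← hβ, Real.sqrt_sq_eq_abs]
  rcases abs_choice β with h | h <;> rw [h] <;> simp

/-- Changing the sign of the off-diagonal entries is conjugation by diag(1, -1), an isometry of ℓ^r.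
Hence both polarities have the same norm. -/
lemma awwForm_neg (r ξ β u v : ℝ) : awwForm r ξ (-β) u v = awwForm r ξ β u (-v) := by
  have h : -β * u + (1 - ξ) * v = -(β * u + (1 - ξ) * -v) := by ring
  rw [awwForm, awwForm, h, abs_neg, neg_mul_comm β v]

lemma awwForm_le (hp : p ≠ ⊤) {ξ β : ℝ} (hξ : ξ ∈ Icc (0 : ℝ) 1) (hβ : β ^ 2 = ξ * (1 - ξ))
    (u v : ℝ) : awwForm p.toReal ξ β u v ≤
      awwConst p ^ p.toReal * (|u| ^ p.toReal + |v| ^ p.toReal) := by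
  have hr := one_le_toReal (p := p) hp
  have key : ∀ v, awwForm p.toReal ξ √(ξ * (1 - ξ)) u v ≤
      awwConst p ^ p.toReal * (|u| ^ p.toReal + |v| ^ p.toReal) := by
    intro v
    have h1 := ((awwCLM p ξ).le_opNorm (WithLp.toLp p ![u, v])).trans
      (mul_le_mul_of_nonneg_right (norm_awwCLM_le hξ) (norm_nonneg _))
    rw [norm_awwCLM_apply hp, norm_piLp_two hp] at h1
    have h2 := Real.rpow_le_rpow (Real.rpow_nonneg (awwForm_nonneg _ _ _ _ _) _) h1 (by linarith : 0 ≤ p.toReal)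
    rw [Real.rpow_inv_rpow (awwForm_nonneg _ _ _ _ _) (by linarith),
      Real.mul_rpow awwConst_nonneg (by positivity),
      Real.rpow_inv_rpow (by positivity) (by linarith)] at h2
    exact h2
  rcases eq_sqrt_or_of_sq hβ with h | h
  · rw [h]; exact key v
  · rw [h, awwForm_neg]
    simpa using key (-v)

/-- One root β for each ξ suffices, by the symmetry under change of sign. -/
lemma awwConst_le (hp : p ≠ ⊤) {C : ℝ} (hC : 0 ≤ C)
    (h : ∀ ξ ∈ Icc (0 : ℝ) 1, ∃ β, β ^ 2 = ξ * (1 - ξ) ∧ ∀ u v,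
      awwForm p.toReal ξ β u v ≤ C ^ p.toReal * (|u| ^ p.toReal + |v| ^ p.toReal)) :
    awwConst p ≤ C := by
  have hr := one_le_toReal (p := p) hp
  refine awwConst_le_of_norm fun ξ hξ ↦ ContinuousLinearMap.opNorm_le_bound _ hC fun x ↦ ?_
  obtain ⟨β, hβ, hβ'⟩ := h ξ hξ
  have key : awwForm p.toReal ξ √(ξ * (1 - ξ)) (x 0) (x 1) ≤
      C ^ p.toReal * (|x 0| ^ p.toReal + |x 1| ^ p.toReal) := by
    rcases eq_sqrt_or_of_sq hβ with h | h
    · rw [← h]; exact hβ' _ _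
    · have h' : √(ξ * (1 - ξ)) = -β := by rw [h, neg_neg]
      rw [h', awwForm_neg]
      simpa using hβ' (x 0) (-x 1)
  rw [norm_awwCLM_apply hp, norm_piLp_two hp]
  refine (Real.rpow_le_rpow (awwForm_nonneg _ _ _ _ _) key (by positivity)).trans (le_of_eq ?_)
  rw [Real.mul_rpow (by positivity) (by positivity), Real.rpow_rpow_inv hC (by linarith)]

lemma abs_le_awwConst_top {ξ β : ℝ} (hξ : ξ ∈ Icc (0 : ℝ) 1) (hβ : β ^ 2 = ξ * (1 - ξ))
    (u v : ℝ) : |ξ * u + β * v| ≤ awwConst ⊤ * max |u| |v| := by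
  have key : ∀ v, |ξ * u + √(ξ * (1 - ξ)) * v| ≤ awwConst ⊤ * max |u| |v| := by
    intro v
    have h1 := ((awwCLM ⊤ ξ).le_opNorm (WithLp.toLp ⊤ ![u, v])).trans
      (mul_le_mul_of_nonneg_right (norm_awwCLM_le hξ) (norm_nonneg _))
    rw [norm_piLp_two_top, norm_piLp_two_top, awwCLM_apply_zero] at h1
    exact (le_max_left _ _).trans h1
  rcases eq_sqrt_or_of_sq hβ with h | h
  · rw [h]; exact key v
  · rw [h]
    simpa using key (-v)

/-- Estimates for first rows suffice: up to the order of the coordinates, the second row of A_ξ is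
the first row of A_{1-ξ}. -/
lemma awwConst_top_le {C : ℝ} (hC : 0 ≤ C)
    (h : ∀ ξ ∈ Icc (0 : ℝ) 1, ∃ β, β ^ 2 = ξ * (1 - ξ) ∧ ∀ u v,
      |ξ * u + β * v| ≤ C * max |u| |v|) : awwConst ⊤ ≤ C := by
  refine awwConst_le_of_norm fun ξ hξ ↦ ContinuousLinearMap.opNorm_le_bound _ hC fun x ↦ ?_
  have key : ∀ ξ ∈ Icc (0 : ℝ) 1, ∀ u v, |ξ * u + √(ξ * (1 - ξ)) * v| ≤ C * max |u| |v| := by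
    intro ξ hξ u v
    obtain ⟨β, hβ, hβ'⟩ := h ξ hξ
    rcases eq_sqrt_or_of_sq hβ with h | h
    · rw [← h]; exact hβ' _ _
    · have h' : √(ξ * (1 - ξ)) = -β := by rw [h, neg_neg]
      rw [h']
      simpa using hβ' u (-v)
  rw [norm_piLp_two_top, norm_piLp_two_top, awwCLM_apply_zero, awwCLM_apply_one]
  refine max_le (key ξ hξ _ _) ?_
  have h2 := key (1 - ξ) ⟨by linarith [hξ.2], by linarith [hξ.1]⟩ (x 1) (x 0)
  rw [sub_sub_cancel, mul_comm (1 - ξ) ξ, max_comm, add_comm] at h2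
  exact h2

end Const

/-! ### Operators on `L^p` given by formulas -/

section Induced

variable {X : Type*} [MeasurableSpace X] {ν : Measure X} {p : ℝ≥0∞} [Fact (1 ≤ p)]

lemma exists_inducesLp {A : (X → ℝ) → X → ℝ} {C : ℝ} (hC : 0 ≤ C)
    (hadd : ∀ f g : X → ℝ, A (f + g) = A f + A g) (hsmul : ∀ (c : ℝ) (f : X → ℝ), A (c • f) = c • A f)
    (hae : ∀ f g : X → ℝ, f =ᵐ[ν] g → A f =ᵐ[ν] A g)
    (hm : ∀ f : X → ℝ, MemLp f p ν → AEStronglyMeasurable (A f) ν)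
    (hb : ∀ f : X → ℝ, MemLp f p ν → eLpNorm (A f) p ν ≤ ENNReal.ofReal C * eLpNorm f p ν) :
    ∃ P : Lp ℝ p ν →L[ℝ] Lp ℝ p ν, InducesLp A P ∧ ‖P‖ ≤ C := by
  have hmem : ∀ f : X → ℝ, MemLp f p ν → MemLp (A f) p ν := fun f hf ↦
    ⟨hm f hf, (hb f hf).trans_lt (ENNReal.mul_lt_top ENNReal.ofReal_lt_top hf.2)⟩
  let L : Lp ℝ p ν →ₗ[ℝ] Lp ℝ p ν :=
    { toFun := fun f ↦ (hmem f (Lp.memLp f)).toLp _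
      map_add' := fun f g ↦ by
        rw [← MemLp.toLp_add, MemLp.toLp_eq_toLp_iff, ← hadd]
        exact hae _ _ (Lp.coeFn_add f g)
      map_smul' := fun c f ↦ by
        rw [RingHom.id_apply, ← MemLp.toLp_const_smul, MemLp.toLp_eq_toLp_iff, ← hsmul]
        exact hae _ _ (Lp.coeFn_smul c f) }
  have hL : ∀ f : Lp ℝ p ν, ‖L f‖ ≤ C * ‖f‖ := by
    intro f
    change ‖(hmem f (Lp.memLp f)).toLp _‖ ≤ _
    rw [Lp.norm_toLp, Lp.norm_def]
    have h := ENNReal.toReal_mono (ENNReal.mul_ne_top ENNReal.ofReal_ne_top (Lp.memLp f).2.ne)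
      (hb f (Lp.memLp f))
    rwa [ENNReal.toReal_mul, ENNReal.toReal_ofReal hC] at h
  refine ⟨L.mkContinuous C hL, fun f hf ↦ ?_, L.mkContinuous_norm_le hC hL⟩
  refine (MemLp.coeFn_toLp (hmem _ (Lp.memLp (hf.toLp f)))).trans ?_
  exact hae _ _ hf.coeFn_toLp

lemma InducesLp.memLp {A : (X → ℝ) → X → ℝ} {P : Lp ℝ p ν →L[ℝ] Lp ℝ p ν} (hP : InducesLp A P)
    {f : X → ℝ} (hf : MemLp f p ν) : MemLp (A f) p ν :=
  (memLp_congr_ae (hP f hf)).1 (Lp.memLp _)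

lemma InducesLp.toLp {A : (X → ℝ) → X → ℝ} {P : Lp ℝ p ν →L[ℝ] Lp ℝ p ν} (hP : InducesLp A P)
    {f : X → ℝ} (hf : MemLp f p ν) : P (hf.toLp f) = (hP.memLp hf).toLp (A f) :=
  Lp.ext ((hP f hf).trans (hP.memLp hf).coeFn_toLp.symm)

lemma InducesLp.coeFn {A : (X → ℝ) → X → ℝ} {P : Lp ℝ p ν →L[ℝ] Lp ℝ p ν} (hP : InducesLp A P)
    (f : Lp ℝ p ν) : P f =ᵐ[ν] A f := by
  have h := hP f (Lp.memLp f)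
  rwa [Lp.toLp_coeFn] at h

lemma InducesLp.eLpNorm_le {A : (X → ℝ) → X → ℝ} {P : Lp ℝ p ν →L[ℝ] Lp ℝ p ν}
    (hP : InducesLp A P) {f : X → ℝ} (hf : MemLp f p ν) :
    eLpNorm (A f) p ν ≤ ENNReal.ofReal ‖P‖ * eLpNorm f p ν := by
  have h := P.le_opNorm (hf.toLp f)
  rw [hP.toLp hf, Lp.norm_toLp, Lp.norm_toLp] at h
  rw [← ENNReal.ofReal_toReal (hP.memLp hf).2.ne, ← ENNReal.ofReal_toReal hf.2.ne,
    ← ENNReal.ofReal_mul (norm_nonneg _)]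
  exact ENNReal.ofReal_le_ofReal h

lemma InducesLp.comp_eq {A B D : (X → ℝ) → X → ℝ} {P Q R : Lp ℝ p ν →L[ℝ] Lp ℝ p ν}
    (hP : InducesLp A P) (hQ : InducesLp B Q) (hR : InducesLp D R)
    (h : ∀ f, A (B f) = D f) : P.comp Q = R := by
  refine ContinuousLinearMap.ext fun f ↦ ?_
  have hf := Lp.memLp f
  rw [← Lp.toLp_coeFn f hf, ContinuousLinearMap.comp_apply, hQ.toLp hf, hP.toLp (hQ.memLp hf),
    hR.toLp hf]
  congr 1
  exact h f

lemma norm_rpow_eq_lintegral (hp : p ≠ ⊤) {f : X → ℝ} (hf : MemLp f p ν) :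
    ENNReal.ofReal (‖hf.toLp f‖ ^ p.toReal) = ∫⁻ x, ENNReal.ofReal (|f x| ^ p.toReal) ∂ν := by
  have hr := one_le_toReal (p := p) hp
  have hp0 : p ≠ 0 := fun h ↦ by rw [h] at hr; simp at hr; linarith
  rw [Lp.norm_toLp, ← ENNReal.ofReal_rpow_of_nonneg ENNReal.toReal_nonneg (by linarith),
    ENNReal.ofReal_toReal hf.2.ne, eLpNorm_eq_lintegral_rpow_enorm_toReal hp0 hp,
    ← ENNReal.rpow_mul, one_div, inv_mul_cancel₀ (by linarith), ENNReal.rpow_one]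
  refine lintegral_congr fun x ↦ ?_
  rw [Real.enorm_eq_ofReal_abs, ENNReal.ofReal_rpow_of_nonneg (abs_nonneg _) (by linarith)]

lemma eLpNorm_rpow_eq (hp : p ≠ ⊤) (f : X → ℝ) :
    eLpNorm f p ν = (∫⁻ x, ENNReal.ofReal (|f x| ^ p.toReal) ∂ν) ^ p.toReal⁻¹ := by
  have hr := one_le_toReal (p := p) hp
  have hp0 : p ≠ 0 := fun h ↦ by rw [h] at hr; simp at hr; linarith
  rw [eLpNorm_eq_lintegral_rpow_enorm_toReal hp0 hp, one_div]
  congr 1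
  refine lintegral_congr fun x ↦ ?_
  rw [Real.enorm_eq_ofReal_abs, ENNReal.ofReal_rpow_of_nonneg (abs_nonneg _) (by linarith)]

end Induced

/-! ### Weighted folding operators -/

section Fold

variable {X : Type*}

/-- The operator `f ↦ a f + b w^q (f ∘ R)`. -/
def fold (q : ℝ) (a b w : X → ℝ) (R : X → X) (f : X → ℝ) (y : X) : ℝ :=
  a y * f y + b y * w y ^ q * f (R y)

variable [MeasurableSpace X]

/-- The data of a folding operator: an involution `R` with Jacobian `w`, and coefficients `a`, `b`
such that the operator acts on `{y, R y}` by a projection matrix. -/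
structure IsFolding (ν : Measure X) (a b w : X → ℝ) (R : X → X) : Prop where
  measurable_a : Measurable a
  measurable_b : Measurable b
  measurable_w : Measurable w
  preserving : MeasurePreserving R (ν.withDensity fun y ↦ ENNReal.ofReal (w y)) ν
  invol : ∀ y, R (R y) = y
  pos : ∀ y, 0 < w y
  mul : ∀ y, w y * w (R y) = 1
  dich : ∀ y, (R y = y ∧ b y = 0 ∧ (a y = 0 ∨ a y = 1)) ∨
    (a (R y) = 1 - a y ∧ b (R y) = b y ∧ b y ^ 2 = a y * (1 - a y))

/-- The values of `(a, b)` accumulate on the circle `β² = ξ (1 - ξ)`, off the fixed points of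
`R`. -/
def Spreads (ν : Measure X) (a b : X → ℝ) (R : X → X) : Prop :=
  ∀ ξ ∈ Icc (0 : ℝ) 1, ∃ β, β ^ 2 = ξ * (1 - ξ) ∧ ∀ O ∈ 𝓝 (ξ, β), ∃ W, MeasurableSet W ∧
    0 < ν W ∧ ν W < ⊤ ∧ ∀ y ∈ W, R y ∉ W ∧ (a y, b y) ∈ O

namespace IsFolding

variable {ν : Measure X} {a b w : X → ℝ} {R : X → X} {p : ℝ≥0∞} [Fact (1 ≤ p)]

/-- The positive density w does not change the null sets, so R respects classes of functions modulo
ν. -/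
lemma quasi (h : IsFolding ν a b w R) : Measure.QuasiMeasurePreserving R ν ν :=
  h.preserving.quasiMeasurePreserving.mono_left
    (withDensity_absolutelyContinuous' h.measurable_w.ennreal_ofReal.aemeasurable
      (Eventually.of_forall fun y ↦ by simpa using h.pos y))

lemma lintegral_comp (h : IsFolding ν a b w R) {g : X → ℝ≥0∞} (hg : AEMeasurable g ν) :
    ∫⁻ y, ENNReal.ofReal (w y) * g (R y) ∂ν = ∫⁻ y, g y ∂ν := by
  have h1 : AEMeasurable (fun y ↦ g (R y)) ν := hg.comp_quasiMeasurePreserving h.quasi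
  have h2 := lintegral_withDensity_eq_lintegral_mul₀
    h.measurable_w.ennreal_ofReal.aemeasurable h1
  have h3 := lintegral_map' (μ := ν.withDensity fun y ↦ ENNReal.ofReal (w y)) (f := g) (g := R)
    (by rw [h.preserving.map_eq]; exact hg) h.preserving.aemeasurable
  rw [h.preserving.map_eq] at h3
  exact h2.symm.trans h3.symm

lemma mem_Icc (h : IsFolding ν a b w R) (y : X) : a y ∈ Icc (0 : ℝ) 1 := by
  rcases h.dich y with ⟨-, -, h0 | h0⟩ | ⟨-, -, h0⟩
  · simp [h0]
  · simp [h0]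
  · have := sq_nonneg (b y)
    constructor <;> nlinarith

lemma sq_b (h : IsFolding ν a b w R) (y : X) : b y ^ 2 = a y * (1 - a y) := by
  rcases h.dich y with ⟨-, h1, h0 | h0⟩ | ⟨-, -, h0⟩
  · simp [h0, h1]
  · simp [h0, h1]
  · exact h0

lemma weight_mul (h : IsFolding ν a b w R) (q : ℝ) (y : X) : w y ^ q * w (R y) ^ q = 1 := by
  rw [← Real.mul_rpow (h.pos y).le (h.pos _).le, h.mul, Real.one_rpow]

/-- In the coordinates (f(y), w(y)^q f(R y)) the matrix has rows (a, b) and (b, 1 - a) with b² = a(1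
- a), so it is idempotent. The weights cancel because w(y) w(R y) = 1. -/
lemma fold_fold (h : IsFolding ν a b w R) (q : ℝ) (f : X → ℝ) :
    fold q a b w R (fold q a b w R f) = fold q a b w R f := by
  funext y
  have hw := h.weight_mul q y
  simp only [fold, h.invol]
  rcases h.dich y with ⟨h1, h2, h3 | h3⟩ | ⟨h1, h2, h3⟩
  · simp [h2, h3]
  · simp [h2, h3]
  · rw [h1, h2]
    linear_combination (b y ^ 2 * f y) * hw + f y * h3

lemma fold_ae (h : IsFolding ν a b w R) (q : ℝ) {f g : X → ℝ} (hfg : f =ᵐ[ν] g) :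
    fold q a b w R f =ᵐ[ν] fold q a b w R g := by
  filter_upwards [hfg, h.quasi.ae hfg] with y h1 h2
  simp only [fold, h1, h2]

lemma aestronglyMeasurable_fold (h : IsFolding ν a b w R) (q : ℝ) {f : X → ℝ}
    (hf : AEStronglyMeasurable f ν) : AEStronglyMeasurable (fold q a b w R f) ν := by
  have h1 : AEMeasurable (fun y ↦ f (R y)) ν :=
    hf.aemeasurable.comp_quasiMeasurePreserving h.quasi
  exact ((h.measurable_a.aemeasurable.mul hf.aemeasurable).add
    ((h.measurable_b.aemeasurable.mul
      (h.measurable_w.pow_const q).aemeasurable).mul h1)).aestronglyMeasurable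

lemma weight_mul_abs {r c x : ℝ} (hr : 1 ≤ r) (hc : 0 < c) :
    c * |x| ^ r = |c ^ r⁻¹ * x| ^ r := by
  rw [abs_mul, abs_of_pos (Real.rpow_pos_of_pos hc _), Real.mul_rpow (by positivity) (abs_nonneg _),
    Real.rpow_inv_rpow hc.le (by linarith)]

/-- The action of a folding operator on a pair of reflected points. -/
lemma form_eq (h : IsFolding ν a b w R) {r : ℝ} (hr : 1 ≤ r) (f : X → ℝ) {y : X}
    (h1 : a (R y) = 1 - a y) (h2 : b (R y) = b y) :
    |fold r⁻¹ a b w R f y| ^ r + w y * |fold r⁻¹ a b w R f (R y)| ^ r =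
      awwForm r (a y) (b y) (f y) (w y ^ r⁻¹ * f (R y)) := by
  have hw := h.weight_mul r⁻¹ y
  have h3 : w y ^ r⁻¹ * fold r⁻¹ a b w R f (R y) =
      b y * f y + (1 - a y) * (w y ^ r⁻¹ * f (R y)) := by
    rw [fold, h1, h2, h.invol]
    linear_combination (b y * f y) * hw
  rw [weight_mul_abs hr (h.pos y), h3, awwForm, fold, mul_assoc]

lemma pair_le (h : IsFolding ν a b w R) (hp : p ≠ ⊤) (f : X → ℝ) (y : X) :
    |fold p.toReal⁻¹ a b w R f y| ^ p.toReal +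
        w y * |fold p.toReal⁻¹ a b w R f (R y)| ^ p.toReal ≤
      awwConst p ^ p.toReal * (|f y| ^ p.toReal + w y * |f (R y)| ^ p.toReal) := by
  have hr := one_le_toReal (p := p) hp
  have hB : 1 ≤ awwConst p ^ p.toReal := Real.one_le_rpow one_le_awwConst (by linarith)
  rcases h.dich y with ⟨h1, h2, h3⟩ | ⟨h1, h2, h3⟩
  · have h4 : |fold p.toReal⁻¹ a b w R f y| ^ p.toReal ≤ |f y| ^ p.toReal := by
      rcases h3 with h3 | h3
      · simp only [fold, h2, h3, zero_mul, add_zero, abs_zero]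
        rw [Real.zero_rpow (by linarith)]
        positivity
      · simp [fold, h2, h3]
    have h5 := (h.pos y).le
    rw [h1]
    have h6 : 0 ≤ |f y| ^ p.toReal + w y * |f y| ^ p.toReal := by positivity
    calc _ ≤ |f y| ^ p.toReal + w y * |f y| ^ p.toReal := by gcongr
      _ ≤ _ := le_mul_of_one_le_left h6 hB
  · rw [h.form_eq hr f h1 h2, weight_mul_abs hr (h.pos y)]
    exact awwForm_le hp (h.mem_Icc y) h3 _ _

/-- Twice the integral is the integral of |g(y)|^p + w(y)|g(R y)|^p, by the change of variables. The
inequality for A_ξ then applies at every point, and no fundamental domain of R has to be chosen. -/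
lemma lintegral_fold_le (h : IsFolding ν a b w R) (hp : p ≠ ⊤) {f : X → ℝ}
    (hf : AEStronglyMeasurable f ν) :
    ∫⁻ y, ENNReal.ofReal (|fold p.toReal⁻¹ a b w R f y| ^ p.toReal) ∂ν ≤
      ENNReal.ofReal (awwConst p ^ p.toReal) * ∫⁻ y, ENNReal.ofReal (|f y| ^ p.toReal) ∂ν := by
  have hm : ∀ g : X → ℝ, AEStronglyMeasurable g ν →
      AEMeasurable (fun y ↦ ENNReal.ofReal (|g y| ^ p.toReal)) ν := fun g hg ↦
    ((continuous_abs.measurable.comp_aemeasurable hg.aemeasurable).pow_const _).ennreal_ofReal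
  have hd : ∀ g : X → ℝ, AEStronglyMeasurable g ν →
      2 * ∫⁻ y, ENNReal.ofReal (|g y| ^ p.toReal) ∂ν =
        ∫⁻ y, ENNReal.ofReal (|g y| ^ p.toReal + w y * |g (R y)| ^ p.toReal) ∂ν := by
    intro g hg
    rw [two_mul]
    nth_rewrite 2 [← h.lintegral_comp (hm g hg)]
    rw [← lintegral_add_left' (hm g hg)]
    refine lintegral_congr fun y ↦ ?_
    rw [ENNReal.ofReal_add (by positivity) (mul_nonneg (h.pos y).le (by positivity)),
      ENNReal.ofReal_mul (h.pos y).le]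
  have h2 : 2 * ∫⁻ y, ENNReal.ofReal (|fold p.toReal⁻¹ a b w R f y| ^ p.toReal) ∂ν ≤
      2 * (ENNReal.ofReal (awwConst p ^ p.toReal) *
        ∫⁻ y, ENNReal.ofReal (|f y| ^ p.toReal) ∂ν) := by
    have hB : 0 ≤ awwConst p ^ p.toReal := Real.rpow_nonneg awwConst_nonneg _
    rw [hd _ (h.aestronglyMeasurable_fold _ hf), mul_left_comm, hd f hf,
      ← lintegral_const_mul' _ _ ENNReal.ofReal_ne_top]
    refine lintegral_mono fun y ↦ ?_
    rw [← ENNReal.ofReal_mul hB]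
    exact ENNReal.ofReal_le_ofReal (h.pair_le hp f y)
  exact (ENNReal.mul_le_mul_iff_right two_ne_zero ENNReal.ofNat_ne_top).1 h2

lemma abs_fold_le_top (h : IsFolding ν a b w R) (f : X → ℝ) (y : X) :
    |fold 0 a b w R f y| ≤ awwConst ⊤ * max |f y| |f (R y)| := by
  rw [fold, Real.rpow_zero, mul_one]
  exact abs_le_awwConst_top (h.mem_Icc y) (h.sq_b y) _ _

lemma eLpNorm_fold_le (h : IsFolding ν a b w R) {f : X → ℝ} (hf : MemLp f p ν) :
    eLpNorm (fold p.toReal⁻¹ a b w R f) p ν ≤ ENNReal.ofReal (awwConst p) * eLpNorm f p ν := by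
  by_cases hp : p = ⊤
  · subst hp
    rw [eLpNorm_exponent_top, eLpNorm_exponent_top]
    have h1 : ∀ᵐ y ∂ν, ‖f y‖ ≤ (eLpNormEssSup f ν).toReal := by
      filter_upwards [enorm_ae_le_eLpNormEssSup f ν] with y hy
      have := ENNReal.toReal_mono (by have := hf.2; rw [eLpNorm_exponent_top] at this; exact this.ne)
        hy
      rwa [toReal_enorm] at this
    have h2 := eLpNormEssSup_le_of_ae_bound (μ := ν)
      (f := fold (⊤ : ℝ≥0∞).toReal⁻¹ a b w R f)
      (C := awwConst ⊤ * (eLpNormEssSup f ν).toReal) (by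
        filter_upwards [h1, h.quasi.ae h1] with y hy hy'
        rw [ENNReal.toReal_top, inv_zero]
        exact (h.abs_fold_le_top f y).trans
          (mul_le_mul_of_nonneg_left (max_le hy hy') awwConst_nonneg))
    refine h2.trans (le_of_eq ?_)
    rw [ENNReal.ofReal_mul awwConst_nonneg, ENNReal.ofReal_toReal]
    have := hf.2
    rw [eLpNorm_exponent_top] at this
    exact this.ne
  · have hr := one_le_toReal (p := p) hp
    rw [eLpNorm_rpow_eq hp, eLpNorm_rpow_eq hp]
    refine (ENNReal.rpow_le_rpow (h.lintegral_fold_le hp hf.1) (by positivity)).trans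
      (le_of_eq ?_)
    rw [ENNReal.mul_rpow_of_nonneg _ _ (by positivity),
      ENNReal.ofReal_rpow_of_nonneg (by have := awwConst_nonneg (p := p); positivity)
        (by positivity), Real.rpow_rpow_inv awwConst_nonneg (by linarith)]

lemma fold_add (q : ℝ) (f g : X → ℝ) :
    fold q a b w R (f + g) = fold q a b w R f + fold q a b w R g := by
  funext y; simp only [fold, Pi.add_apply]; ring

lemma fold_smul (q c : ℝ) (f : X → ℝ) : fold q a b w R (c • f) = c • fold q a b w R f := by
  funext y; simp only [fold, Pi.smul_apply, smul_eq_mul]; ring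

theorem exists_inducesLp (h : IsFolding ν a b w R) :
    ∃ P : Lp ℝ p ν →L[ℝ] Lp ℝ p ν, InducesLp (fold p.toReal⁻¹ a b w R) P ∧ ‖P‖ ≤ awwConst p :=
  Latitudinal.exists_inducesLp awwConst_nonneg (fold_add _) (fold_smul _)
    (fun _ _ hfg ↦ h.fold_ae _ hfg) (fun _ hf ↦ h.aestronglyMeasurable_fold _ hf.1)
    (fun _ hf ↦ h.eLpNorm_fold_le hf)

lemma setLIntegral_preimage (h : IsFolding ν a b w R) {W : Set X} (hW : MeasurableSet W)
    {g : X → ℝ≥0∞} (hg : AEMeasurable g ν) :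
    ∫⁻ y in R ⁻¹' W, g y ∂ν = ∫⁻ y in W, ENNReal.ofReal (w y) * g (R y) ∂ν := by
  have hW' := h.preserving.measurable hW
  rw [← lintegral_indicator hW', ← lintegral_indicator hW,
    ← h.lintegral_comp (hg.indicator hW')]
  refine lintegral_congr fun y ↦ ?_
  by_cases hy : y ∈ W
  · rw [indicator_of_mem (by rwa [mem_preimage, h.invol]), indicator_of_mem hy]
  · rw [indicator_of_notMem (by rwa [mem_preimage, h.invol]), indicator_of_notMem hy, mul_zero]

/-- The function equal to `u` on `W` and to `v w^q` on its reflection. -/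
def pairFn (q : ℝ) (w : X → ℝ) (R : X → X) (W : Set X) (u v : ℝ) : X → ℝ :=
  W.indicator (fun _ ↦ u) + (R ⁻¹' W).indicator fun y ↦ v * w y ^ q

lemma pairFn_of_mem (h : IsFolding ν a b w R) (q : ℝ) {W : Set X} (hRW : ∀ y ∈ W, R y ∉ W)
    (u v : ℝ) {y : X} (hy : y ∈ W) :
    pairFn q w R W u v y = u ∧ w y ^ q * pairFn q w R W u v (R y) = v := by
  have h1 : y ∉ R ⁻¹' W := hRW y hy
  have h2 : R y ∈ R ⁻¹' W := by rwa [mem_preimage, h.invol]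
  have hw := h.weight_mul q y
  rw [pairFn, Pi.add_apply, Pi.add_apply, indicator_of_mem hy, indicator_of_notMem h1,
    indicator_of_notMem (hRW y hy), indicator_of_mem h2]
  exact ⟨by ring, by linear_combination v * hw⟩

lemma measurable_pairFn (h : IsFolding ν a b w R) (q : ℝ) {W : Set X} (hW : MeasurableSet W)
    (u v : ℝ) : Measurable (pairFn q w R W u v) :=
  (measurable_const.indicator hW).add
    ((measurable_const.mul (h.measurable_w.pow_const q)).indicator (h.preserving.measurable hW))

lemma lintegral_pair (h : IsFolding ν a b w R) {r : ℝ} {W : Set X}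
    (hW : MeasurableSet W) (hRW : ∀ y ∈ W, R y ∉ W) {g : X → ℝ} (hg : AEStronglyMeasurable g ν) :
    ∫⁻ y in W ∪ R ⁻¹' W, ENNReal.ofReal (|g y| ^ r) ∂ν =
      ∫⁻ y in W, ENNReal.ofReal (|g y| ^ r + w y * |g (R y)| ^ r) ∂ν := by
  have hm : AEMeasurable (fun y ↦ ENNReal.ofReal (|g y| ^ r)) ν :=
    ((continuous_abs.measurable.comp_aemeasurable hg.aemeasurable).pow_const _).ennreal_ofReal
  rw [lintegral_union (h.preserving.measurable hW) (disjoint_left.2 hRW),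
    h.setLIntegral_preimage hW hm, ← lintegral_add_left' hm.restrict]
  refine lintegral_congr fun y ↦ ?_
  rw [ENNReal.ofReal_add (by positivity) (mul_nonneg (h.pos y).le (by positivity)),
    ENNReal.ofReal_mul (h.pos y).le]

lemma lintegral_pairFn (h : IsFolding ν a b w R) {r : ℝ} (hr : 1 ≤ r) {W : Set X}
    (hW : MeasurableSet W) (hRW : ∀ y ∈ W, R y ∉ W) (u v : ℝ) :
    ∫⁻ y, ENNReal.ofReal (|pairFn r⁻¹ w R W u v y| ^ r) ∂ν =
      ENNReal.ofReal (|u| ^ r + |v| ^ r) * ν W := by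
  have hW' := h.preserving.measurable hW
  have h1 := h.lintegral_pair (r := r) hW hRW
    (h.measurable_pairFn r⁻¹ hW u v).aestronglyMeasurable
  have h2 : ∫⁻ y in W ∪ R ⁻¹' W, ENNReal.ofReal (|pairFn r⁻¹ w R W u v y| ^ r) ∂ν =
      ∫⁻ y, ENNReal.ofReal (|pairFn r⁻¹ w R W u v y| ^ r) ∂ν := by
    rw [← lintegral_indicator (hW.union hW')]
    refine lintegral_congr fun y ↦ ?_
    by_cases hy : y ∈ W ∪ R ⁻¹' W
    · rw [indicator_of_mem hy]
    · rw [indicator_of_notMem hy, pairFn, Pi.add_apply, indicator_of_notMem fun h ↦ hy (Or.inl h),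
        indicator_of_notMem fun h ↦ hy (Or.inr h), add_zero, abs_zero,
        Real.zero_rpow (by linarith), ENNReal.ofReal_zero]
  rw [← h2, h1, ← setLIntegral_const]
  refine setLIntegral_congr_fun hW fun y hy ↦ ?_
  have h3 := h.pairFn_of_mem r⁻¹ hRW u v hy
  simp only [weight_mul_abs hr (h.pos y), h3]

/-- The test function is u on a small set W and v, suitably weighted, on its mirror image. On these
sets (a, b) is close to (ξ, β), so the operator acts nearly as the constant matrix; disjointness of
W and its image lets u and v be chosen independently. -/
theorem awwConst_le_norm (h : IsFolding ν a b w R) (hs : Spreads ν a b R)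
    {P : Lp ℝ p ν →L[ℝ] Lp ℝ p ν} (hP : InducesLp (fold p.toReal⁻¹ a b w R) P) :
    awwConst p ≤ ‖P‖ := by
  by_cases hp : p = ⊤
  · subst hp
    refine awwConst_top_le (norm_nonneg _) fun ξ hξ ↦ ?_
    obtain ⟨β, hβ, H⟩ := hs ξ hξ
    refine ⟨β, hβ, fun u v ↦ ?_⟩
    by_contra! hlt
    obtain ⟨K, hK1, hK2⟩ := exists_between hlt
    have hO : {z : ℝ × ℝ | K < |z.1 * u + z.2 * v|} ∈ 𝓝 (ξ, β) :=
      (isOpen_lt continuous_const (by fun_prop)).mem_nhds hK2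
    obtain ⟨W, hW, hW0, -, hWO⟩ := H _ hO
    have hRW : ∀ y ∈ W, R y ∉ W := fun y hy ↦ (hWO y hy).1
    set f := pairFn 0 w R W u v
    have hpf : ∀ y ∈ W, f y = u ∧ w y ^ (0 : ℝ) * f (R y) = v := fun y hy ↦
      h.pairFn_of_mem 0 hRW u v hy
    have hfb : ∀ y, ‖f y‖ ≤ max |u| |v| := by
      intro y
      by_cases hy : y ∈ W
      · rw [(hpf y hy).1]
        exact le_max_left _ _
      · by_cases hy' : y ∈ R ⁻¹' W
        · simp [f, pairFn, hy, indicator_of_mem hy']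
        · simp [f, pairFn, hy, indicator_of_notMem hy']
    have hf : MemLp f ⊤ ν := memLp_top_of_bound
      (h.measurable_pairFn 0 hW u v).aestronglyMeasurable _ (Eventually.of_forall hfb)
    have h1 := hP.eLpNorm_le hf
    have h2 : eLpNorm f ⊤ ν ≤ ENNReal.ofReal (max |u| |v|) := by
      rw [eLpNorm_exponent_top]
      exact eLpNormEssSup_le_of_ae_bound (Eventually.of_forall hfb)
    have h3 := h1.trans (mul_le_mul_right h2 _)
    rw [← ENNReal.ofReal_mul (norm_nonneg _), eLpNorm_exponent_top] at h3
    have h4 : ∀ᵐ y ∂ν, y ∉ W := by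
      filter_upwards [enorm_ae_le_eLpNormEssSup (fold (⊤ : ℝ≥0∞).toReal⁻¹ a b w R f) ν] with y hy hyW
      have h5 := hy.trans h3
      have h6 := hpf y hyW
      rw [ENNReal.toReal_top, inv_zero, fold, mul_assoc, h6.1, h6.2, Real.enorm_eq_ofReal_abs,
        ENNReal.ofReal_le_ofReal_iff (by positivity)] at h5
      exact absurd (hWO y hyW).2 (not_lt.2 (h5.trans hK1.le))
    have h7 : ν W = 0 := by
      rw [ae_iff] at h4
      simpa using h4
    exact hW0.ne' h7
  · have hr := one_le_toReal (p := p) hp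
    refine awwConst_le hp (norm_nonneg _) fun ξ hξ ↦ ?_
    obtain ⟨β, hβ, H⟩ := hs ξ hξ
    refine ⟨β, hβ, fun u v ↦ ?_⟩
    by_contra! hlt
    obtain ⟨K, hK1, hK2⟩ := exists_between hlt
    have hc : Continuous fun z : ℝ × ℝ ↦ awwForm p.toReal z.1 z.2 u v := by
      unfold awwForm
      have hr0 : 0 ≤ p.toReal := by linarith
      fun_prop (disch := assumption)
    obtain ⟨W, hW, hW0, hWt, hWO⟩ := H {z : ℝ × ℝ | K < awwForm p.toReal z.1 z.2 u v}
      ((isOpen_lt continuous_const hc).mem_nhds hK2)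
    have hRW : ∀ y ∈ W, R y ∉ W := fun y hy ↦ (hWO y hy).1
    set f := pairFn p.toReal⁻¹ w R W u v
    have hpf : ∀ y ∈ W, f y = u ∧ w y ^ p.toReal⁻¹ * f (R y) = v := fun y hy ↦
      h.pairFn_of_mem p.toReal⁻¹ hRW u v hy
    have hfm := (h.measurable_pairFn p.toReal⁻¹ hW u v).aestronglyMeasurable (μ := ν)
    have hfi := h.lintegral_pairFn hr hW hRW u v
    have hf : MemLp f p ν := ⟨hfm, by
      rw [eLpNorm_rpow_eq hp, hfi]
      exact ENNReal.rpow_lt_top_of_nonneg (by positivity)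
        (ENNReal.mul_ne_top ENNReal.ofReal_ne_top hWt.ne)⟩
    have h1 := hP.eLpNorm_le hf
    rw [eLpNorm_rpow_eq hp, eLpNorm_rpow_eq hp] at h1
    have h2 := ENNReal.rpow_le_rpow h1 (by linarith : 0 ≤ p.toReal)
    rw [ENNReal.mul_rpow_of_nonneg _ _ (by linarith), ENNReal.rpow_inv_rpow (by linarith),
      ENNReal.rpow_inv_rpow (by linarith), hfi,
      ENNReal.ofReal_rpow_of_nonneg (norm_nonneg _) (by linarith), ← mul_assoc,
      ← ENNReal.ofReal_mul (by positivity)] at h2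
    have h3 : ENNReal.ofReal K * ν W ≤
        ∫⁻ y, ENNReal.ofReal (|fold p.toReal⁻¹ a b w R f y| ^ p.toReal) ∂ν := by
      refine le_trans ?_ (setLIntegral_le_lintegral (W ∪ R ⁻¹' W) _)
      rw [h.lintegral_pair hW hRW (h.aestronglyMeasurable_fold _ hfm), ← setLIntegral_const]
      refine setLIntegral_mono' hW fun y hy ↦ ENNReal.ofReal_le_ofReal ?_
      have h4 : a (R y) = 1 - a y ∧ b (R y) = b y := by
        rcases h.dich y with h5 | h5
        · exact absurd hy (by have := hRW y hy; rwa [h5.1] at this)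
        · exact ⟨h5.1, h5.2.1⟩
      have h6 := hpf y hy
      rw [h.form_eq hr f h4.1 h4.2, h6.1, h6.2]
      exact (hWO y hy).2.le
    have h5 := (ENNReal.mul_le_mul_iff_left hW0.ne' hWt.ne).1 (h3.trans h2)
    rw [ENNReal.ofReal_le_ofReal_iff (by positivity)] at h5
    exact absurd h5 (not_le.2 hK1)

lemma integral_comp (h : IsFolding ν a b w R) {k : X → ℝ} (hk : AEStronglyMeasurable k ν) :
    ∫ y, w y * k (R y) ∂ν = ∫ y, k y ∂ν := by
  have h1 := integral_map (μ := ν.withDensity fun y ↦ ENNReal.ofReal (w y)) (φ := R) (f := k)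
    h.preserving.aemeasurable (by rw [h.preserving.map_eq]; exact hk)
  rw [h.preserving.map_eq] at h1
  rw [h1, integral_withDensity_eq_integral_toReal_smul h.measurable_w.ennreal_ofReal
    (Eventually.of_forall fun _ ↦ ENNReal.ofReal_lt_top)]
  refine integral_congr_ae (Eventually.of_forall fun y ↦ ?_)
  simp only [ENNReal.toReal_ofReal (h.pos y).le, smul_eq_mul]

/-- Folding operators are symmetric on `L²`. -/
theorem isSymmetricL2 (h : IsFolding ν a b w R) (hp : p = 2) {P : Lp ℝ p ν →L[ℝ] Lp ℝ p ν}
    (hP : InducesLp (fold p.toReal⁻¹ a b w R) P) : IsSymmetricL2 P := by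
  subst hp
  set q : ℝ := (2 : ℝ≥0∞).toReal⁻¹ with hq
  -- Since q = 1/2, the Jacobian factor turns the weight at R y into the weight at y. Thus the
  -- change of variables exchanges f and g in the reflected term.
  have hq2 : ∀ y, w y * w (R y) ^ q = w y ^ q := by
    intro y
    have h1 : w y ^ q * w y ^ q = w y := by
      rw [← Real.rpow_add (h.pos y), hq]
      norm_num
    have h2 := h.weight_mul q y
    linear_combination (-(w (R y) ^ q)) * h1 + w y ^ q * h2
  have hint : ∀ f g : Lp ℝ 2 ν, Integrable (fun y ↦ f y * g y) ν := fun f g ↦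
    (Lp.memLp f).integrable_mul (Lp.memLp g)
  intro f g
  have hA : Integrable (fun y ↦ a y * (f y * g y)) ν := by
    refine (hint f g).bdd_mul (c := 1) h.measurable_a.aestronglyMeasurable
      (Eventually.of_forall fun y ↦ ?_)
    rw [Real.norm_eq_abs, abs_of_nonneg (h.mem_Icc y).1]
    exact (h.mem_Icc y).2
  have e1 : ∀ f g : Lp ℝ 2 ν, ∀ᵐ y ∂ν, P f y * g y - a y * (f y * g y) =
      b y * w y ^ q * f (R y) * g y := by
    intro f g
    filter_upwards [hP.coeFn f] with y hy
    rw [hy, fold]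
    ring
  have hA' : Integrable (fun y ↦ a y * (g y * f y)) ν := by simpa only [mul_comm (g _)] using hA
  have h1 := integral_sub (hint (P f) g) hA
  have h2 := integral_sub (hint (P g) f) hA'
  rw [integral_congr_ae (e1 f g)] at h1
  rw [integral_congr_ae (e1 g f)] at h2
  have hR : ∀ f : Lp ℝ 2 ν, AEMeasurable (fun y ↦ f (R y)) ν := fun f ↦
    (Lp.aestronglyMeasurable f).aemeasurable.comp_quasiMeasurePreserving h.quasi
  have h3 := h.integral_comp (k := fun y ↦ b y * w y ^ q * f (R y) * g y)
    ((((h.measurable_b.mul (h.measurable_w.pow_const q)).aemeasurable.mul (hR f)).mul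
      (Lp.aestronglyMeasurable g).aemeasurable).aestronglyMeasurable)
  have h4 : ∫ y, w y * (b (R y) * w (R y) ^ q * f (R (R y)) * g (R y)) ∂ν =
      ∫ y, b y * w y ^ q * g (R y) * f y ∂ν := by
    refine integral_congr_ae (Eventually.of_forall fun y ↦ ?_)
    have hb : b (R y) = b y := by
      rcases h.dich y with h5 | h5
      · rw [h5.1]
      · exact h5.2.1
    simp only [h.invol, hb, ← hq2 y]
    ring
  have h5 : ∫ y, a y * (f y * g y) ∂ν = ∫ y, a y * (g y * f y) ∂ν := by
    simp only [mul_comm (f _)]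
  have h6 : ∫ y, f y * P g y ∂ν = ∫ y, P g y * f y ∂ν := by simp only [mul_comm]
  rw [h6]
  linarith

theorem isIdempotentElem (h : IsFolding ν a b w R) {P : Lp ℝ p ν →L[ℝ] Lp ℝ p ν}
    (hP : InducesLp (fold p.toReal⁻¹ a b w R) P) : IsIdempotentElem P :=
  hP.comp_eq hP hP (h.fold_fold _)

end IsFolding
end Fold

/-! ### Operators on `C₀` given by formulas -/

section C0

variable {X : Type*} [TopologicalSpace X]

lemma norm_C0_le {f : C₀(X, ℝ)} {C : ℝ} (hC : 0 ≤ C) : ‖f‖ ≤ C ↔ ∀ y, |f y| ≤ C := by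
  rw [← ZeroAtInftyContinuousMap.norm_toBCF_eq_norm, BoundedContinuousFunction.norm_le hC]
  rfl

lemma abs_le_norm_C0 (f : C₀(X, ℝ)) (y : X) : |f y| ≤ ‖f‖ := (norm_C0_le (norm_nonneg f)).1 le_rfl y

lemma exists_inducesC0 {A : (X → ℝ) → X → ℝ} {C : ℝ} (hC : 0 ≤ C)
    (hadd : ∀ f g : X → ℝ, A (f + g) = A f + A g) (hsmul : ∀ (c : ℝ) (f : X → ℝ), A (c • f) = c • A f)
    (hc : ∀ f : C₀(X, ℝ), Continuous (A f)) (h0 : ∀ f : C₀(X, ℝ), Tendsto (A f) (cocompact X) (𝓝 0))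
    (hb : ∀ (f : C₀(X, ℝ)) y, |A f y| ≤ C * ‖f‖) :
    ∃ T : C₀(X, ℝ) →L[ℝ] C₀(X, ℝ), InducesC0 A T := by
  let L : C₀(X, ℝ) →ₗ[ℝ] C₀(X, ℝ) :=
    { toFun := fun f ↦ ⟨⟨A f, hc f⟩, h0 f⟩
      map_add' := fun f g ↦ DFunLike.coe_injective (hadd f g)
      map_smul' := fun c f ↦ DFunLike.coe_injective (hsmul c f) }
  exact ⟨L.mkContinuous C fun f ↦ (norm_C0_le (by positivity)).2 (hb f), fun f ↦ rfl⟩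

/-- Two Urysohn functions that vanish off disjoint neighbourhoods: at each point at most one of them
is nonzero, so the norm does not exceed the larger of |u| and |v|. -/
lemma exists_C0_pair [T2Space X] [LocallyCompactSpace X] {y z : X} (hyz : y ≠ z) (u v : ℝ) :
    ∃ f : C₀(X, ℝ), f y = u ∧ f z = v ∧ ‖f‖ ≤ max |u| |v| := by
  obtain ⟨U, V, hU, hV, hyU, hzV, hUV⟩ := t2_separation hyz
  obtain ⟨φ, h1, h2, h3, h4⟩ := exists_continuous_one_zero_of_isCompact (isCompact_singleton (x := y))
    hU.isClosed_compl (disjoint_compl_right_iff_subset.2 (singleton_subset_iff.2 hyU))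
  obtain ⟨χ, k1, k2, k3, k4⟩ := exists_continuous_one_zero_of_isCompact (isCompact_singleton (x := z))
    hV.isClosed_compl (disjoint_compl_right_iff_subset.2 (singleton_subset_iff.2 hzV))
  let F : C₀(X, ℝ) := u • ⟨φ, h3.is_zero_at_infty⟩ + v • ⟨χ, k3.is_zero_at_infty⟩
  have hF : ∀ x, F x = u * φ x + v * χ x := fun x ↦ rfl
  refine ⟨F, ?_, ?_, (norm_C0_le (by positivity)).2 fun x ↦ ?_⟩
  · rw [hF, h1 rfl, k2 (disjoint_left.1 hUV hyU)]
    simp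
  · rw [hF, k1 rfl, h2 (disjoint_right.1 hUV hzV)]
    simp
  · have key : ∀ c t : ℝ, t ∈ Icc (0 : ℝ) 1 → |c * t| ≤ |c| := fun c t ht ↦ by
      rw [abs_mul, abs_of_nonneg ht.1]
      exact mul_le_of_le_one_right (abs_nonneg c) ht.2
    rw [hF]
    by_cases hx : x ∈ U
    · rw [k2 (disjoint_left.1 hUV hx), Pi.zero_apply, mul_zero, add_zero]
      exact (key u _ (h4 x)).trans (le_max_left _ _)
    · rw [h2 hx, Pi.zero_apply, mul_zero, zero_add]
      exact (key v _ (k4 x)).trans (le_max_right _ _)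

/-- The values of `(a, b)` accumulate on the circle `β² = ξ (1 - ξ)`, off the fixed points of
`R`. -/
def SpreadsPoint (a b : X → ℝ) (R : X → X) : Prop :=
  ∀ ξ ∈ Icc (0 : ℝ) 1, ∃ β, β ^ 2 = ξ * (1 - ξ) ∧ ∀ O ∈ 𝓝 (ξ, β), ∃ y, R y ≠ y ∧ (a y, b y) ∈ O

lemma norm_C0_fold_le {a b : X → ℝ} {R : X → X} {T : C₀(X, ℝ) →L[ℝ] C₀(X, ℝ)}
    (hT : ∀ f y, T f y = a y * f y + b y * f (R y)) (ha : ∀ y, a y ∈ Icc (0 : ℝ) 1)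
    (hb : ∀ y, b y ^ 2 = a y * (1 - a y)) : ‖T‖ ≤ awwConst ⊤ := by
  refine ContinuousLinearMap.opNorm_le_bound _ awwConst_nonneg fun f ↦ ?_
  refine (norm_C0_le (mul_nonneg awwConst_nonneg (norm_nonneg _))).2 fun y ↦ ?_
  rw [hT]
  exact (abs_le_awwConst_top (ha y) (hb y) _ _).trans (mul_le_mul_of_nonneg_left
    (max_le (abs_le_norm_C0 _ _) (abs_le_norm_C0 _ _)) awwConst_nonneg)

/-- For p = ∞ the weight has exponent zero. A test function with prescribed values at the two points
y and R y replaces the test sets of positive measure. -/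
theorem norm_C0_fold [T2Space X] [LocallyCompactSpace X] {a b : X → ℝ} {R : X → X}
    {T : C₀(X, ℝ) →L[ℝ] C₀(X, ℝ)}
    (hT : ∀ f y, T f y = a y * f y + b y * f (R y)) (ha : ∀ y, a y ∈ Icc (0 : ℝ) 1)
    (hb : ∀ y, b y ^ 2 = a y * (1 - a y)) (hs : SpreadsPoint a b R) : ‖T‖ = awwConst ⊤ := by
  refine le_antisymm (norm_C0_fold_le hT ha hb) (awwConst_top_le T.opNorm_nonneg fun ξ hξ ↦ ?_)
  obtain ⟨β, hβ, H⟩ := hs ξ hξ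
  refine ⟨β, hβ, fun u v ↦ ?_⟩
  by_contra! hlt
  obtain ⟨y, hy, hyO⟩ := H {z : ℝ × ℝ | ‖T‖ * max |u| |v| < |z.1 * u + z.2 * v|}
    ((isOpen_lt continuous_const (by fun_prop)).mem_nhds hlt)
  obtain ⟨f, h1, h2, h3⟩ := exists_C0_pair hy.symm u v
  have h4 := (abs_le_norm_C0 (T f) y).trans ((T.le_opNorm f).trans
    (mul_le_mul_of_nonneg_left h3 T.opNorm_nonneg))
  rw [hT, h1, h2] at h4
  exact absurd hyO (not_lt.2 h4)

end C0

/-! ### Profiles and the operators on the line -/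

section Line

namespace IsProfile

variable {s : ℝ → ℝ} {δ : ℝ}

lemma eq_zero (hs : IsProfile s δ) {t : ℝ} (ht : t ≤ -δ) : s t = 0 := by
  by_contra h
  exact absurd (hs.tsupport_subset (subset_tsupport s h)) (not_lt.2 ht)

lemma eq_one (hs : IsProfile s δ) {t : ℝ} (ht : δ ≤ t) : s t = 1 := by
  have h := hs.sq_add_sq t
  rw [hs.eq_zero (t := -t) (by linarith)] at h
  have h1 := (hs.mem_Icc t).1
  nlinarith

lemma prod_sq (hs : IsProfile s δ) (t : ℝ) : (s t * s (-t)) ^ 2 = s t ^ 2 * (1 - s t ^ 2) := by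
  have h := hs.sq_add_sq t
  linear_combination (s t ^ 2) * h

/-- The values of a profile exhaust the circle, off the centre of the window. -/
lemma exists_window (hs : IsProfile s δ) (hδ : 0 < δ) {ε : ℝ} (hε : ε = 1 ∨ ε = -1) (ϑ ξ : ℝ)
    (hξ : ξ ∈ Icc (0 : ℝ) 1) : ∃ β, β ^ 2 = ξ * (1 - ξ) ∧ ∀ O ∈ 𝓝 (ξ, β), ∃ N : Set ℝ,
      IsOpen N ∧ N.Nonempty ∧ N ⊆ Ioo (ϑ - δ) (ϑ + δ) ∧
      ∀ t ∈ N, 2 * ϑ - t ∉ N ∧ (s (t - ϑ) ^ 2, ε * (s (t - ϑ) * s (ϑ - t))) ∈ O := by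
  have hε2 : ε ^ 2 = 1 := by rcases hε with h | h <;> rw [h] <;> norm_num
  have hsq : ∀ x ∈ Icc (0 : ℝ) 1, (ε * √(x * (1 - x))) ^ 2 = x * (1 - x) := fun x hx ↦ by
    rw [mul_pow, hε2, one_mul, Real.sq_sqrt (mul_nonneg hx.1 (sub_nonneg.2 hx.2))]
  refine ⟨ε * √(ξ * (1 - ξ)), hsq ξ hξ, fun O hO ↦ ?_⟩
  have hcont : Continuous fun x : ℝ ↦ (x, ε * √(x * (1 - x))) := by fun_prop
  have hO' : ∀ᶠ x in 𝓝 ξ, (x, ε * √(x * (1 - x))) ∈ interior O :=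
    hcont.continuousAt.eventually (isOpen_interior.mem_nhds (mem_interior_iff_mem_nhds.2 hO))
  obtain ⟨r, hr, hball⟩ := Metric.eventually_nhds_iff_ball.1 hO'
  -- The value ξ is perturbed to stay off 0 and 1, so that it is attained inside the open window,
  -- and off 1/2, the value at the centre, which is fixed by the reflection.
  have hc : ∃ c, c ∈ Ioo (0 : ℝ) 1 ∧ c ≠ 1 / 2 ∧ |c - ξ| < r := by
    rcases le_or_gt ξ (1 / 2) with h | h
    · have h1 : 0 < min (r / 2) (1 / 8) := by positivity
      have h2 := min_le_left (r / 2) (1 / 8)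
      have h3 := min_le_right (r / 2) ((1 : ℝ) / 8)
      by_cases h4 : ξ + min (r / 2) (1 / 8) = 1 / 2
      · refine ⟨ξ + min (r / 2) (1 / 8) / 2, ⟨by linarith [hξ.1], by linarith⟩, by linarith, ?_⟩
        rw [add_sub_cancel_left, abs_of_pos (by linarith)]
        linarith
      · refine ⟨ξ + min (r / 2) (1 / 8), ⟨by linarith [hξ.1], by linarith⟩, h4, ?_⟩
        rw [add_sub_cancel_left, abs_of_pos (by linarith)]
        linarith
    · have h1 : 0 < min (r / 2) (1 / 8) := by positivity
      have h2 := min_le_left (r / 2) (1 / 8)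
      have h3 := min_le_right (r / 2) ((1 : ℝ) / 8)
      by_cases h4 : ξ - min (r / 2) (1 / 8) = 1 / 2
      · refine ⟨ξ - min (r / 2) (1 / 8) / 2, ⟨by linarith, by linarith [hξ.2]⟩, by linarith, ?_⟩
        rw [sub_sub_cancel_left, abs_neg, abs_of_pos (by linarith)]
        linarith
      · refine ⟨ξ - min (r / 2) (1 / 8), ⟨by linarith, by linarith [hξ.2]⟩, h4, ?_⟩
        rw [sub_sub_cancel_left, abs_neg, abs_of_pos (by linarith)]
        linarith
  obtain ⟨c, hc01, hc2, hcr⟩ := hc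
  have hcs := hs.smooth.continuous
  have hivt := intermediate_value_Icc (a := -δ) (b := δ) (by linarith)
    (f := fun t ↦ s t ^ 2) (by fun_prop)
  obtain ⟨τ, hτ, hτc⟩ := hivt (show c ∈ Icc (s (-δ) ^ 2) (s δ ^ 2) by
    rw [hs.eq_zero le_rfl, hs.eq_one le_rfl]
    exact ⟨by simpa using hc01.1.le, by simpa using hc01.2.le⟩)
  simp only at hτc
  have hτ0 : τ ≠ 0 := by
    rintro rfl
    have h := hs.sq_add_sq 0
    rw [neg_zero] at h
    exact hc2 (by linarith)
  have hτ1 : -δ < τ := by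
    rcases hτ.1.eq_or_lt with h | h
    · rw [← h, hs.eq_zero le_rfl] at hτc
      have := hc01.1
      simp at hτc
      linarith
    · exact h
  have hτ2 : τ < δ := by
    rcases hτ.2.eq_or_lt with h | h
    · rw [h, hs.eq_one le_rfl] at hτc
      have := hc01.2
      simp at hτc
      linarith
    · exact h
  have hprod : s τ * s (-τ) = √(c * (1 - c)) := by
    rw [← hτc, ← hs.prod_sq, Real.sqrt_sq (mul_nonneg (hs.mem_Icc _).1 (hs.mem_Icc _).1)]
  have hΦ : Continuous fun t ↦ (s (t - ϑ) ^ 2, ε * (s (t - ϑ) * s (ϑ - t))) := by fun_prop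
  -- The radius |τ| keeps N on one side of the centre ϑ, hence disjoint from its mirror image.
  let N : Set ℝ := Ioo (ϑ - δ) (ϑ + δ) ∩ {t | |t - ϑ - τ| < |τ|} ∩
    (fun t ↦ (s (t - ϑ) ^ 2, ε * (s (t - ϑ) * s (ϑ - t)))) ⁻¹' interior O
  refine ⟨N, (isOpen_Ioo.inter (isOpen_lt (by fun_prop) continuous_const)).inter
    (isOpen_interior.preimage hΦ), ⟨ϑ + τ, ⟨⟨by linarith, by linarith⟩, ?_⟩, ?_⟩,
    fun t ht ↦ ht.1.1, fun t ht ↦ ⟨fun ht' ↦ ?_, interior_subset ht.2⟩⟩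
  · simpa using hτ0
  · have e1 : ϑ + τ - ϑ = τ := by ring
    have e2 : ϑ - (ϑ + τ) = -τ := by ring
    rw [mem_preimage, e1, e2, hτc, hprod]
    exact hball c (by rwa [Metric.mem_ball, Real.dist_eq])
  · have h1 : |t - ϑ - τ| < |τ| := ht.1.2
    have h2 : |2 * ϑ - t - ϑ - τ| < |τ| := ht'.1.2
    have h3 : |2 * τ| ≤ |t - ϑ - τ| + |2 * ϑ - t - ϑ - τ| := by
      have : 2 * τ = -((t - ϑ - τ) + (2 * ϑ - t - ϑ - τ)) := by ring
      rw [this, abs_neg]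
      exact abs_add_le _ _
    rw [abs_mul, abs_two] at h3
    linarith

lemma isFolding_line (hs : IsProfile s δ) {ε : ℝ} (hε : ε = 1 ∨ ε = -1) (ϑ : ℝ) :
    IsFolding (volume : Measure ℝ) (fun t ↦ s (t - ϑ) ^ 2)
      (fun t ↦ ε * (s (t - ϑ) * s (ϑ - t))) (fun _ ↦ 1) (fun t ↦ 2 * ϑ - t) := by
  have hε2 : ε ^ 2 = 1 := by rcases hε with h | h <;> rw [h] <;> norm_num
  have hc := hs.smooth.continuous
  refine ⟨by fun_prop, by fun_prop, measurable_const, ?_, fun y ↦ by ring, fun _ ↦ one_pos,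
    fun _ ↦ one_mul 1, fun y ↦ Or.inr ⟨?_, ?_, ?_⟩⟩
  · simp only [ENNReal.ofReal_one]
    rw [show (fun _ : ℝ ↦ (1 : ℝ≥0∞)) = 1 from rfl, withDensity_one]
    exact Measure.measurePreserving_sub_left volume (2 * ϑ)
  · have h := hs.sq_add_sq (y - ϑ)
    have e1 : 2 * ϑ - y - ϑ = -(y - ϑ) := by ring
    rw [e1]
    linarith
  · have e1 : 2 * ϑ - y - ϑ = ϑ - y := by ring
    have e2 : ϑ - (2 * ϑ - y) = y - ϑ := by ring
    rw [e1, e2]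
    ring
  · have h := hs.prod_sq (y - ϑ)
    rw [neg_sub] at h
    rw [mul_pow, hε2, one_mul, h]

lemma spreads_line (hs : IsProfile s δ) (hδ : 0 < δ) {ε : ℝ} (hε : ε = 1 ∨ ε = -1) (ϑ : ℝ) :
    Spreads (volume : Measure ℝ) (fun t ↦ s (t - ϑ) ^ 2)
      (fun t ↦ ε * (s (t - ϑ) * s (ϑ - t))) (fun t ↦ 2 * ϑ - t) := by
  intro ξ hξ
  obtain ⟨β, hβ, H⟩ := hs.exists_window hδ hε ϑ ξ hξ
  refine ⟨β, hβ, fun O hO ↦ ?_⟩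
  obtain ⟨N, hN, hne, hsub, hNO⟩ := H O hO
  exact ⟨N, hN.measurableSet, hN.measure_pos _ hne,
    (measure_mono hsub).trans_lt measure_Ioo_lt_top, hNO⟩

lemma awwLine_eq_fold (ε : ℝ) (s : ℝ → ℝ) (ϑ q : ℝ) :
    awwLine ε s ϑ = fold q (fun t ↦ s (t - ϑ) ^ 2)
      (fun t ↦ ε * (s (t - ϑ) * s (ϑ - t))) (fun _ ↦ 1) (fun t ↦ 2 * ϑ - t) := by
  funext h t
  simp only [awwLine, fold, Real.one_rpow]
  ring

end IsProfile

theorem awwLineNormLp (p : ℝ≥0∞) [Fact (1 ≤ p)] : AWWLineNormLp p (awwConst p) := by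
  intro δ ϑ ε s hδ hs hε
  have hF := hs.isFolding_line hε ϑ
  obtain ⟨P, hP, hPn⟩ := hF.exists_inducesLp (p := p)
  refine ⟨P, ?_, le_antisymm hPn (hF.awwConst_le_norm (hs.spreads_line hδ hε ϑ) hP)⟩
  rw [IsProfile.awwLine_eq_fold ε s ϑ p.toReal⁻¹]
  exact hP

theorem awwLineNormC0 : AWWLineNormC0 (awwConst ⊤) := by
  intro δ ϑ ε s hδ hs hε
  have hε1 : |ε| = 1 := by rcases hε with h | h <;> rw [h] <;> norm_num
  have hc := hs.smooth.continuous
  have hF := hs.isFolding_line hε ϑ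
  have hs1 : ∀ t, |s t| ≤ 1 := fun t ↦ abs_le.2 ⟨by linarith [(hs.mem_Icc t).1], (hs.mem_Icc t).2⟩
  have hbd : ∀ (f : C₀(ℝ, ℝ)) t, |awwLine ε s ϑ f t| ≤ |f t| + |f (2 * ϑ - t)| := by
    intro f t
    rw [awwLine]
    refine (abs_add_le _ _).trans (add_le_add ?_ ?_)
    · rw [abs_mul, abs_pow]
      exact mul_le_of_le_one_left (abs_nonneg _) (pow_le_one₀ (abs_nonneg _) (hs1 _))
    · rw [abs_mul, hε1, one_mul, abs_mul, abs_mul]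
      exact mul_le_of_le_one_left (abs_nonneg _)
        (mul_le_one₀ (hs1 _) (abs_nonneg _) (hs1 _))
  obtain ⟨T, hT⟩ := exists_inducesC0 (A := awwLine ε s ϑ) (C := 2) (by norm_num)
    (fun f g ↦ by funext t; simp only [awwLine, Pi.add_apply]; ring)
    (fun c f ↦ by funext t; simp only [awwLine, Pi.smul_apply, smul_eq_mul]; ring)
    (fun f ↦ by
      have := f.continuous
      unfold awwLine
      fun_prop)
    (fun f ↦ by
      have h1 : Tendsto (fun t ↦ |f t| + |f (2 * ϑ - t)|) (cocompact ℝ) (𝓝 0) := by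
        have h2 : Tendsto (fun t ↦ f (2 * ϑ - t)) (cocompact ℝ) (𝓝 0) :=
          (zero_at_infty f).comp (Homeomorph.subLeft (2 * ϑ)).isClosedEmbedding.tendsto_cocompact
        have h3 : Tendsto (fun t ↦ f t) (cocompact ℝ) (𝓝 0) := zero_at_infty f
        simpa using h3.abs.add h2.abs
      exact squeeze_zero_norm (hbd f) h1)
    (fun f t ↦ by
      refine (hbd f t).trans ?_
      linarith [abs_le_norm_C0 f t, abs_le_norm_C0 f (2 * ϑ - t)])
  refine ⟨T, hT, norm_C0_fold (a := fun t ↦ s (t - ϑ) ^ 2)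
    (b := fun t ↦ ε * (s (t - ϑ) * s (ϑ - t))) (R := fun t ↦ 2 * ϑ - t) (fun f t ↦ ?_)
    hF.mem_Icc hF.sq_b fun ξ hξ ↦ ?_⟩
  · rw [hT f, awwLine]
    ring
  · obtain ⟨β, hβ, H⟩ := hs.exists_window hδ hε ϑ ξ hξ
    refine ⟨β, hβ, fun O hO ↦ ?_⟩
    obtain ⟨N, -, ⟨t, ht⟩, -, hNO⟩ := H O hO
    exact ⟨t, fun h ↦ (hNO t ht).1 (by simpa only [h] using ht), (hNO t ht).2⟩

end Line

/-! ### Cut-off operators of folding type along the levels of a function -/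

lemma IsFolding.measurePreserving_of_lintegral {X : Type*} [MeasurableSpace X] {ν : Measure X}
    {w : X → ℝ} {R : X → X} (hR : Measurable R)
    (h : ∀ g : X → ℝ≥0∞, Measurable g → ∫⁻ y, ENNReal.ofReal (w y) * g (R y) ∂ν = ∫⁻ y, g y ∂ν) :
    MeasurePreserving R (ν.withDensity fun y ↦ ENNReal.ofReal (w y)) ν := by
  refine ⟨hR, Measure.ext fun S hS ↦ ?_⟩
  rw [Measure.map_apply hR hS, withDensity_apply _ (hR hS), ← lintegral_indicator (hR hS),
    ← lintegral_indicator_one hS, ← h _ (measurable_one.indicator hS)]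
  refine lintegral_congr fun y ↦ ?_
  by_cases hy : R y ∈ S
  · rw [indicator_of_mem (show y ∈ R ⁻¹' S from hy), indicator_of_mem hy, Pi.one_apply, mul_one]
  · rw [indicator_of_notMem (show y ∉ R ⁻¹' S from hy), indicator_of_notMem hy, mul_zero]

lemma Spreads.spreadsPoint {X : Type*} [MeasurableSpace X] {ν : Measure X}
    {a b : X → ℝ} {R : X → X} (h : Spreads ν a b R) : SpreadsPoint a b R := by
  intro ξ hξ
  obtain ⟨β, hβ, H⟩ := h ξ hξ
  refine ⟨β, hβ, fun O hO ↦ ?_⟩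
  obtain ⟨W, -, h0, -, hW⟩ := H O hO
  obtain ⟨y, hy⟩ := nonempty_of_measure_ne_zero h0.ne'
  exact ⟨y, fun h' ↦ (hW y hy).1 (by rwa [h']), (hW y hy).2⟩

/-- A folding operator `f ↦ a f + b w^q (f ∘ R)` that is the identity where `m ≥ ϑ + δ` and zero
where `m ≤ ϑ - δ`, together with a Hestenes operator that represents `f ↦ b w^q (f ∘ R)`. -/
structure Cut (d : ℕ) {M : Type*} [TopologicalSpace M] [ChartedSpace (EuclideanSpace ℝ (Fin d)) M]
    [MeasurableSpace M] (ν : Measure M) (m : M → ℝ) (δ q ϑ : ℝ) where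
  a : M → ℝ
  b : M → ℝ
  w : M → ℝ
  R : M → M
  H : SimpleH d M
  isFolding : IsFolding ν a b w R
  off : ∀ y, m y ∉ Ioo (ϑ - δ) (ϑ + δ) → b y = 0 ∧ R y = y ∧ w y = 1
  smooth_a : ContMDiff (𝓡 d) 𝓘(ℝ, ℝ) ∞ a
  tsupport_a : tsupport a ⊆ m ⁻¹' Ioi (ϑ - δ)
  tsupport_sub : tsupport (fun y ↦ 1 - a y) ⊆ m ⁻¹' Iio (ϑ + δ)
  source_subset : H.Φ.source ⊆ m ⁻¹' Ioo (ϑ - δ) (ϑ + δ)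
  target_subset : H.Φ.target ⊆ m ⁻¹' Ioo (ϑ - δ) (ϑ + δ)
  act_eq : ∀ f y, H.act f y = b y * w y ^ q * f (R y)

namespace Cut

variable {d : ℕ} {M : Type*} [TopologicalSpace M] [ChartedSpace (EuclideanSpace ℝ (Fin d)) M]
  [MeasurableSpace M] {ν : Measure M} {m : M → ℝ} {δ q ϑ ϑ₁ ϑ₂ : ℝ}

/-- The operator of a cut. -/
def op (E : Cut d ν m δ q ϑ) : (M → ℝ) → M → ℝ := fold q E.a E.b E.w E.R

lemma a_top (E : Cut d ν m δ q ϑ) {y : M} (hy : ϑ + δ ≤ m y) : E.a y = 1 := by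
  by_contra h
  exact absurd (E.tsupport_sub (subset_tsupport (fun y ↦ 1 - E.a y)
    (show 1 - E.a y ≠ 0 from sub_ne_zero.2 (Ne.symm h)))) (not_lt.2 hy)

lemma a_bot (E : Cut d ν m δ q ϑ) {y : M} (hy : m y ≤ ϑ - δ) : E.a y = 0 := by
  by_contra h
  exact absurd (E.tsupport_a (subset_tsupport _ h)) (not_lt.2 hy)

lemma R_mem (E : Cut d ν m δ q ϑ) {y : M} (hy : m y ∈ Ioo (ϑ - δ) (ϑ + δ)) :
    m (E.R y) ∈ Ioo (ϑ - δ) (ϑ + δ) := by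
  by_contra h
  have h1 := (E.off _ h).2.1
  rw [E.isFolding.invol] at h1
  rw [← h1] at h
  exact h hy

lemma op_of_notMem (E : Cut d ν m δ q ϑ) (f : M → ℝ) {y : M}
    (hy : m y ∉ Ioo (ϑ - δ) (ϑ + δ)) : E.op f y = E.a y * f y := by
  rw [op, fold, (E.off y hy).1]
  ring

lemma op_top (E : Cut d ν m δ q ϑ) (f : M → ℝ) {y : M} (hy : ϑ + δ ≤ m y) : E.op f y = f y := by
  rw [E.op_of_notMem f fun h ↦ absurd h.2 (not_lt.2 hy), E.a_top hy, one_mul]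

lemma op_bot (E : Cut d ν m δ q ϑ) (f : M → ℝ) {y : M} (hy : m y ≤ ϑ - δ) : E.op f y = 0 := by
  rw [E.op_of_notMem f fun h ↦ absurd h.1 (not_lt.2 hy), E.a_bot hy, zero_mul]

/-- The values of `E f` where `m > ϑ - δ` depend only on the values of `f` there. -/
lemma op_congr (E : Cut d ν m δ q ϑ) {f g : M → ℝ} {y : M} (h : f y = g y)
    (hw : m y ∈ Ioo (ϑ - δ) (ϑ + δ) → f (E.R y) = g (E.R y)) : E.op f y = E.op g y := by
  by_cases hy : m y ∈ Ioo (ϑ - δ) (ϑ + δ)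
  · rw [op, fold, fold, h, hw hy]
  · rw [E.op_of_notMem f hy, E.op_of_notMem g hy, h]

lemma op_op (E : Cut d ν m δ q ϑ) (f : M → ℝ) : E.op (E.op f) = E.op f := E.isFolding.fold_fold q f

lemma op_sub (E : Cut d ν m δ q ϑ) (f g : M → ℝ) :
    E.op (fun y ↦ f y - g y) = fun y ↦ E.op f y - E.op g y := by
  funext y
  simp only [op, fold]
  ring

lemma op_zero (E : Cut d ν m δ q ϑ) : E.op 0 = 0 := by
  funext y
  simp [op, fold]

section Pair

variable (E₁ : Cut d ν m δ q ϑ₁) (E₂ : Cut d ν m δ q ϑ₂)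

/-- All values that enter E₂ with a nonzero coefficient are taken where m > ϑ₂ - δ, and there E₁ f =
f. -/
lemma op_comp_of_lt (h : ϑ₁ + δ < ϑ₂ - δ) (f : M → ℝ) : E₂.op (E₁.op f) = E₂.op f := by
  funext y
  rcases le_or_gt (m y) (ϑ₂ - δ) with hy | hy
  · rw [E₂.op_bot _ hy, E₂.op_bot _ hy]
  · exact E₂.op_congr (E₁.op_top f (by linarith)) fun hw ↦
      E₁.op_top f (by linarith [(E₂.R_mem hw).1])

/-- E₂ f vanishes below the upper window, in particular on the whole lower window; above the lower
window E₁ is the identity. -/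
lemma op_comp_of_gt (h : ϑ₁ + δ < ϑ₂ - δ) (f : M → ℝ) : E₁.op (E₂.op f) = E₂.op f := by
  funext y
  rcases le_or_gt (ϑ₁ + δ) (m y) with hy | hy
  · rw [E₁.op_top _ hy]
  · have h0 : ∀ z, m z < ϑ₁ + δ → E₂.op f z = 0 := fun z hz ↦ E₂.op_bot f (by linarith)
    rw [h0 y hy, E₁.op_congr (g := 0) (h0 y hy) fun hw ↦ h0 _ (E₁.R_mem hw).2, op_zero]
    rfl

/-- The difference `E₁ - E₂`. -/
def diff (f : M → ℝ) (y : M) : ℝ := E₁.op f y - E₂.op f y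

/-- The coefficient `a` of `E₁ - E₂` as a folding operator. -/
def diffA (y : M) : ℝ := E₁.a y - E₂.a y

/-- The coefficient `b` of `E₁ - E₂` as a folding operator. -/
def diffB (y : M) : ℝ := E₁.b y - E₂.b y

/-- The weight `w` of `E₁ - E₂` as a folding operator. -/
def diffW (y : M) : ℝ := E₁.w y * E₂.w y

/-- The involution `R` of `E₁ - E₂` as a folding operator. -/
def diffR (y : M) : M := E₁.R (E₂.R y)

variable {E₁ E₂}

lemma diff_high {y : M} (hy : ϑ₁ + δ ≤ m y) :
    E₁.a y = 1 ∧ E₁.b y = 0 ∧ E₁.w y = 1 ∧ E₁.R y = y := by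
  have := E₁.off y fun h ↦ absurd h.2 (not_lt.2 hy)
  exact ⟨E₁.a_top hy, this.1, this.2.2, this.2.1⟩

lemma diffR_of_mem (h : ϑ₁ + δ < ϑ₂ - δ) {y : M} (hy : m y ∈ Ioo (ϑ₂ - δ) (ϑ₂ + δ)) :
    diffR E₁ E₂ y = E₂.R y :=
  (diff_high (by linarith [(E₂.R_mem hy).1])).2.2.2

/-- The windows are disjoint. Below the upper window E₂ vanishes and the difference is E₁; on it E₁
is the identity, and 1 - a₂, -b₂ satisfy the same relations as a₂, b₂; above it the difference is
zero. Each involution is the identity with weight one off its own window, so the involutions compose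
and the weights multiply. -/
theorem isFolding_diff (h : ϑ₁ + δ < ϑ₂ - δ) :
    IsFolding ν (diffA E₁ E₂) (diffB E₁ E₂) (diffW E₁ E₂) (diffR E₁ E₂) := by
  have H₁ := E₁.isFolding
  have H₂ := E₂.isFolding
  have hoff : ∀ y, m y ∉ Ioo (ϑ₂ - δ) (ϑ₂ + δ) → diffR E₁ E₂ y = E₁.R y ∧ E₂.b y = 0 ∧
      E₂.w y = 1 := fun y hy ↦ by
    obtain ⟨h1, h2, h3⟩ := E₂.off y hy
    exact ⟨by rw [diffR, h2], h1, h3⟩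
  have hR₁ : ∀ y, m y ∉ Ioo (ϑ₂ - δ) (ϑ₂ + δ) → m (E₁.R y) ∉ Ioo (ϑ₂ - δ) (ϑ₂ + δ) := by
    intro y hy
    by_cases hy' : m y ∈ Ioo (ϑ₁ - δ) (ϑ₁ + δ)
    · intro h'
      linarith [(E₁.R_mem hy').2, h'.1]
    · rwa [(E₁.off y hy').2.1]
  have hw : ∀ y, E₁.w (E₂.R y) = E₁.w y := fun y ↦ by
    by_cases hy : m y ∈ Ioo (ϑ₂ - δ) (ϑ₂ + δ)
    · rw [(diff_high (E₁ := E₁) (y := y) (by linarith [hy.1])).2.2.1,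
        (diff_high (E₁ := E₁) (y := E₂.R y) (by linarith [(E₂.R_mem hy).1])).2.2.1]
    · rw [(E₂.off y hy).2.1]
  refine ⟨H₁.measurable_a.sub H₂.measurable_a, H₁.measurable_b.sub H₂.measurable_b,
    H₁.measurable_w.mul H₂.measurable_w, IsFolding.measurePreserving_of_lintegral
    (H₁.preserving.measurable.comp H₂.preserving.measurable) fun g hg ↦ ?_, fun y ↦ ?_,
    fun y ↦ mul_pos (H₁.pos y) (H₂.pos y), fun y ↦ ?_, fun y ↦ ?_⟩
  · have hm : Measurable fun y ↦ ENNReal.ofReal (E₁.w y) * g (E₁.R y) :=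
      H₁.measurable_w.ennreal_ofReal.mul (hg.comp H₁.preserving.measurable)
    rw [← H₁.lintegral_comp hg.aemeasurable, ← H₂.lintegral_comp hm.aemeasurable]
    refine lintegral_congr fun y ↦ ?_
    rw [diffW, mul_comm (E₁.w y), ENNReal.ofReal_mul (H₂.pos y).le, hw, mul_assoc]
    rfl
  · by_cases hy : m y ∈ Ioo (ϑ₂ - δ) (ϑ₂ + δ)
    · rw [diffR_of_mem h hy, diffR_of_mem h (E₂.R_mem hy), H₂.invol]
    · rw [(hoff y hy).1, (hoff _ (hR₁ y hy)).1, H₁.invol]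
  · by_cases hy : m y ∈ Ioo (ϑ₂ - δ) (ϑ₂ + δ)
    · rw [diffR_of_mem h hy, diffW, diffW, hw, (diff_high (by linarith [hy.1])).2.2.1, one_mul,
        one_mul, H₂.mul]
    · rw [(hoff y hy).1, diffW, diffW, (hoff y hy).2.2, (hoff _ (hR₁ y hy)).2.2, mul_one, mul_one,
        H₁.mul]
  · by_cases hy : m y ∈ Ioo (ϑ₂ - δ) (ϑ₂ + δ)
    · rw [diffR_of_mem h hy]
      obtain ⟨h1, h2, -, h4⟩ := diff_high (E₁ := E₁) (y := y) (by linarith [hy.1])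
      obtain ⟨h1', h2', -, -⟩ := diff_high (E₁ := E₁) (y := E₂.R y)
        (by linarith [(E₂.R_mem hy).1])
      simp only [diffA, diffB, h1, h2, h1', h2', zero_sub, neg_eq_zero, neg_inj, neg_sq]
      rcases H₂.dich y with ⟨k1, k2, k3⟩ | ⟨k1, k2, k3⟩
      · refine Or.inl ⟨k1, k2, ?_⟩
        rcases k3 with k3 | k3 <;> rw [k3] <;> norm_num
      · refine Or.inr ⟨by rw [k1], k2, ?_⟩
        rw [k3]
        ring
    · rw [(hoff y hy).1]
      simp only [diffA, diffB, (hoff y hy).2.1, (hoff _ (hR₁ y hy)).2.1, sub_zero]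
      rcases le_or_gt (m y) (ϑ₂ - δ) with hy1 | hy1
      · have ha : ∀ z, m z ≤ ϑ₂ - δ → E₂.a z = 0 := fun z hz ↦ E₂.a_bot hz
        have hz : m (E₁.R y) ≤ ϑ₂ - δ := by
          by_cases hy' : m y ∈ Ioo (ϑ₁ - δ) (ϑ₁ + δ)
          · linarith [(E₁.R_mem hy').2]
          · rwa [(E₁.off y hy').2.1]
        rw [ha _ hy1, ha _ hz, sub_zero, sub_zero]
        exact H₁.dich y
      · have hy2 : ϑ₂ + δ ≤ m y := by
          by_contra h'
          exact hy ⟨hy1, not_le.1 h'⟩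
        obtain ⟨h1, h2, -, h4⟩ := diff_high (E₁ := E₁) (y := y) (by linarith)
        exact Or.inl ⟨h4, h2, Or.inl (by rw [h1, E₂.a_top hy2, sub_self])⟩

theorem diff_eq_fold (h : ϑ₁ + δ < ϑ₂ - δ) :
    diff E₁ E₂ = fold q (diffA E₁ E₂) (diffB E₁ E₂) (diffW E₁ E₂) (diffR E₁ E₂) := by
  funext f y
  rw [diff, op, op, fold, fold, fold]
  by_cases hy : m y ∈ Ioo (ϑ₂ - δ) (ϑ₂ + δ)
  · obtain ⟨h1, h2, h3, h4⟩ := diff_high (E₁ := E₁) (y := y) (by linarith [hy.1])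
    rw [diffR_of_mem h hy, diffA, diffB, diffW, h1, h2, h3]
    simp only [one_mul]
    ring
  · obtain ⟨h1, h2, h3⟩ := E₂.off y hy
    rw [diffR, diffA, diffB, diffW, h1, h2, h3]
    simp only [mul_one]
    ring

/-- The upper window alone suffices: there (a, b) is the image of (a₂, b₂) under (ξ, β) ↦ (1 - ξ,
-β), which preserves the circle. The lower cut may be the identity. -/
theorem spreads_diff (h : ϑ₁ + δ < ϑ₂ - δ) (hs : Spreads ν E₂.a E₂.b E₂.R) :
    Spreads ν (diffA E₁ E₂) (diffB E₁ E₂) (diffR E₁ E₂) := by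
  intro ξ hξ
  obtain ⟨β, hβ, H⟩ := hs (1 - ξ) ⟨by linarith [hξ.2], by linarith [hξ.1]⟩
  refine ⟨-β, by rw [neg_sq, hβ]; ring, fun O hO ↦ ?_⟩
  have hc : Continuous fun z : ℝ × ℝ ↦ (1 - z.1, -z.2) := by fun_prop
  have hO' : (fun z : ℝ × ℝ ↦ (1 - z.1, -z.2)) ⁻¹' O ∈ 𝓝 (1 - ξ, β) :=
    hc.continuousAt.preimage_mem_nhds (by simpa using hO)
  obtain ⟨W, hW, h0, h1, hWO⟩ := H _ hO'
  refine ⟨W, hW, h0, h1, fun y hy ↦ ?_⟩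
  obtain ⟨k1, k2⟩ := hWO y hy
  have hy' : m y ∈ Ioo (ϑ₂ - δ) (ϑ₂ + δ) := by
    by_contra h'
    exact k1 (by rwa [(E₂.off y h').2.1])
  obtain ⟨h1, h2, -, -⟩ := diff_high (E₁ := E₁) (y := y) (by linarith [hy'.1])
  rw [diffR_of_mem h hy', diffA, diffB, h1, h2, zero_sub]
  exact ⟨k1, k2⟩

lemma diff_eq_zero (h : ϑ₁ + δ < ϑ₂ - δ) (f : M → ℝ) {y : M} (hy : m y ≤ ϑ₁ - δ ∨ ϑ₂ + δ ≤ m y)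
    (hδ : 0 < δ) : diff E₁ E₂ f y = 0 := by
  rcases hy with hy | hy
  · rw [diff, E₁.op_bot f hy, E₂.op_bot f (by linarith), sub_zero]
  · rw [diff, E₂.op_top f hy, E₁.op_top f (by linarith), sub_self]

end Pair

end Cut

/-! ### Hestenes operators on `C₀` -/

section Hestenes

variable {d : ℕ} {M : Type*} [TopologicalSpace M] [ChartedSpace (EuclideanSpace ℝ (Fin d)) M]

namespace SimpleH

lemma act_of_mem (H : SimpleH d M) (f : M → ℝ) {x : M} (hx : x ∈ H.Φ.source) :
    H.act f x = H.φ x * f (H.Φ x) := if_pos hx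

lemma act_of_notMem (H : SimpleH d M) (f : M → ℝ) {x : M} (hx : x ∉ tsupport H.φ) :
    H.act f x = 0 := by
  rw [act]
  split_ifs
  · rw [image_eq_zero_of_notMem_tsupport hx, zero_mul]
  · rfl

lemma continuous_act (H : SimpleH d M) {f : M → ℝ} (hf : Continuous f) :
    Continuous (H.act f) := by
  refine continuous_iff_continuousAt.2 fun x ↦ ?_
  by_cases hx : x ∈ H.Φ.source
  · have h1 : ContinuousAt (fun y ↦ H.φ y * f (H.Φ y)) x :=
      H.smooth_φ.continuous.continuousAt.mul (hf.continuousAt.comp (H.Φ.continuousAt hx))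
    refine h1.congr ?_
    filter_upwards [H.Φ.open_source.mem_nhds hx] with y hy
    exact (H.act_of_mem f hy).symm
  · have h1 : ContinuousAt (fun _ : M ↦ (0 : ℝ)) x := continuousAt_const
    refine h1.congr ?_
    filter_upwards [(isClosed_tsupport H.φ).isOpen_compl.mem_nhds
      fun h ↦ hx (H.tsupport_subset h)] with y hy
    exact (H.act_of_notMem f hy).symm

lemma exists_inducesC0 (H : SimpleH d M) : ∃ T : C₀(M, ℝ) →L[ℝ] C₀(M, ℝ), InducesC0 H.act T := by
  obtain ⟨C, hC⟩ := H.hasCompactSupport.exists_bound_of_continuous H.smooth_φ.continuous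
  refine Latitudinal.exists_inducesC0 (le_max_right C 0) (fun f g ↦ ?_) (fun c f ↦ ?_)
    (fun f ↦ H.continuous_act f.continuous) (fun f ↦ ?_) fun f y ↦ ?_
  · funext x
    simp only [act, Pi.add_apply]
    split_ifs <;> ring
  · funext x
    simp only [act, Pi.smul_apply, smul_eq_mul]
    split_ifs <;> ring
  · have h : HasCompactSupport (H.act f) := H.hasCompactSupport.mono' fun x hx ↦ by
      by_contra h
      exact hx (H.act_of_notMem f h)
    exact h.is_zero_at_infty
  · rw [act]
    split_ifs
    · rw [abs_mul]
      exact mul_le_mul ((hC y).trans (le_max_left _ _)) (abs_le_norm_C0 f _) (abs_nonneg _)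
        (le_max_right _ _)
    · rw [abs_zero]
      exact mul_nonneg (le_max_right _ _) (norm_nonneg f)

/-- The multiplication by a function with compact support in `U`. -/
def ofFunction {φ : M → ℝ} (h : ContMDiff (𝓡 d) 𝓘(ℝ, ℝ) ∞ φ) (hc : HasCompactSupport φ)
    {U : Set M} (hU : IsOpen U) (hφ : tsupport φ ⊆ U) : SimpleH d M where
  φ := φ
  Φ := OpenPartialHomeomorph.ofSet U hU
  smooth_φ := h
  hasCompactSupport := hc
  tsupport_subset := hφ
  smooth_Φ := contMDiffOn_id
  smooth_symm := contMDiffOn_id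

lemma ofFunction_act {φ : M → ℝ} (h : ContMDiff (𝓡 d) 𝓘(ℝ, ℝ) ∞ φ) (hc : HasCompactSupport φ)
    {U : Set M} (hU : IsOpen U) (hφ : tsupport φ ⊆ U) (f : M → ℝ) (x : M) :
    (ofFunction h hc hU hφ).act f x = φ x * f x := by
  by_cases hx : x ∈ U
  · exact act_of_mem _ f hx
  · rw [act_of_notMem _ f fun h' ↦ hx (hφ h'), image_eq_zero_of_notMem_tsupport fun h' ↦ hx (hφ h'),
      zero_mul]

end SimpleH

namespace Cut

variable [MeasurableSpace M] {ν : Measure M} {m : M → ℝ} {δ q ϑ ϑ₁ ϑ₂ : ℝ}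
  {E₁ : Cut d ν m δ q ϑ₁} {E₂ : Cut d ν m δ q ϑ₂}

/-- Where a₁ = 0 also a₂ = 0, and where a₂ = 1 also a₁ = 1. So the closed supports of a₁ and of 1 -
a₂ bound the support from below and from above. -/
lemma tsupport_diffA (h : ϑ₁ + δ < ϑ₂ - δ) :
    tsupport (diffA E₁ E₂) ⊆ m ⁻¹' Ioo (ϑ₁ - δ) (ϑ₂ + δ) := by
  have h1 : tsupport (diffA E₁ E₂) ⊆ tsupport E₁.a := closure_mono fun y hy h0 ↦ hy (by
    rw [diffA, h0, zero_sub, neg_eq_zero]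
    refine E₂.a_bot ?_
    by_contra h'
    have := E₁.a_top (y := y) (by linarith)
    rw [h0] at this
    exact zero_ne_one this)
  have h2 : tsupport (diffA E₁ E₂) ⊆ tsupport fun y ↦ 1 - E₂.a y := closure_mono fun y hy h0 ↦ hy (by
    simp only at h0
    rw [diffA, ← sub_eq_zero.1 h0, sub_eq_zero]
    refine E₁.a_top ?_
    by_contra h'
    have := E₂.a_bot (y := y) (by linarith)
    rw [this, sub_zero] at h0
    exact one_ne_zero h0)
  exact fun y hy ↦ ⟨E₁.tsupport_a (h1 hy), E₂.tsupport_sub (h2 hy)⟩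

/-- Three simple Hestenes operators: multiplication by a₁ - a₂, whose support is compact although
those of a₁ and a₂ need not be, the reflected term of E₁, and minus that of E₂. -/
theorem exists_inducesC0_diff (hδ : 0 < δ) (h : ϑ₁ + δ < ϑ₂ - δ) (hm : Continuous m)
    (hc : ∀ b, IsCompact (m ⁻¹' Iic b)) :
    ∃ T : C₀(M, ℝ) →L[ℝ] C₀(M, ℝ), InducesC0 (diff E₁ E₂) T ∧
      IsLocalizedHOperator d T (m ⁻¹' Ioo (ϑ₁ - δ) (ϑ₂ + δ)) := by
  have hts := tsupport_diffA (E₁ := E₁) (E₂ := E₂) h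
  have hcs : HasCompactSupport (diffA E₁ E₂) := (hc (ϑ₂ + δ)).of_isClosed_subset
    (isClosed_tsupport _) fun y hy ↦ (hts hy).2.le
  let H₀ : SimpleH d M := SimpleH.ofFunction (E₁.smooth_a.sub E₂.smooth_a) hcs
    (isOpen_Ioo.preimage hm) hts
  have hH₀ : ∀ f x, H₀.act f x = diffA E₁ E₂ x * f x := SimpleH.ofFunction_act _ _ _ _
  obtain ⟨T₀, hT₀⟩ := H₀.exists_inducesC0
  obtain ⟨T₁, hT₁⟩ := E₁.H.exists_inducesC0
  obtain ⟨T₂, hT₂⟩ := E₂.H.exists_inducesC0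
  have happ : ∀ f x, (T₀ + T₁ - T₂) f x = H₀.act f x + E₁.H.act f x - E₂.H.act f x := fun f x ↦ by
    rw [← hT₀, ← hT₁, ← hT₂]
    rfl
  refine ⟨T₀ + T₁ - T₂, fun f ↦ funext fun x ↦ ?_, 3, ![1, 1, -1], ![H₀, E₁.H, E₂.H], fun k ↦ ?_,
    fun f x ↦ ?_⟩
  · rw [happ, hH₀, diffA, E₁.act_eq, E₂.act_eq, diff, op, op, fold, fold]
    ring
  · have s1 : m ⁻¹' Ioo (ϑ₁ - δ) (ϑ₁ + δ) ⊆ m ⁻¹' Ioo (ϑ₁ - δ) (ϑ₂ + δ) :=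
      preimage_mono (Ioo_subset_Ioo_right (by linarith))
    have s2 : m ⁻¹' Ioo (ϑ₂ - δ) (ϑ₂ + δ) ⊆ m ⁻¹' Ioo (ϑ₁ - δ) (ϑ₂ + δ) :=
      preimage_mono (Ioo_subset_Ioo_left (by linarith))
    fin_cases k
    · exact ⟨subset_rfl, subset_rfl⟩
    · exact ⟨E₁.source_subset.trans s1, E₁.target_subset.trans s1⟩
    · exact ⟨E₂.source_subset.trans s2, E₂.target_subset.trans s2⟩
  · rw [happ, Fin.sum_univ_three]
    simp [sub_eq_add_neg]

theorem norm_C0_diff [T2Space M] (hq : q = 0) (h : ϑ₁ + δ < ϑ₂ - δ)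
    (hs : Spreads ν E₂.a E₂.b E₂.R) {T : C₀(M, ℝ) →L[ℝ] C₀(M, ℝ)}
    (hT : InducesC0 (diff E₁ E₂) T) : ‖T‖ = awwConst ⊤ := by
  have := ChartedSpace.locallyCompactSpace (EuclideanSpace ℝ (Fin d)) M
  subst hq
  exact norm_C0_fold (fun f y ↦ by rw [hT, diff_eq_fold h, fold, Real.rpow_zero, mul_one])
    (isFolding_diff h).mem_Icc (isFolding_diff h).sq_b (spreads_diff h hs).spreadsPoint

lemma diff_diff (h : ϑ₁ + δ < ϑ₂ - δ) (f : M → ℝ) :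
    diff E₁ E₂ (diff E₁ E₂ f) = diff E₁ E₂ f := by
  rw [diff_eq_fold h]
  exact (isFolding_diff h).fold_fold q f

end Cut

lemma InducesC0.comp_eq {A B D : (M → ℝ) → M → ℝ} {P Q R : C₀(M, ℝ) →L[ℝ] C₀(M, ℝ)}
    (hP : InducesC0 A P) (hQ : InducesC0 B Q) (hR : InducesC0 D R)
    (h : ∀ f, A (B f) = D f) : P.comp Q = R := by
  refine ContinuousLinearMap.ext fun f ↦ DFunLike.coe_injective ?_
  rw [ContinuousLinearMap.comp_apply, hP, hQ, hR, h]

end Hestenes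

/-! ### Decompositions of the identity into folding operators -/

/-- The folding operators `D i`, localized on the sets `U i`, sum up to the identity; the finite
set `S y` of at most two indices contains all `i` with `y ∈ U i`. -/
structure IsPartition {X ι : Type*} [MeasurableSpace X] (ν : Measure X) (q : ℝ)
    (D : ι → (X → ℝ) → X → ℝ) (U : ι → Set X) (S : X → Finset ι) : Prop where
  exists_folding : ∀ i, ∃ (a b w : X → ℝ) (R : X → X), IsFolding ν a b w R ∧ D i = fold q a b w R ∧
    (∀ y ∈ U i, R y ∈ U i) ∧ ∀ y, y ∉ U i → a y = 0 ∧ b y = 0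
  measurableSet : ∀ i, MeasurableSet (U i)
  mem : ∀ i y, y ∈ U i → i ∈ S y
  card_le : ∀ y, (S y).card ≤ 2
  sum_eq : ∀ f y, ∑ i ∈ S y, D i f y = f y
  comp_eq_zero : ∀ i j, i ≠ j → ∀ f, D i (D j f) = 0

namespace IsPartition

variable {X ι : Type*} [MeasurableSpace X] {ν : Measure X} {q : ℝ}
  {D : ι → (X → ℝ) → X → ℝ} {U : ι → Set X} {S : X → Finset ι}

lemma apply_eq_zero (h : IsPartition ν q D U S) {i : ι} (f : X → ℝ) {y : X} (hy : y ∉ U i) :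
    D i f y = 0 := by
  obtain ⟨a, b, w, R, -, hD, -, h0⟩ := h.exists_folding i
  rw [hD, fold, (h0 y hy).1, (h0 y hy).2]
  ring

lemma apply_indicator (h : IsPartition ν q D U S) (i : ι) (f : X → ℝ) :
    D i ((U i).indicator f) = D i f := by
  obtain ⟨a, b, w, R, -, hD, hR, h0⟩ := h.exists_folding i
  funext y
  rw [hD, fold, fold]
  by_cases hy : y ∈ U i
  · rw [indicator_of_mem hy, indicator_of_mem (hR y hy)]
  · rw [(h0 y hy).1, (h0 y hy).2]
    ring

lemma comp_self (h : IsPartition ν q D U S) (i : ι) (f : X → ℝ) : D i (D i f) = D i f := by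
  obtain ⟨a, b, w, R, hF, hD, -⟩ := h.exists_folding i
  rw [hD, hF.fold_fold]

open Classical in
-- At a given point the remainder of any partial sum consists of at most two terms. Both the lower
-- bounds and the convergence of the sum rest on this.
lemma sub_sum (h : IsPartition ν q D U S) (s : Finset ι) (f : X → ℝ) (y : X) :
    f y - ∑ i ∈ s, D i f y = ∑ i ∈ S y \ s, D i f y := by
  have h1 : ∑ i ∈ s, D i f y = ∑ i ∈ S y ∩ s, D i f y := by
    refine (Finset.sum_subset Finset.inter_subset_right fun i hi hi' ↦ ?_).symm
    exact h.apply_eq_zero f fun hy ↦ hi' (Finset.mem_inter.2 ⟨h.mem i y hy, hi⟩)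
  rw [h1, sub_eq_iff_eq_add, add_comm, Finset.sum_inter_add_sum_sdiff, h.sum_eq]

lemma sub_sum_eq_zero (h : IsPartition ν q D U S) {s : Finset ι} (f : X → ℝ) {y : X}
    (hs : S y ⊆ s) : f y - ∑ i ∈ s, D i f y = 0 := by
  classical
  rw [h.sub_sum, Finset.sdiff_eq_empty_iff_subset.2 hs, Finset.sum_empty]

/-- Convexity for at most two terms gives 2^{r-1}. The right side does not depend on s: the empty
set yields the lower bound for the norms, and in general it is the dominating function for
convergence. -/
lemma rpow_sub_sum_le (h : IsPartition ν q D U S) {r : ℝ} (hr : 1 ≤ r) (s : Finset ι) (f : X → ℝ)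
    (y : X) : ENNReal.ofReal (|f y - ∑ i ∈ s, D i f y| ^ r) ≤
      ENNReal.ofReal (2 ^ (r - 1)) * ∑' i, ENNReal.ofReal (|D i f y| ^ r) := by
  classical
  rw [h.sub_sum]
  set t := S y \ s
  have ht : (t.card : ℝ) ≤ 2 := by
    exact_mod_cast (Finset.card_le_card Finset.sdiff_subset).trans (h.card_le y)
  have h1 : |∑ i ∈ t, D i f y| ^ r ≤ 2 ^ (r - 1) * ∑ i ∈ t, |D i f y| ^ r :=
    (Real.rpow_le_rpow (abs_nonneg _) (Finset.abs_sum_le_sum_abs _ _) (by linarith)).trans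
      ((Real.rpow_sum_le_const_mul_sum_rpow t _ hr).trans (mul_le_mul_of_nonneg_right
        (Real.rpow_le_rpow (Nat.cast_nonneg _) ht (by linarith))
        (Finset.sum_nonneg fun i _ ↦ by positivity)))
  refine (ENNReal.ofReal_le_ofReal h1).trans ?_
  rw [ENNReal.ofReal_mul (by positivity), ENNReal.ofReal_sum_of_nonneg fun i _ ↦ by positivity]
  exact mul_le_mul_right (ENNReal.sum_le_tsum t) _

/-! ### Norm bounds and convergence in L^p. -/

section Lp

variable {p : ℝ≥0∞} [Fact (1 ≤ p)] {P : ι → Lp ℝ p ν →L[ℝ] Lp ℝ p ν}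

lemma _root_.Latitudinal.norm_rpow_Lp (hp : p ≠ ⊤) (f : Lp ℝ p ν) :
    ENNReal.ofReal (‖f‖ ^ p.toReal) = ∫⁻ x, ENNReal.ofReal (|f x| ^ p.toReal) ∂ν := by
  rw [← norm_rpow_eq_lintegral hp (Lp.memLp f), Lp.toLp_coeFn]

lemma norm_rpow_apply (hP : ∀ i, InducesLp (D i) (P i)) (hp : p ≠ ⊤) (f : Lp ℝ p ν) (i : ι) :
    ENNReal.ofReal (‖P i f‖ ^ p.toReal) = ∫⁻ x, ENNReal.ofReal (|D i f x| ^ p.toReal) ∂ν := by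
  rw [norm_rpow_Lp hp]
  refine lintegral_congr_ae ?_
  filter_upwards [(hP i).coeFn f] with x hx
  rw [hx]

lemma aemeasurable_apply (hP : ∀ i, InducesLp (D i) (P i)) (f : Lp ℝ p ν) (i : ι) :
    AEMeasurable (fun x ↦ ENNReal.ofReal (|D i f x| ^ p.toReal)) ν :=
  ((continuous_abs.measurable.comp_aemeasurable
    ((hP i).memLp (Lp.memLp f)).1.aemeasurable).pow_const _).ennreal_ofReal

/-- The operator sees only the restriction of f to `U i`. Restricting f before using the norm bound
lets the sum over i be controlled by the overlap of the bands. -/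
lemma norm_rpow_apply_le (h : IsPartition ν p.toReal⁻¹ D U S) (hP : ∀ i, InducesLp (D i) (P i))
    (hp : p ≠ ⊤) (f : Lp ℝ p ν) (i : ι) : ENNReal.ofReal (‖P i f‖ ^ p.toReal) ≤
      ENNReal.ofReal (awwConst p ^ p.toReal) *
        ∫⁻ x, (U i).indicator (fun x ↦ ENNReal.ofReal (|f x| ^ p.toReal)) x ∂ν := by
  have hr := one_le_toReal (p := p) hp
  rw [norm_rpow_apply hP hp, ← h.apply_indicator i f]
  obtain ⟨a, b, w, R, hF, hD, -⟩ := h.exists_folding i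
  rw [hD]
  refine (hF.lintegral_fold_le hp ((Lp.aestronglyMeasurable f).indicator
    (h.measurableSet i))).trans_eq ?_
  congr 1
  refine lintegral_congr fun x ↦ ?_
  by_cases hx : x ∈ U i
  · rw [indicator_of_mem hx, indicator_of_mem hx]
  · rw [indicator_of_notMem hx, indicator_of_notMem hx, abs_zero, Real.zero_rpow (by linarith),
      ENNReal.ofReal_zero]

lemma tsum_indicator_le (h : IsPartition ν q D U S) (g : X → ℝ≥0∞) (y : X) :
    ∑' i, (U i).indicator g y ≤ 2 * g y := by
  classical
  have h0 : ∀ i ∉ S y, (U i).indicator g y = 0 := fun i hi ↦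
    indicator_of_notMem (fun hy ↦ hi (h.mem i y hy)) _
  rw [tsum_eq_sum h0]
  refine (Finset.sum_le_sum fun i _ ↦ indicator_le_self (U i) g y).trans ?_
  rw [Finset.sum_const, nsmul_eq_mul]
  exact mul_le_mul_left (by exact_mod_cast h.card_le y) _

lemma tsum_norm_rpow_le [Countable ι] (h : IsPartition ν p.toReal⁻¹ D U S)
    (hP : ∀ i, InducesLp (D i) (P i)) (hp : p ≠ ⊤) (f : Lp ℝ p ν) :
    ∑' i, ENNReal.ofReal (‖P i f‖ ^ p.toReal) ≤
      ENNReal.ofReal (2 * awwConst p ^ p.toReal * ‖f‖ ^ p.toReal) := by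
  have hm : AEMeasurable (fun x ↦ ENNReal.ofReal (|f x| ^ p.toReal)) ν :=
    ((continuous_abs.measurable.comp_aemeasurable
      (Lp.aestronglyMeasurable f).aemeasurable).pow_const _).ennreal_ofReal
  have hB : 0 ≤ awwConst p ^ p.toReal := Real.rpow_nonneg awwConst_nonneg _
  refine (ENNReal.tsum_le_tsum fun i ↦ h.norm_rpow_apply_le hP hp f i).trans ?_
  rw [ENNReal.tsum_mul_left, ← lintegral_tsum fun i ↦ hm.indicator (h.measurableSet i)]
  refine (mul_le_mul_right (lintegral_mono fun y ↦ h.tsum_indicator_le _ y) _).trans_eq ?_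
  rw [lintegral_const_mul' _ _ (by norm_num), ← norm_rpow_Lp hp, ENNReal.ofReal_mul (by positivity),
    ENNReal.ofReal_mul (by norm_num), ENNReal.ofReal_ofNat]
  ring

lemma summable_norm_rpow [Countable ι] (h : IsPartition ν p.toReal⁻¹ D U S)
    (hP : ∀ i, InducesLp (D i) (P i)) (hp : p ≠ ⊤) (f : Lp ℝ p ν) :
    Summable fun i ↦ ‖P i f‖ ^ p.toReal := by
  have h1 := ENNReal.summable_toReal
    ((h.tsum_norm_rpow_le hP hp f).trans_lt ENNReal.ofReal_lt_top).ne
  refine h1.congr fun i ↦ ?_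
  rw [ENNReal.toReal_ofReal (by positivity)]

lemma ofReal_tsum_norm_rpow [Countable ι] (h : IsPartition ν p.toReal⁻¹ D U S)
    (hP : ∀ i, InducesLp (D i) (P i)) (hp : p ≠ ⊤) (f : Lp ℝ p ν) :
    ENNReal.ofReal (∑' i, ‖P i f‖ ^ p.toReal) = ∑' i, ENNReal.ofReal (‖P i f‖ ^ p.toReal) :=
  ENNReal.ofReal_tsum_of_nonneg (fun i ↦ by positivity) (h.summable_norm_rpow hP hp f)

lemma lintegral_tsum_eq [Countable ι] (h : IsPartition ν p.toReal⁻¹ D U S)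
    (hP : ∀ i, InducesLp (D i) (P i)) (hp : p ≠ ⊤) (f : Lp ℝ p ν) :
    ∫⁻ y, ENNReal.ofReal (2 ^ (p.toReal - 1)) * ∑' i, ENNReal.ofReal (|D i f y| ^ p.toReal) ∂ν =
      ENNReal.ofReal (2 ^ (p.toReal - 1) * ∑' i, ‖P i f‖ ^ p.toReal) := by
  rw [lintegral_const_mul' _ _ ENNReal.ofReal_ne_top, lintegral_tsum (aemeasurable_apply hP f),
    ENNReal.ofReal_mul (by positivity), h.ofReal_tsum_norm_rpow hP hp]
  simp only [norm_rpow_apply hP hp]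

/-- Lower bound from the pointwise convexity estimate for the empty partial sum, upper bound from
the double overlap; then p-th roots are taken. -/
theorem boundsLp [Countable ι] (h : IsPartition ν p.toReal⁻¹ D U S)
    (hP : ∀ i, InducesLp (D i) (P i)) (hp : p ≠ ⊤) :
    BoundsLp P (2 ^ (p.toReal⁻¹ - 1)) (2 ^ p.toReal⁻¹ * awwConst p) := by
  have hr := one_le_toReal (p := p) hp
  have hr0 : p.toReal ≠ 0 := by linarith
  have hB := awwConst_nonneg (p := p)
  intro f
  have hs := h.summable_norm_rpow hP hp f
  have hs0 : 0 ≤ ∑' i, ‖P i f‖ ^ p.toReal := tsum_nonneg fun i ↦ by positivity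
  refine ⟨hs, ?_, ?_⟩
  · have h1 : ‖f‖ ^ p.toReal ≤ 2 ^ (p.toReal - 1) * ∑' i, ‖P i f‖ ^ p.toReal := by
      rw [← ENNReal.ofReal_le_ofReal_iff (by positivity), ← h.lintegral_tsum_eq hP hp,
        norm_rpow_Lp hp]
      refine lintegral_mono fun y ↦ ?_
      simpa using h.rpow_sub_sum_le hr ∅ f y
    have h2 := Real.rpow_le_rpow (by positivity) h1 (inv_nonneg.2 (zero_le_one.trans hr))
    rw [Real.rpow_rpow_inv (norm_nonneg _) hr0, Real.mul_rpow (by positivity) hs0,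
      ← Real.rpow_mul (by norm_num), sub_mul, mul_inv_cancel₀ hr0, one_mul] at h2
    calc (2 : ℝ) ^ (p.toReal⁻¹ - 1) * ‖f‖
        ≤ 2 ^ (p.toReal⁻¹ - 1) *
          (2 ^ (1 - p.toReal⁻¹) * (∑' i, ‖P i f‖ ^ p.toReal) ^ p.toReal⁻¹) :=
          mul_le_mul_of_nonneg_left h2 (by positivity)
      _ = _ := by
          rw [← mul_assoc, ← Real.rpow_add (by norm_num), sub_add_sub_cancel, sub_self,
            Real.rpow_zero, one_mul]
  · have h1 : ∑' i, ‖P i f‖ ^ p.toReal ≤ 2 * awwConst p ^ p.toReal * ‖f‖ ^ p.toReal := by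
      rw [← ENNReal.ofReal_le_ofReal_iff (by positivity), h.ofReal_tsum_norm_rpow hP hp]
      exact h.tsum_norm_rpow_le hP hp f
    have h2 := Real.rpow_le_rpow hs0 h1 (inv_nonneg.2 (zero_le_one.trans hr))
    rwa [Real.mul_rpow (by positivity) (by positivity), Real.mul_rpow (by norm_num) (by positivity),
      Real.rpow_rpow_inv hB hr0, Real.rpow_rpow_inv (norm_nonneg _) hr0] at h2

/-- Dominated convergence along the finite subsets of ι, a countably generated filter as ι is
countable. At each y the remainder vanishes as soon as the subset contains `S y`. -/
theorem hasSum [Countable ι] (h : IsPartition ν p.toReal⁻¹ D U S)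
    (hP : ∀ i, InducesLp (D i) (P i)) (hp : p ≠ ⊤) (f : Lp ℝ p ν) :
    HasSum (fun i ↦ P i f) f := by
  have hr := one_le_toReal (p := p) hp
  have hr0 : p.toReal ≠ 0 := by linarith
  have hcoe : ∀ s : Finset ι, ⇑(f - ∑ i ∈ s, P i f) =ᵐ[ν] fun y ↦ f y - ∑ i ∈ s, D i f y := by
    intro s
    have h1 : ∀ᵐ y ∂ν, ∀ i, P i f y = D i f y := ae_all_iff.2 fun i ↦ (hP i).coeFn f
    filter_upwards [Lp.coeFn_sub f (∑ i ∈ s, P i f), Lp.coeFn_finsetSum s fun i ↦ P i f, h1]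
      with y k1 k2 k3
    rw [k1, Pi.sub_apply, k2, Finset.sum_apply]
    simp only [k3]
  have hnorm : ∀ s : Finset ι, ENNReal.ofReal (‖f - ∑ i ∈ s, P i f‖ ^ p.toReal) =
      ∫⁻ y, ENNReal.ofReal (|f y - ∑ i ∈ s, D i f y| ^ p.toReal) ∂ν := by
    intro s
    rw [norm_rpow_Lp hp]
    refine lintegral_congr_ae ?_
    filter_upwards [hcoe s] with y hy
    rw [hy]
  have hlim : Tendsto (fun s : Finset ι ↦
      ∫⁻ y, ENNReal.ofReal (|f y - ∑ i ∈ s, D i f y| ^ p.toReal) ∂ν) atTop (𝓝 (∫⁻ _, 0 ∂ν)) := by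
    refine tendsto_lintegral_filter_of_dominated_convergence' _
      (Eventually.of_forall fun s ↦ ?_)
      (Eventually.of_forall fun s ↦ Eventually.of_forall fun y ↦ h.rpow_sub_sum_le hr s f y) ?_
      (Eventually.of_forall fun y ↦ ?_)
    · have h1 : AEMeasurable (fun y ↦ f y - ∑ i ∈ s, D i f y) ν :=
        (Lp.aestronglyMeasurable (f - ∑ i ∈ s, P i f)).aemeasurable.congr (hcoe s)
      exact ((continuous_abs.measurable.comp_aemeasurable h1).pow_const _).ennreal_ofReal
    · rw [h.lintegral_tsum_eq hP hp]
      exact ENNReal.ofReal_ne_top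
    · refine tendsto_const_nhds.congr' ?_
      filter_upwards [eventually_ge_atTop (S y)] with s hs
      rw [h.sub_sum_eq_zero f hs, abs_zero, Real.zero_rpow hr0, ENNReal.ofReal_zero]
  rw [lintegral_zero] at hlim
  have h1 : Tendsto (fun s : Finset ι ↦ ‖f - ∑ i ∈ s, P i f‖ ^ p.toReal) atTop (𝓝 0) := by
    have := (ENNReal.tendsto_toReal ENNReal.zero_ne_top).comp hlim
    refine this.congr fun s ↦ ?_
    rw [Function.comp_apply, ← hnorm, ENNReal.toReal_ofReal (by positivity)]
  have h2 := h1.rpow_const (p := p.toReal⁻¹) (Or.inr (by positivity))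
  rw [Real.zero_rpow (inv_ne_zero hr0)] at h2
  rw [HasSum, tendsto_iff_norm_sub_tendsto_zero]
  refine h2.congr fun s ↦ ?_
  rw [Real.rpow_rpow_inv (norm_nonneg _) hr0, norm_sub_rev]

theorem isIdempotentElem (h : IsPartition ν q D U S)
    (hP : ∀ i, InducesLp (D i) (P i)) (i : ι) : IsIdempotentElem (P i) :=
  (hP i).comp_eq (hP i) (hP i) (h.comp_self i)

theorem comp_eq_zero_Lp (h : IsPartition ν q D U S)
    (hP : ∀ i, InducesLp (D i) (P i)) {i j : ι} (hij : i ≠ j) : (P i).comp (P j) = 0 :=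
  (hP i).comp_eq (hP j) (D := 0) (fun _ _ ↦ Lp.coeFn_zero ℝ p ν) fun f ↦ h.comp_eq_zero i j hij f

theorem isSymmetricL2 (h : IsPartition ν p.toReal⁻¹ D U S)
    (hP : ∀ i, InducesLp (D i) (P i)) (hp : p = 2) (i : ι) : IsSymmetricL2 (P i) := by
  obtain ⟨a, b, w, R, hF, hD, -⟩ := h.exists_folding i
  have := hP i
  rw [hD] at this
  exact hF.isSymmetricL2 hp this

/-- For symmetric idempotents ‖P_i f‖² = ⟨P_i f, f⟩. Pairing f with the convergent sum gives
Parseval's identity. -/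
theorem boundsLp_one [Countable ι] (h : IsPartition ν p.toReal⁻¹ D U S)
    (hP : ∀ i, InducesLp (D i) (P i)) (hp : p = 2) : BoundsLp P 1⁻¹ 1 := by
  have hsym := h.isSymmetricL2 hP hp
  subst hp
  intro f
  have hs := h.summable_norm_rpow hP (by norm_num) f
  have hinner : ∀ i, inner ℝ (P i f) f = ‖P i f‖ ^ (2 : ℝ≥0∞).toReal := fun i ↦ by
    have h1 : ∀ u v : Lp ℝ 2 ν, inner ℝ (P i u) v = inner ℝ u (P i v) := fun u v ↦ by
      have h2 := hsym i v u
      rw [L2.inner_def, L2.inner_def]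
      simpa using h2.symm
    have h3 : P i (P i f) = P i f := congrArg (fun L ↦ L f) (h.isIdempotentElem hP i)
    rw [← h3, h1, h3, real_inner_self_eq_norm_sq]
    simp
  have hsum : ∑' i, ‖P i f‖ ^ (2 : ℝ≥0∞).toReal = ‖f‖ ^ (2 : ℝ≥0∞).toReal := by
    have h1 := (h.hasSum hP (by norm_num) f).mapL (innerSL ℝ f)
    simp only [innerSL_apply_apply] at h1
    have h2 : HasSum (fun i ↦ ‖P i f‖ ^ (2 : ℝ≥0∞).toReal) (inner ℝ f f) := by
      refine h1.congr_fun fun i ↦ ?_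
      rw [← hinner, real_inner_comm]
    rw [h2.tsum_eq, real_inner_self_eq_norm_sq]
    simp
  refine ⟨hs, ?_⟩
  rw [hsum, Real.rpow_rpow_inv (norm_nonneg _) (by norm_num), inv_one, one_mul]
  exact ⟨le_rfl, le_rfl⟩

end Lp

end IsPartition

lemma BoundsLp.mono {ι X : Type*} [MeasurableSpace X] {ν : Measure X} {p : ℝ≥0∞} [Fact (1 ≤ p)]
    {P : ι → Lp ℝ p ν →L[ℝ] Lp ℝ p ν} {c C c' C' : ℝ} (h : BoundsLp P c C) (hc : c' ≤ c)
    (hC : C ≤ C') : BoundsLp P c' C' := fun f ↦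
  ⟨(h f).1, (mul_le_mul_of_nonneg_right hc (norm_nonneg _)).trans (h f).2.1,
    (h f).2.2.trans (mul_le_mul_of_nonneg_right hC (norm_nonneg _))⟩

lemma sum_apply_C0 {ι X : Type*} [TopologicalSpace X] (s : Finset ι) (F : ι → C₀(X, ℝ)) (y : X) :
    (∑ i ∈ s, F i) y = ∑ i ∈ s, F i y := by
  classical
  induction s using Finset.induction_on with
  | empty => rfl
  | insert i s hi ih =>
    rw [Finset.sum_insert hi, Finset.sum_insert hi, ZeroAtInftyContinuousMap.add_apply, ih]

/-! ### Norm bounds and convergence in C₀. -/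

namespace IsPartition

section C0

variable {X ι : Type*} [TopologicalSpace X] [MeasurableSpace X] {ν : Measure X}
  {D : ι → (X → ℝ) → X → ℝ} {U : ι → Set X} {S : X → Finset ι} {T : ι → C₀(X, ℝ) →L[ℝ] C₀(X, ℝ)}

lemma abs_apply_le (h : IsPartition ν 0 D U S) {i : ι} {f : X → ℝ} {c : ℝ} (hc : 0 ≤ c)
    (hf : ∀ y ∈ U i, |f y| ≤ c) (y : X) : |D i f y| ≤ awwConst ⊤ * c := by
  by_cases hy : y ∈ U i
  · obtain ⟨a, b, w, R, hF, hD, hR, -⟩ := h.exists_folding i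
    rw [hD]
    exact (hF.abs_fold_le_top f y).trans
      (mul_le_mul_of_nonneg_left (max_le (hf y hy) (hf _ (hR y hy))) awwConst_nonneg)
  · rw [h.apply_eq_zero f hy, abs_zero]
    exact mul_nonneg awwConst_nonneg hc

lemma norm_C0_apply_le (h : IsPartition ν 0 D U S) (hT : ∀ i, InducesC0 (D i) (T i))
    {i : ι} {f : C₀(X, ℝ)} {c : ℝ} (hc : 0 ≤ c) (hf : ∀ y ∈ U i, |f y| ≤ c) :
    ‖T i f‖ ≤ awwConst ⊤ * c :=
  (norm_C0_le (mul_nonneg awwConst_nonneg hc)).2 fun y ↦ by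
    rw [hT i f]
    exact h.abs_apply_le hc hf y

/-- The factor is the number of terms at a point, whatever the size of the index set. The empty set
gives the lower bound, large finite sets give convergence. -/
lemma norm_C0_sub_sum_le (h : IsPartition ν 0 D U S) (hT : ∀ i, InducesC0 (D i) (T i))
    (s : Finset ι) (f : C₀(X, ℝ)) {c : ℝ} (hc : 0 ≤ c) (hs : ∀ i ∉ s, ‖T i f‖ ≤ c) :
    ‖f - ∑ i ∈ s, T i f‖ ≤ 2 * c := by
  classical
  refine (norm_C0_le (by positivity)).2 fun y ↦ ?_
  have h1 : (f - ∑ i ∈ s, T i f) y = f y - ∑ i ∈ s, D i f y := by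
    rw [ZeroAtInftyContinuousMap.sub_apply, sum_apply_C0]
    simp only [hT _ f]
  rw [h1, h.sub_sum]
  refine (Finset.abs_sum_le_sum_abs _ _).trans ((Finset.sum_le_card_nsmul _ _ c fun i hi ↦ ?_).trans
    ?_)
  · rw [← hT i f]
    exact (abs_le_norm_C0 _ y).trans (hs i (Finset.mem_sdiff.1 hi).2)
  · rw [nsmul_eq_mul]
    exact mul_le_mul_of_nonneg_right
      (by exact_mod_cast (Finset.card_le_card Finset.sdiff_subset).trans (h.card_le y)) hc

/-- f is small off a compact set, which all but finitely many bands miss. -/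
theorem tendsto_norm_C0 (h : IsPartition ν 0 D U S) (hT : ∀ i, InducesC0 (D i) (T i))
    (hU : ∀ K : Set X, IsCompact K → {i | (U i ∩ K).Nonempty}.Finite) (f : C₀(X, ℝ)) :
    Tendsto (fun i ↦ ‖T i f‖) cofinite (𝓝 0) := by
  have hB := awwConst_nonneg (p := ⊤)
  rw [Metric.tendsto_nhds]
  intro ε hε
  have hε' : 0 < ε / (awwConst ⊤ + 1) := by positivity
  obtain ⟨K, hK, hKf⟩ := mem_cocompact.1 ((zero_at_infty f) (Metric.ball_mem_nhds 0 hε'))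
  filter_upwards [(hU K hK).compl_mem_cofinite] with i hi
  rw [Real.dist_0_eq_abs, abs_norm]
  refine (h.norm_C0_apply_le hT hε'.le fun y hy ↦ ?_).trans_lt ?_
  · have h1 : y ∈ f ⁻¹' Metric.ball 0 (ε / (awwConst ⊤ + 1)) := hKf fun hy' ↦ hi ⟨y, hy, hy'⟩
    rw [mem_preimage, Metric.mem_ball, Real.dist_0_eq_abs] at h1
    exact h1.le
  · rw [mul_div_assoc', div_lt_iff₀ (by positivity)]
    nlinarith

theorem hasSum_C0 (h : IsPartition ν 0 D U S) (hT : ∀ i, InducesC0 (D i) (T i))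
    (hU : ∀ K : Set X, IsCompact K → {i | (U i ∩ K).Nonempty}.Finite) (f : C₀(X, ℝ)) :
    HasSum (fun i ↦ T i f) f := by
  rw [HasSum, SummationFilter.unconditional_filter, Metric.tendsto_nhds]
  intro ε hε
  have h1 : {i | ¬ ‖T i f‖ < ε / 3}.Finite :=
    (h.tendsto_norm_C0 hT hU f).eventually (gt_mem_nhds (by positivity))
  filter_upwards [eventually_ge_atTop h1.toFinset] with s hs
  rw [dist_comm, dist_eq_norm]
  refine (h.norm_C0_sub_sum_le hT s f (c := ε / 3) (by positivity) fun i hi ↦ ?_).trans_lt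
    (by linarith)
  by_contra h2
  exact hi (hs (h1.mem_toFinset.2 fun h3 ↦ h2 h3.le))

theorem boundsC0 (h : IsPartition ν 0 D U S) (hT : ∀ i, InducesC0 (D i) (T i))
    (hU : ∀ K : Set X, IsCompact K → {i | (U i ∩ K).Nonempty}.Finite) :
    BoundsC0 T 2⁻¹ (awwConst ⊤) := by
  intro f
  have hle : ∀ i, ‖T i f‖ ≤ awwConst ⊤ * ‖f‖ := fun i ↦
    h.norm_C0_apply_le hT (norm_nonneg f) fun y _ ↦ abs_le_norm_C0 f y
  have hb : BddAbove (range fun i ↦ ‖T i f‖) := ⟨_, forall_mem_range.2 hle⟩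
  refine ⟨h.tendsto_norm_C0 hT hU f, hb, ?_, Real.iSup_le hle
    (mul_nonneg awwConst_nonneg (norm_nonneg f))⟩
  have h1 := h.norm_C0_sub_sum_le hT ∅ f (c := ⨆ i, ‖T i f‖)
    (Real.iSup_nonneg fun i ↦ norm_nonneg _) fun i _ ↦ le_ciSup hb i
  rw [Finset.sum_empty, sub_zero] at h1
  linarith

end C0

end IsPartition

lemma BoundsC0.mono {ι X : Type*} [TopologicalSpace X]
    {T : ι → C₀(X, ℝ) →L[ℝ] C₀(X, ℝ)} {c C c' C' : ℝ} (h : BoundsC0 T c C) (hc : c' ≤ c)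
    (hC : C ≤ C') : BoundsC0 T c' C' := fun f ↦
  ⟨(h f).1, (h f).2.1, (mul_le_mul_of_nonneg_right hc (norm_nonneg _)).trans (h f).2.2.1,
    (h f).2.2.2.trans (mul_le_mul_of_nonneg_right hC (norm_nonneg _))⟩

/-! ### Chains of cuts -/

section Chain

variable {d : ℕ} {M : Type*} [TopologicalSpace M] [ChartedSpace (EuclideanSpace ℝ (Fin d)) M]
  [MeasurableSpace M] {ν : Measure M} {m : M → ℝ} {δ q : ℝ} {κ ι : Type*} [LinearOrder κ]
  [LinearOrder ι] {ϑ : κ → ℝ}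

lemma Cut.op_op_of_le (hϑ : ∀ k l, k < l → ϑ k + δ < ϑ l - δ)
    (E : ∀ k, Cut d ν m δ q (ϑ k)) {k l : κ} (hkl : k ≤ l) (f : M → ℝ) :
    (E k).op ((E l).op f) = (E l).op f ∧ (E l).op ((E k).op f) = (E l).op f := by
  rcases hkl.eq_or_lt with rfl | h
  · exact ⟨(E k).op_op f, (E k).op_op f⟩
  · exact ⟨(E k).op_comp_of_gt (E l) (hϑ k l h) f, (E k).op_comp_of_lt (E l) (hϑ k l h) f⟩

/-- The differences of consecutive cuts form a decomposition of the identity. -/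
theorem Cut.exists_isPartition [OpensMeasurableSpace M] (hm : Continuous m) (hδ : 0 < δ)
    (hϑ : ∀ k l, k < l → ϑ k + δ < ϑ l - δ)
    (E : ∀ k, Cut d ν m δ q (ϑ k)) {lo hi : ι → κ} (hlt : ∀ i, lo i < hi i)
    (hle : ∀ i j, i < j → hi i ≤ lo j)
    (hsum : ∀ y, ∃ s : Finset ι,
      (∀ i, m y ∈ Ioo (ϑ (lo i) - δ) (ϑ (hi i) + δ) → i ∈ s) ∧
      ∀ f : M → ℝ, ∑ i ∈ s, diff (E (lo i)) (E (hi i)) f y = f y) :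
    ∃ S, IsPartition ν q (fun i ↦ diff (E (lo i)) (E (hi i)))
      (fun i ↦ m ⁻¹' Ioo (ϑ (lo i) - δ) (ϑ (hi i) + δ)) S := by
  classical
  have hzero : ∀ i f y, m y ∉ Ioo (ϑ (lo i) - δ) (ϑ (hi i) + δ) →
      diff (E (lo i)) (E (hi i)) f y = 0 := fun i f y hy ↦ by
    refine diff_eq_zero (hϑ _ _ (hlt i)) f ?_ hδ
    by_contra! h'
    exact hy h'
  choose s hs hsum using hsum
  -- The set from `hsum` may be large; the filter keeps only the bands that contain y, and the
  -- discarded terms vanish.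
  refine ⟨fun y ↦ (s y).filter fun i ↦ m y ∈ Ioo (ϑ (lo i) - δ) (ϑ (hi i) + δ), ⟨fun i ↦ ?_,
    fun i ↦ (isOpen_Ioo.preimage hm).measurableSet,
    fun i y hy ↦ Finset.mem_filter.2 ⟨hs y i hy, hy⟩, fun y ↦ ?_, fun f y ↦ ?_, fun i j hij f ↦ ?_⟩⟩
  · have h := hϑ _ _ (hlt i)
    refine ⟨_, _, _, _, isFolding_diff h, diff_eq_fold h, fun y hy ↦ ?_, fun y hy ↦ ?_⟩
    · by_cases h2 : m y ∈ Ioo (ϑ (hi i) - δ) (ϑ (hi i) + δ)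
      · have := (E (hi i)).R_mem h2
        rw [mem_preimage, diffR_of_mem h h2]
        exact ⟨by linarith [this.1], this.2⟩
      · rw [mem_preimage, diffR, ((E (hi i)).off y h2).2.1]
        by_cases h1 : m y ∈ Ioo (ϑ (lo i) - δ) (ϑ (lo i) + δ)
        · have := (E (lo i)).R_mem h1
          exact ⟨this.1, by linarith [this.2]⟩
        · rw [((E (lo i)).off y h1).2.1]
          exact hy
    · have hy' : m y ≤ ϑ (lo i) - δ ∨ ϑ (hi i) + δ ≤ m y := by
        by_contra! h'
        exact hy h'
      have h1 := (E (lo i)).off y fun h' ↦ by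
        rcases hy' with hy' | hy' <;> linarith [h'.1, h'.2]
      have h2 := (E (hi i)).off y fun h' ↦ by
        rcases hy' with hy' | hy' <;> linarith [h'.1, h'.2]
      rw [diffA, diffB, h1.1, h2.1]
      rcases hy' with hy' | hy'
      · rw [(E (lo i)).a_bot hy', (E (hi i)).a_bot (by linarith)]
        simp
      · rw [(E (hi i)).a_top hy', (E (lo i)).a_top (by linarith)]
        simp
  · by_contra! hc
    obtain ⟨i, hi', j, hj', k, hk', hij, hik, hjk⟩ := Finset.two_lt_card.1 hc
    -- If a third band lies between two others, the top of the lower one and the bottom of the upper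
    -- one belong to different, hence separated, windows.
    have hno : ∀ a b c : ι, a < b → b < c → m y ∈ Ioo (ϑ (lo a) - δ) (ϑ (hi a) + δ) →
        m y ∈ Ioo (ϑ (lo c) - δ) (ϑ (hi c) + δ) → False := fun a b c hab hbc ha hc ↦ by
      have h1 := hϑ _ _ (((hle a b hab).trans_lt (hlt b)).trans_le (hle b c hbc))
      linarith [ha.2, hc.1]
    have h1 := (Finset.mem_filter.1 hi').2
    have h2 := (Finset.mem_filter.1 hj').2
    have h3 := (Finset.mem_filter.1 hk').2
    rcases lt_or_gt_of_ne hij with a | a <;> rcases lt_or_gt_of_ne hik with b | b <;>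
      rcases lt_or_gt_of_ne hjk with c | c
    · exact hno _ _ _ a c h1 h3
    · exact hno _ _ _ b c h1 h2
    · exact absurd (a.trans c) (not_lt.2 b.le)
    · exact hno _ _ _ b a h3 h2
    · exact hno _ _ _ a b h2 h3
    · exact absurd (b.trans c) (not_lt.2 a.le)
    · exact hno _ _ _ c b h2 h1
    · exact hno _ _ _ c a h3 h1
  · rw [← hsum y f]
    exact Finset.sum_filter_of_ne fun i _ h0 ↦ by
      by_contra hy
      exact h0 (hzero i f y hy)
  · funext y
    have key : ∀ {k l : κ}, k ≤ l → (E k).op ((E l).op f) = (E l).op f ∧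
      (E l).op ((E k).op f) = (E l).op f := fun hkl ↦ op_op_of_le hϑ E hkl f
    -- Each of the four products equals the cut with the higher level. For i ≠ j both levels of one
    -- difference dominate those of the other, so the products cancel in pairs.
    have e : ∀ k l, diff (E k) (E l) = fun f y ↦ (E k).op f y - (E l).op f y := fun k l ↦ rfl
    simp only [e, op_sub]
    rcases lt_or_gt_of_ne hij with h | h
    · have h1 := hle i j h
      have h2 := (hlt j).le
      have h3 := (hlt i).le
      rw [(key (h3.trans h1)).1, (key h1).1, (key (h1.trans h2)).1, (key (h3.trans (h1.trans h2))).1]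
      simp
    · have h1 := hle j i h
      have h2 := (hlt j).le
      have h3 := (hlt i).le
      rw [(key h1).2, (key (h1.trans h3)).2, (key (h2.trans h1)).2, (key (h2.trans (h1.trans h3))).2]
      simp

end Chain

/-! ### Constant cuts, and smooth decompositions from chains of cuts. -/

namespace Cut

variable {d : ℕ} {M : Type*} [TopologicalSpace M] [ChartedSpace (EuclideanSpace ℝ (Fin d)) M]
  [MeasurableSpace M] {ν : Measure M} {m : M → ℝ} {δ q : ℝ}

/-- The cut whose operator is the multiplication by a constant `c ∈ {0, 1}`. -/
def const (c : ℝ) (hc : c = 0 ∨ c = 1) {ϑ : ℝ} (h0 : c ≠ 0 → ∀ y, ϑ - δ < m y)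
    (h1 : c ≠ 1 → ∀ y, m y < ϑ + δ) : Cut d ν m δ q ϑ where
  a := fun _ ↦ c
  b := 0
  w := 1
  R := id
  H := SimpleH.ofFunction (φ := 0) contMDiff_const HasCompactSupport.zero isOpen_empty (by simp)
  isFolding := by
    refine ⟨measurable_const, measurable_zero, measurable_one, ?_, fun y ↦ rfl, fun _ ↦ one_pos,
      fun _ ↦ one_mul 1, fun y ↦ Or.inl ⟨rfl, rfl, hc⟩⟩
    exact IsFolding.measurePreserving_of_lintegral measurable_id fun g _ ↦ by simp
  off := fun y _ ↦ ⟨rfl, rfl, rfl⟩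
  smooth_a := contMDiff_const
  tsupport_a := by
    rcases eq_or_ne c 0 with h | h
    · have : (fun _ : M ↦ c) = 0 := by rw [h]; rfl
      rw [this, tsupport_zero]
      exact empty_subset _
    · exact fun y _ ↦ h0 h y
  tsupport_sub := by
    rcases eq_or_ne c 1 with h | h
    · have : (fun _ : M ↦ 1 - c) = 0 := by rw [h, sub_self]; rfl
      rw [this, tsupport_zero]
      exact empty_subset _
    · exact fun y _ ↦ h1 h y
  source_subset := empty_subset _
  target_subset := empty_subset _
  act_eq := fun f y ↦ by rw [SimpleH.ofFunction_act]; simp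

lemma op_const {c : ℝ} {hc : c = 0 ∨ c = 1} {ϑ : ℝ} {h0 : c ≠ 0 → ∀ y, ϑ - δ < m y}
    {h1 : c ≠ 1 → ∀ y, m y < ϑ + δ} (f : M → ℝ) (y : M) :
    (const c hc h0 h1 : Cut d ν m δ q ϑ).op f y = c * f y := by
  simp [op, fold, const]

section Decomposition

variable {p : ℝ≥0∞} [Fact (1 ≤ p)] {κ ι : Type*} [LinearOrder κ] [LinearOrder ι] [Countable ι]
  {ϑ : κ → ℝ}

/-- Here 2^{1/p} ≤ 2 and B_p ≤ (1 + √2)/2 ≤ 3/2. -/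
lemma two_rpow_mul_awwConst_le (hp : p ≠ ⊤) : 2 ^ p.toReal⁻¹ * awwConst p ≤ 3 := by
  have hr := one_le_toReal (p := p) hp
  have h1 : (2 : ℝ) ^ p.toReal⁻¹ ≤ 2 := by
    simpa using Real.rpow_le_rpow_of_exponent_le (x := 2) (by norm_num) (inv_le_one_of_one_le₀ hr)
  have h2 := awwConst_le_schur (p := p)
  have h3 : √2 ≤ 2 := by rw [Real.sqrt_le_left (by norm_num)]; norm_num
  have h4 := awwConst_nonneg (p := p)
  nlinarith

lemma inv_three_le_two_rpow (hp : p ≠ ⊤) : (3 : ℝ)⁻¹ ≤ 2 ^ (p.toReal⁻¹ - 1) := by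
  have hr := one_le_toReal (p := p) hp
  have h1 : (2 : ℝ) ^ (-1 : ℝ) ≤ 2 ^ (p.toReal⁻¹ - 1) :=
    Real.rpow_le_rpow_of_exponent_le (by norm_num) (by
      have : 0 ≤ p.toReal⁻¹ := by positivity
      linarith)
  rw [Real.rpow_neg_one] at h1
  exact (by norm_num : (3 : ℝ)⁻¹ ≤ 2⁻¹).trans h1

/-- The telescoping is isolated in `hsum`, and levels and bands have separate index types, so that
infinite and finite chains are treated together. -/
theorem exists_decomposition [OpensMeasurableSpace M] (hm : Continuous m) (hδ : 0 < δ)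
    (hc : ∀ b, IsCompact (m ⁻¹' Iic b)) (hϑ : ∀ k l, k < l → ϑ k + δ < ϑ l - δ)
    (E : ∀ k, Cut d ν m δ p.toReal⁻¹ (ϑ k)) {lo hi : ι → κ} (hlt : ∀ i, lo i < hi i)
    (hle : ∀ i j, i < j → hi i ≤ lo j)
    (hsum : ∀ y, ∃ s : Finset ι,
      (∀ i, m y ∈ Ioo (ϑ (lo i) - δ) (ϑ (hi i) + δ) → i ∈ s) ∧
      ∀ f : M → ℝ, ∑ i ∈ s, diff (E (lo i)) (E (hi i)) f y = f y)
    {Q : ι → (M → ℝ) → M → ℝ} {U : ι → Set M} (hQ : ∀ i, Q i = diff (E (lo i)) (E (hi i)))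
    (hU : ∀ i, U i = m ⁻¹' Ioo (ϑ (lo i) - δ) (ϑ (hi i) + δ))
    (hlf : ∀ K : Set M, IsCompact K → {i | (U i ∩ K).Nonempty}.Finite) :
    ∃ T : ι → C₀(M, ℝ) →L[ℝ] C₀(M, ℝ), (∀ i, InducesC0 (Q i) (T i)) ∧
      (p ≠ ⊤ →
        ∃ P : ι → Lp ℝ p ν →L[ℝ] Lp ℝ p ν,
          (∀ i, InducesLp (Q i) (P i)) ∧ IsSmoothDecompositionLp d U T P ∧
          BoundsLp P (2 ^ (p.toReal⁻¹ - 1)) (2 ^ p.toReal⁻¹ * awwConst p) ∧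
          BoundsLp P 3⁻¹ 3 ∧ (p = 2 → ∀ i, IsSymmetricL2 (P i))) ∧
      (p = ⊤ → IsSmoothDecompositionC0 d U T ∧ BoundsC0 T 2⁻¹ (awwConst p) ∧
        BoundsC0 T 3⁻¹ 3) := by
  obtain ⟨S, hS⟩ := exists_isPartition hm hδ hϑ E hlt hle hsum
  rw [← funext hQ, ← funext hU] at hS
  choose T hT hTloc using fun i ↦ exists_inducesC0_diff (E₁ := E (lo i)) (E₂ := E (hi i)) hδ
    (hϑ _ _ (hlt i)) hm hc
  simp only [← hQ] at hT
  simp only [← hU] at hTloc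
  have hfam : IsLocalizedFamily d U T := by
    refine ⟨fun i ↦ ?_, fun i ↦ ?_, ?_, fun K hK ↦ (hlf K hK).subset fun i hi ↦ hi.1, hTloc⟩
    · rw [hU]
      exact isOpen_Ioo.preimage hm
    · rw [hU]
      exact (hc _).of_isClosed_subset isClosed_closure
        (closure_minimal (preimage_mono fun t ht ↦ ht.2.le) (isClosed_Iic.preimage hm))
    -- At a point outside all bands every term vanishes, which contradicts the sum formula for the
    -- constant function one.
    · refine eq_univ_of_forall fun y ↦ ?_
      by_contra hy
      have h1 := hS.sum_eq 1 y
      rw [Finset.sum_eq_zero fun i _ ↦ hS.apply_eq_zero 1 fun h' ↦ hy (mem_iUnion.2 ⟨i, h'⟩)] at h1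
      exact zero_ne_one h1
  refine ⟨T, hT, fun hp ↦ ?_, fun hp ↦ ?_⟩
  · have hex : ∀ i, ∃ P : Lp ℝ p ν →L[ℝ] Lp ℝ p ν, InducesLp (Q i) P := fun i ↦ by
      obtain ⟨P, hP, -⟩ := (isFolding_diff (E₁ := E (lo i)) (E₂ := E (hi i))
        (hϑ _ _ (hlt i))).exists_inducesLp (p := p)
      rw [← diff_eq_fold (hϑ _ _ (hlt i)), ← hQ] at hP
      exact ⟨P, hP⟩
    choose P hP using hex
    have hb := hS.boundsLp hP hp
    have hb3 := hb.mono (inv_three_le_two_rpow hp) (two_rpow_mul_awwConst_le hp)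
    refine ⟨P, hP, ⟨hfam, fun i f hf ↦ ?_, hS.isIdempotentElem hP,
      fun i j hij ↦ hS.comp_eq_zero_Lp hP hij, hS.hasSum hP hp, ?_⟩, hb, hb3,
      fun hp2 ↦ hS.isSymmetricL2 hP hp2⟩
    · rw [hT i f]
      exact hP i f hf
    · by_cases hp2 : p = 2
      · exact ⟨1, one_pos, fun _ ↦ rfl, hS.boundsLp_one hP hp2⟩
      · exact ⟨3, by norm_num, fun h ↦ absurd h hp2, hb3⟩
  · subst hp
    rw [ENNReal.toReal_top, inv_zero] at hS
    have hb := hS.boundsC0 hT hlf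
    have hb3 : BoundsC0 T 3⁻¹ 3 := hb.mono (by norm_num) (by
      have h2 := awwConst_le_schur (p := ⊤)
      have h3 : √2 ≤ 2 := by rw [Real.sqrt_le_left (by norm_num)]; norm_num
      linarith)
    exact ⟨⟨hfam, fun i ↦ (hT i).comp_eq (hT i) (hT i) (hS.comp_self i),
      fun i j hij ↦ (hT i).comp_eq (hT j) (D := 0) (fun _ ↦ rfl) (hS.comp_eq_zero i j hij),
      hS.hasSum_C0 hT hlf, 3, by norm_num, hb3⟩, hb, hb3⟩

end Decomposition

end Cut

/-! ### The cut of a regular window -/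

lemma tsupport_mono_of_imp {X α β : Type*} [TopologicalSpace X] [Zero α] [Zero β] {f : X → α}
    {g : X → β} (h : ∀ y, g y = 0 → f y = 0) : tsupport f ⊆ tsupport g :=
  closure_mono fun y hy h0 ↦ hy (h y h0)

section WindowCut

variable {d : ℕ} {M : Type*} [TopologicalSpace M] [T2Space M]
  [ChartedSpace (EuclideanSpace ℝ (Fin d)) M]
  [IsManifold (𝓡 d) ∞ M] [RiemannianBundle (fun x : M ↦ TangentSpace (𝓡 d) x)]
  [IsContMDiffRiemannianBundle (𝓡 d) ∞ (EuclideanSpace ℝ (Fin d))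
    (fun x : M ↦ TangentSpace (𝓡 d) x)]

namespace IsWindowFlow

variable {m : M → ℝ} {ϑ δ η : ℝ} {θ : ℝ → M → M} {s : ℝ → ℝ}

open Classical in
/-- The reflection of the window, extended by the identity. -/
def reflection (m : M → ℝ) (ϑ δ : ℝ) (θ : ℝ → M → M) (y : M) : M :=
  if m y ∈ Ioo (ϑ - δ) (ϑ + δ) then flowReflection m ϑ θ y else y

open Classical in
/-- The Jacobian of the reflection, extended by one. -/
def weight (d : ℕ) {M : Type*} [TopologicalSpace M]
    [ChartedSpace (EuclideanSpace ℝ (Fin d)) M] [IsManifold (𝓡 d) ∞ M]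
    [RiemannianBundle (fun x : M ↦ TangentSpace (𝓡 d) x)]
    (m : M → ℝ) (ϑ δ : ℝ) (θ : ℝ → M → M) (y : M) : ℝ :=
  if m y ∈ Ioo (ϑ - δ) (ϑ + δ) then jacobian d (flowReflection m ϑ θ) y else 1

lemma reflection_of_mem {y : M} (hy : m y ∈ Ioo (ϑ - δ) (ϑ + δ)) :
    reflection m ϑ δ θ y = flowReflection m ϑ θ y := if_pos hy

lemma reflection_of_notMem {y : M} (hy : m y ∉ Ioo (ϑ - δ) (ϑ + δ)) :
    reflection m ϑ δ θ y = y := if_neg hy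

lemma weight_of_mem {y : M} (hy : m y ∈ Ioo (ϑ - δ) (ϑ + δ)) :
    weight d m ϑ δ θ y = jacobian d (flowReflection m ϑ θ) y := if_pos hy

lemma weight_of_notMem {y : M} (hy : m y ∉ Ioo (ϑ - δ) (ϑ + δ)) :
    weight d m ϑ δ θ y = 1 := if_neg hy

lemma weight_pos (hms : ContMDiff (𝓡 d) 𝓘(ℝ, ℝ) ∞ m) (hδ : 0 < δ)
    (hθ : IsWindowFlow (d := d) m ϑ δ η θ) (y : M) : 0 < weight d m ϑ δ θ y := by
  by_cases hy : m y ∈ Ioo (ϑ - δ) (ϑ + δ)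
  · rw [weight_of_mem hy]
    exact hθ.jacobian_pos hms hδ hy
  · rw [weight_of_notMem hy]
    exact one_pos

lemma contMDiffAt_weight (hms : ContMDiff (𝓡 d) 𝓘(ℝ, ℝ) ∞ m) (hδ : 0 < δ)
    (hθ : IsWindowFlow (d := d) m ϑ δ η θ) {y : M} (hy : m y ∈ Ioo (ϑ - δ) (ϑ + δ)) :
    ContMDiffAt (𝓡 d) 𝓘(ℝ, ℝ) ∞ (weight d m ϑ δ θ) y := by
  refine (contMDiffAt_jacobian (hθ.contMDiff_flowReflection hms)
    (hθ.jacobian_pos hms hδ hy)).congr_of_eventuallyEq ?_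
  filter_upwards [(isOpen_Ioo.preimage hms.continuous).mem_nhds hy] with z hz
  exact weight_of_mem hz

variable [SecondCountableTopology M] [MeasurableSpace M] [BorelSpace M]

/-- The reflection and its weight are extended by the identity and by one, so the change of
variables is needed only on the open window. Off it the profile is 0 or 1, and the operator is a
multiplication by that value. -/
lemma isFolding (hms : ContMDiff (𝓡 d) 𝓘(ℝ, ℝ) ∞ m) (hδ : 0 < δ)
    (hθ : IsWindowFlow (d := d) m ϑ δ η θ) (hs : IsProfile s δ) :
    IsFolding (riemannianVolume d M) (fun y ↦ s (m y - ϑ) ^ 2)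
      (fun y ↦ s (m y - ϑ) * s (ϑ - m y)) (weight d m ϑ δ θ) (reflection m ϑ δ θ) := by
  classical
  have hmc := hms.continuous
  have hsc := hs.smooth.continuous
  have hV : IsOpen (m ⁻¹' Ioo (ϑ - δ) (ϑ + δ)) := isOpen_Ioo.preimage hmc
  have hR := hθ.contMDiff_flowReflection hms
  have hRm : Measurable (reflection m ϑ δ θ) :=
    Measurable.ite hV.measurableSet hR.continuous.measurable measurable_id
  have hwc : ContinuousOn (jacobian d (flowReflection m ϑ θ)) (m ⁻¹' Ioo (ϑ - δ) (ϑ + δ)) :=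
    fun y hy ↦ (contMDiffAt_jacobian hR
      (hθ.jacobian_pos hms hδ hy)).continuousAt.continuousWithinAt
  have hw : (m ⁻¹' Ioo (ϑ - δ) (ϑ + δ)).piecewise (jacobian d (flowReflection m ϑ θ)) 1 =
      weight d m ϑ δ θ := by
    funext y
    by_cases hy : y ∈ m ⁻¹' Ioo (ϑ - δ) (ϑ + δ)
    · rw [piecewise_eq_of_mem _ _ _ hy, weight_of_mem hy]
    · rw [piecewise_eq_of_notMem _ _ _ hy, weight_of_notMem hy, Pi.one_apply]
  refine ⟨by fun_prop, by fun_prop,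
    hw ▸ hwc.measurable_piecewise continuousOn_const hV.measurableSet,
    IsFolding.measurePreserving_of_lintegral hRm fun g hg ↦ ?_, fun y ↦ ?_,
    hθ.weight_pos hms hδ, fun y ↦ ?_, fun y ↦ ?_⟩
  · rw [← lintegral_add_compl _ hV.measurableSet,
      ← lintegral_add_compl (fun y ↦ g y) hV.measurableSet]
    congr 1
    · rw [← setLIntegral_jacobian_comp hR hV (fun y hy ↦ hθ.flowReflection_mem hy)
        (fun y hy ↦ hθ.flowReflection_flowReflection hy) (fun y hy ↦ hθ.jacobian_pos hms hδ hy) hg]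
      refine setLIntegral_congr_fun hV.measurableSet fun y hy ↦ ?_
      simp only [weight_of_mem hy, reflection_of_mem hy]
    · refine setLIntegral_congr_fun hV.measurableSet.compl fun y hy ↦ ?_
      simp only [weight_of_notMem hy, reflection_of_notMem hy, ENNReal.ofReal_one, one_mul]
  · by_cases hy : m y ∈ Ioo (ϑ - δ) (ϑ + δ)
    · rw [reflection_of_mem hy, reflection_of_mem (hθ.flowReflection_mem hy),
        hθ.flowReflection_flowReflection hy]
    · rw [reflection_of_notMem hy, reflection_of_notMem hy]
  · by_cases hy : m y ∈ Ioo (ϑ - δ) (ϑ + δ)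
    · rw [reflection_of_mem hy, weight_of_mem hy, weight_of_mem (hθ.flowReflection_mem hy),
        hθ.jacobian_mul_jacobian hms hδ hy]
    · rw [reflection_of_notMem hy, weight_of_notMem hy, one_mul]
  · by_cases hy : m y ∈ Ioo (ϑ - δ) (ϑ + δ)
    · rw [reflection_of_mem hy, hθ.level_flowReflection hy]
      have e1 : 2 * ϑ - m y - ϑ = ϑ - m y := by ring
      have e2 : ϑ - (2 * ϑ - m y) = m y - ϑ := by ring
      have h1 := hs.sq_add_sq (m y - ϑ)
      have h2 := hs.prod_sq (m y - ϑ)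
      rw [neg_sub] at h1 h2
      rw [e1, e2]
      exact Or.inr ⟨by linarith, mul_comm _ _, h2⟩
    · rw [reflection_of_notMem hy]
      refine Or.inl ⟨rfl, ?_⟩
      by_cases h1 : ϑ - δ < m y
      · have h2 : ϑ + δ ≤ m y := by
          by_contra h2
          exact hy ⟨h1, not_le.1 h2⟩
        rw [hs.eq_zero (t := ϑ - m y) (by linarith), hs.eq_one (t := m y - ϑ) (by linarith)]
        simp
      · rw [hs.eq_zero (t := m y - ϑ) (by linarith)]
        simp

/-- The cut given by a profile on a regular window. -/
theorem exists_cut (hms : ContMDiff (𝓡 d) 𝓘(ℝ, ℝ) ∞ m) (hδ : 0 < δ)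
    (hθ : IsWindowFlow (d := d) m ϑ δ η θ) (hs : IsProfile s δ)
    (hc : ∀ b, IsCompact (m ⁻¹' Iic b)) (q : ℝ) :
    ∃ E : Cut d (riemannianVolume d M) m δ q ϑ, E.a = (fun y ↦ s (m y - ϑ) ^ 2) ∧
      E.b = (fun y ↦ s (m y - ϑ) * s (ϑ - m y)) ∧ E.w = weight d m ϑ δ θ ∧
      E.R = reflection m ϑ δ θ := by
  have hmc := hms.continuous
  have hsc := hs.smooth.continuous
  have hV : IsOpen (m ⁻¹' Ioo (ϑ - δ) (ϑ + δ)) := isOpen_Ioo.preimage hmc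
  have hR := hθ.contMDiff_flowReflection hms
  have hF := hθ.isFolding hms hδ hs
  have hsub : ContMDiff (𝓡 d) 𝓘(ℝ, ℝ) ∞ fun y ↦ s (m y - ϑ) :=
    hs.smooth.contMDiff.comp (hms.sub contMDiff_const)
  have hsub' : ContMDiff (𝓡 d) 𝓘(ℝ, ℝ) ∞ fun y ↦ s (ϑ - m y) :=
    hs.smooth.contMDiff.comp (contMDiff_const.sub hms)
  have hts : tsupport (fun y ↦ s (m y - ϑ)) ⊆ {y | m y - ϑ ∈ tsupport s} :=
    closure_minimal (fun y hy ↦ subset_tsupport s hy)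
      ((isClosed_tsupport s).preimage (by fun_prop : Continuous fun y ↦ m y - ϑ))
  have hts' : tsupport (fun y ↦ s (ϑ - m y)) ⊆ {y | ϑ - m y ∈ tsupport s} :=
    closure_minimal (fun y hy ↦ subset_tsupport s hy)
      ((isClosed_tsupport s).preimage (by fun_prop : Continuous fun y ↦ ϑ - m y))
  have hlow : tsupport (fun y ↦ s (m y - ϑ)) ⊆ m ⁻¹' Ioi (ϑ - δ) := fun y hy ↦ by
    have := hs.tsupport_subset (hts hy)
    rw [mem_Ioi] at this
    rw [mem_preimage, mem_Ioi]
    linarith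
  have hhigh : tsupport (fun y ↦ s (ϑ - m y)) ⊆ m ⁻¹' Iio (ϑ + δ) := fun y hy ↦ by
    have := hs.tsupport_subset (hts' hy)
    rw [mem_Ioi] at this
    rw [mem_preimage, mem_Iio]
    linarith
  let φ : M → ℝ := fun y ↦ s (m y - ϑ) * s (ϑ - m y) * weight d m ϑ δ θ y ^ q
  have hφ : tsupport φ ⊆ m ⁻¹' Ioo (ϑ - δ) (ϑ + δ) := fun y hy ↦
    ⟨hlow (tsupport_mono_of_imp (fun y h0 ↦ by simp only [φ, h0, zero_mul]) hy),
      hhigh (tsupport_mono_of_imp (fun y h0 ↦ by simp only [φ, h0, mul_zero, zero_mul]) hy)⟩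
  -- The extended weight may jump at the boundary of the window. Smoothness is used only on the
  -- closed support of φ, which lies inside the open window; elsewhere φ is locally zero.
  have hφs : ContMDiff (𝓡 d) 𝓘(ℝ, ℝ) ∞ φ := fun y ↦ by
    by_cases hy : y ∈ tsupport φ
    · have h1 := hθ.contMDiffAt_weight hms hδ (hφ hy)
      have h2 : ContMDiffAt (𝓡 d) 𝓘(ℝ, ℝ) ∞ (fun y ↦ weight d m ϑ δ θ y ^ q) y :=
        (Real.contDiffAt_rpow_const_of_ne (p := q)
          (hθ.weight_pos hms hδ y).ne').contMDiffAt.comp y h1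
      exact (hsub.mul hsub').contMDiffAt.mul h2
    · exact (contMDiffAt_const (c := (0 : ℝ))).congr_of_eventuallyEq
        (notMem_tsupport_iff_eventuallyEq.1 hy)
  let Φ : OpenPartialHomeomorph M M :=
    { toFun := flowReflection m ϑ θ
      invFun := flowReflection m ϑ θ
      source := m ⁻¹' Ioo (ϑ - δ) (ϑ + δ)
      target := m ⁻¹' Ioo (ϑ - δ) (ϑ + δ)
      map_source' := fun y hy ↦ hθ.flowReflection_mem hy
      map_target' := fun y hy ↦ hθ.flowReflection_mem hy
      left_inv' := fun y hy ↦ hθ.flowReflection_flowReflection hy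
      right_inv' := fun y hy ↦ hθ.flowReflection_flowReflection hy
      open_source := hV
      open_target := hV
      continuousOn_toFun := hR.continuous.continuousOn
      continuousOn_invFun := hR.continuous.continuousOn }
  let H : SimpleH d M :=
    { φ := φ
      Φ := Φ
      smooth_φ := hφs
      hasCompactSupport := (hc (ϑ + δ)).of_isClosed_subset (isClosed_tsupport _)
        fun y hy ↦ (hφ hy).2.le
      tsupport_subset := hφ
      smooth_Φ := hR.contMDiffOn
      smooth_symm := hR.contMDiffOn }
  have hoff : ∀ y, m y ∉ Ioo (ϑ - δ) (ϑ + δ) → s (m y - ϑ) * s (ϑ - m y) = 0 := fun y hy ↦ by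
    by_contra h0
    rw [mul_eq_zero, not_or] at h0
    exact hy ⟨hlow (subset_tsupport _ h0.1), hhigh (subset_tsupport _ h0.2)⟩
  refine ⟨⟨_, _, _, _, H, hF, fun y hy ↦ ⟨hoff y hy, reflection_of_notMem hy, weight_of_notMem hy⟩,
    hsub.pow 2, ?_, ?_, subset_rfl, subset_rfl, fun f y ↦ ?_⟩, rfl, rfl, rfl, rfl⟩
  · exact (tsupport_mono_of_imp fun y h0 ↦ by rw [h0, sq, zero_mul]).trans hlow
  · refine (tsupport_mono_of_imp fun y h0 ↦ ?_).trans hhigh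
    have h1 := hs.sq_add_sq (m y - ϑ)
    rw [neg_sub, h0] at h1
    linarith
  · by_cases hy : m y ∈ Ioo (ϑ - δ) (ϑ + δ)
    · rw [H.act_of_mem f hy, reflection_of_mem hy]
      rfl
    · rw [H.act_of_notMem f fun h ↦ hy (hφ h), hoff y hy]
      ring

/-- Values in a regular window are attained, so the preimage of a nonempty open set of levels is
nonempty and has positive measure. Compactness of sublevel sets makes it finite. -/
lemma spreads (hm : Continuous m) (hδ : 0 < δ) (hθ : IsWindowFlow (d := d) m ϑ δ η θ)
    (hs : IsProfile s δ) (hreg : IsRegularWindow d m ϑ δ) (hc : ∀ b, IsCompact (m ⁻¹' Iic b)) :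
    Spreads (riemannianVolume d M) (fun y ↦ s (m y - ϑ) ^ 2)
      (fun y ↦ s (m y - ϑ) * s (ϑ - m y)) (reflection m ϑ δ θ) := by
  intro ξ hξ
  obtain ⟨β, hβ, H⟩ := hs.exists_window hδ (Or.inl rfl) ϑ ξ hξ
  refine ⟨β, hβ, fun O hO ↦ ?_⟩
  obtain ⟨N, hN, ⟨t, ht⟩, hsub, hNO⟩ := H O hO
  obtain ⟨⟨x, hx⟩, -⟩ := hreg t (Ioo_subset_Icc_self (hsub ht))
  refine ⟨m ⁻¹' N, (hN.preimage hm).measurableSet,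
    (hN.preimage hm).measure_pos _ ⟨x, by rwa [mem_preimage, hx]⟩,
    (measure_mono (t := m ⁻¹' Iic (ϑ + δ)) fun y hy ↦ (hsub hy).2.le).trans_lt (hc (ϑ + δ)).measure_lt_top, fun y hy ↦ ?_⟩
  obtain ⟨h1, h2⟩ := hNO _ hy
  rw [one_mul] at h2
  rw [reflection_of_mem (hsub hy), mem_preimage, hθ.level_flowReflection (hsub hy)]
  exact ⟨h1, h2⟩

end IsWindowFlow

variable [SecondCountableTopology M] [MeasurableSpace M] [BorelSpace M]

lemma IsMorseExhaustion.isCompact_preimage_Iic {m : M → ℝ} (hm : IsMorseExhaustion d m) (b : ℝ) :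
    IsCompact (m ⁻¹' Iic b) := by
  have : m ⁻¹' Iic b = m ⁻¹' Icc 0 b := by
    ext y
    exact ⟨fun h ↦ ⟨hm.nonneg y, h⟩, fun h ↦ h.2⟩
  rw [this]
  exact hm.isCompact_preimage b

theorem exists_cut_awwOp {m : M → ℝ} (hm : IsMorseExhaustion d m) {ϑ δ : ℝ} (hδ : 0 < δ)
    (hreg : IsRegularWindow d m ϑ δ) {s : ℝ → ℝ} (hs : IsProfile s δ) (p : ℝ≥0∞) :
    ∃ E : Cut d (riemannianVolume d M) m δ p.toReal⁻¹ ϑ, E.op = awwOp d p m δ s ϑ ∧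
      Spreads (riemannianVolume d M) E.a E.b E.R := by
  have hms := hm.isMorse.smooth
  obtain ⟨η, θ, hθ⟩ := exists_isWindowFlow hm hδ hreg
  obtain ⟨E, ha, hb, hw, hR⟩ := hθ.exists_cut hms hδ hs hm.isCompact_preimage_Iic p.toReal⁻¹
  refine ⟨E, ?_, ?_⟩
  · funext f y
    by_cases h1 : ϑ + δ ≤ m y
    · rw [E.op_top f h1, awwOp, if_pos h1]
    by_cases h2 : m y ≤ ϑ - δ
    · rw [E.op_bot f h2, awwOp, if_neg h1, if_pos h2]
    have hy : m y ∈ Ioo (ϑ - δ) (ϑ + δ) := ⟨not_le.1 h2, not_le.1 h1⟩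
    rw [hθ.awwOp_eq hms hδ p s f hy, Cut.op, fold, ha, hb, hw, hR,
      IsWindowFlow.weight_of_mem hy, IsWindowFlow.reflection_of_mem hy]
  · rw [ha, hb, hR]
    exact hθ.spreads hms.continuous hδ hs hreg hm.isCompact_preimage_Iic

end WindowCut

/-! ### Latitudinal projections and decompositions -/

section Main

variable {d : ℕ} {M : Type*} [TopologicalSpace M] [T2Space M] [SecondCountableTopology M]
  [ChartedSpace (EuclideanSpace ℝ (Fin d)) M]
  [IsManifold (𝓡 d) ∞ M] [RiemannianBundle (fun x : M ↦ TangentSpace (𝓡 d) x)]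
  [IsContMDiffRiemannianBundle (𝓡 d) ∞ (EuclideanSpace ℝ (Fin d))
    (fun x : M ↦ TangentSpace (𝓡 d) x)]
  [MeasurableSpace M] [BorelSpace M] {m : M → ℝ} {δ ϑ : ℝ} {s : ℝ → ℝ}

/-- The value ϑ - δ is attained and m is nonnegative. Hence the convention E_0 = I never competes
with a regular window. -/
lemma IsRegularWindow.pos (hreg : IsRegularWindow d m ϑ δ) (hm : IsMorseExhaustion d m)
    (hδ : 0 < δ) : 0 < ϑ := by
  obtain ⟨⟨x, hx⟩, -⟩ := hreg (ϑ - δ) ⟨le_rfl, by linarith⟩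
  linarith [hm.nonneg x]

/-- The convention E_0 = I is the constant cut 1, which is admissible because m ≥ 0 > -δ. -/
theorem exists_cut_cutOp (hm : IsMorseExhaustion d m) (hδ : 0 < δ)
    (hϑ : ϑ = 0 ∨ IsRegularWindow d m ϑ δ) (hs : IsProfile s δ) (p : ℝ≥0∞) :
    ∃ E : Cut d (riemannianVolume d M) m δ p.toReal⁻¹ ϑ, E.op = cutOp d p m δ s ϑ ∧
      (IsRegularWindow d m ϑ δ → Spreads (riemannianVolume d M) E.a E.b E.R) := by
  by_cases h0 : ϑ = 0
  · refine ⟨Cut.const 1 (Or.inr rfl) (fun _ y ↦ by linarith [hm.nonneg y]) fun h ↦ absurd rfl h, ?_,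
      fun hreg ↦ absurd h0 (hreg.pos hm hδ).ne'⟩
    funext f y
    rw [Cut.op_const, cutOp, if_pos h0, one_mul]
  · obtain ⟨E, hE, hsp⟩ := exists_cut_awwOp hm hδ (hϑ.resolve_left h0) hs p
    refine ⟨E, ?_, fun _ ↦ hsp⟩
    funext f
    rw [hE, cutOp, if_neg h0]

/-- The convention E_1 = 0 is the constant cut 0, which is admissible because m ≤ 1 < 1 + δ. -/
theorem exists_cut_cutOpCompact (hm : IsMorseExhaustion d m) (hrange : range m = Icc 0 1)
    (hδ : 0 < δ) (hϑ : ϑ = 0 ∨ ϑ = 1 ∨ IsRegularWindow d m ϑ δ) (hs : IsProfile s δ) (p : ℝ≥0∞) :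
    ∃ E : Cut d (riemannianVolume d M) m δ p.toReal⁻¹ ϑ, E.op = cutOpCompact d p m δ s ϑ := by
  by_cases h1 : ϑ = 1
  · refine ⟨Cut.const 0 (Or.inl rfl) (fun h ↦ absurd rfl h) fun _ y ↦ ?_, ?_⟩
    · have : m y ∈ Icc (0 : ℝ) 1 := hrange ▸ mem_range_self y
      linarith [this.2]
    · funext f y
      rw [Cut.op_const, cutOpCompact, if_pos h1, zero_mul]
      rfl
  · obtain ⟨E, hE, -⟩ := exists_cut_cutOp hm hδ (by tauto) hs p
    refine ⟨E, ?_⟩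
    funext f
    rw [hE, cutOpCompact, if_neg h1]

theorem latitudinal_projection (hm : IsMorseExhaustion d m) (p : ℝ≥0∞) [Fact (1 ≤ p)]
    (hδ : 0 < δ) {ϑ₁ ϑ₂ : ℝ} {s₁ s₂ : ℝ → ℝ} (hs₁ : IsProfile s₁ δ) (hs₂ : IsProfile s₂ δ)
    (h₁ : ϑ₁ = 0 ∨ IsRegularWindow d m ϑ₁ δ) (h₂ : IsRegularWindow d m ϑ₂ δ)
    (h : ϑ₁ + δ < ϑ₂ - δ) {E₁ E₂ Q : (M → ℝ) → M → ℝ} (hE₁ : E₁ = cutOp d p m δ s₁ ϑ₁)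
    (hE₂ : E₂ = cutOp d p m δ s₂ ϑ₂) (hQ : Q = fun f ↦ E₁ f - E₂ f) :
    (∀ f, E₂ (E₁ f) = E₂ f ∧ E₁ (E₂ f) = E₂ f) ∧
    (∀ f x,
      (m x ≤ ϑ₁ - δ ∨ ϑ₂ + δ ≤ m x → Q f x = 0) ∧
      (m x ∈ Ioo (ϑ₁ - δ) (ϑ₁ + δ) → Q f x = E₁ f x) ∧
      (m x ∈ Icc (ϑ₁ + δ) (ϑ₂ - δ) → Q f x = f x) ∧
      (m x ∈ Ioo (ϑ₂ - δ) (ϑ₂ + δ) → Q f x = f x - E₂ f x)) ∧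
    (∃ T : C₀(M, ℝ) →L[ℝ] C₀(M, ℝ), InducesC0 Q T ∧
      IsLocalizedHOperator d T (m ⁻¹' Ioo (ϑ₁ - δ) (ϑ₂ + δ)) ∧
      (p = ⊤ → IsIdempotentElem T ∧ ‖T‖ = awwConst p ∧ AWWLineNormC0 ‖T‖)) ∧
    ∃ P : Lp ℝ p (riemannianVolume d M) →L[ℝ] Lp ℝ p (riemannianVolume d M),
      InducesLp Q P ∧ IsIdempotentElem P ∧ ‖P‖ = awwConst p ∧ AWWLineNormLp p ‖P‖ ∧
      (p = 2 → IsSymmetricL2 P) := by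
  obtain ⟨C₁, hC₁, -⟩ := exists_cut_cutOp hm hδ h₁ hs₁ p
  obtain ⟨C₂, hC₂, hsp⟩ := exists_cut_cutOp hm hδ (Or.inr h₂) hs₂ p
  replace hsp := hsp h₂
  rw [← hC₁] at hE₁
  rw [← hC₂] at hE₂
  subst hE₁ hE₂
  replace hQ : Q = Cut.diff C₁ C₂ := hQ
  subst hQ
  have hF := Cut.isFolding_diff (E₁ := C₁) (E₂ := C₂) h
  refine ⟨fun f ↦ ⟨C₁.op_comp_of_lt C₂ h f, C₁.op_comp_of_gt C₂ h f⟩,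
    fun f x ↦ ⟨fun hx ↦ Cut.diff_eq_zero h f hx hδ, fun hx ↦ ?_, fun hx ↦ ?_, fun hx ↦ ?_⟩, ?_, ?_⟩
  · rw [Cut.diff, C₂.op_bot f (by linarith [hx.2]), sub_zero]
  · rw [Cut.diff, C₁.op_top f hx.1, C₂.op_bot f hx.2, sub_zero]
  · rw [Cut.diff, C₁.op_top f (by linarith [hx.1])]
  · obtain ⟨T, hT, hTloc⟩ := Cut.exists_inducesC0_diff (E₁ := C₁) (E₂ := C₂) hδ h
      hm.isMorse.smooth.continuous hm.isCompact_preimage_Iic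
    refine ⟨T, hT, hTloc, fun hp ↦ ?_⟩
    subst hp
    have hn := Cut.norm_C0_diff (by simp) h hsp hT
    exact ⟨hT.comp_eq hT hT (Cut.diff_diff h), hn, hn ▸ awwLineNormC0⟩
  · obtain ⟨P, hP, hPn⟩ := hF.exists_inducesLp (p := p)
    have hn := le_antisymm hPn (hF.awwConst_le_norm (Cut.spreads_diff h hsp) hP)
    refine ⟨P, ?_, hF.isIdempotentElem hP, hn, hn ▸ awwLineNormLp p,
      fun hp ↦ hF.isSymmetricL2 hp hP⟩
    rw [Cut.diff_eq_fold h]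
    exact hP

theorem decomposition_noncompact (hm : IsMorseExhaustion d m) (p : ℝ≥0∞) [Fact (1 ≤ p)]
    (hδ : 0 < δ) {ϑ : ℕ → ℝ} {s : ℕ → ℝ → ℝ} (h0 : ϑ 0 = 0)
    (hϑ : ∀ i, ϑ i + δ < ϑ (i + 1) - δ) (hreg : ∀ i, 1 ≤ i → IsRegularWindow d m (ϑ i) δ)
    (hs : ∀ i, IsProfile (s i) δ) {Q : ℕ → (M → ℝ) → M → ℝ} {U : ℕ → Set M}
    (hQ : ∀ i, Q i = fun f ↦
      cutOp d p m δ (s i) (ϑ i) f - cutOp d p m δ (s (i + 1)) (ϑ (i + 1)) f)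
    (hU : ∀ i, U i = m ⁻¹' Ioo (ϑ i - δ) (ϑ (i + 1) + δ)) :
    ∃ T : ℕ → C₀(M, ℝ) →L[ℝ] C₀(M, ℝ), (∀ i, InducesC0 (Q i) (T i)) ∧
      (p ≠ ⊤ →
        ∃ P : ℕ → Lp ℝ p (riemannianVolume d M) →L[ℝ] Lp ℝ p (riemannianVolume d M),
          (∀ i, InducesLp (Q i) (P i)) ∧ IsSmoothDecompositionLp d U T P ∧
          BoundsLp P (2 ^ (p.toReal⁻¹ - 1)) (2 ^ p.toReal⁻¹ * awwConst p) ∧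
          BoundsLp P 3⁻¹ 3 ∧ (p = 2 → ∀ i, IsSymmetricL2 (P i))) ∧
      (p = ⊤ → IsSmoothDecompositionC0 d U T ∧ BoundsC0 T 2⁻¹ (awwConst p) ∧
        BoundsC0 T 3⁻¹ 3) := by
  have hmono : StrictMono ϑ := strictMono_nat_of_lt_succ fun i ↦ by linarith [hϑ i]
  have hlt : ∀ k l, k < l → ϑ k + δ < ϑ l - δ := fun k l hkl ↦ by
    linarith [hϑ k, hmono.monotone (Nat.succ_le_of_lt hkl)]
  -- Consecutive levels differ by more than 2δ, so they tend to infinity; this crude bound is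
  -- enough.
  have hgrow : ∀ n : ℕ, n * δ ≤ ϑ n := fun n ↦ by
    induction n with
    | zero => rw [h0]; simp
    | succ n ih =>
      push_cast
      linarith [hϑ n]
  have hlarge : ∀ b, ∃ N, b ≤ ϑ N - δ := fun b ↦ by
    obtain ⟨N, hN⟩ := exists_nat_ge ((b + δ) / δ)
    rw [div_le_iff₀ hδ] at hN
    exact ⟨N, by linarith [hgrow N]⟩
  choose E hE _ using fun i ↦ exists_cut_cutOp hm hδ (ϑ := ϑ i) (s := s i)
    (by
      rcases Nat.eq_zero_or_pos i with h | h
      · exact Or.inl (by rw [h, h0])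
      · exact Or.inr (hreg i h)) (hs i) p
  have hlt' : ∀ {N i : ℕ} {b : ℝ}, b ≤ ϑ N - δ → ϑ i - δ < b → i < N := fun h1 h2 ↦
    hmono.lt_iff_lt.1 (by linarith)
  refine Cut.exists_decomposition hm.isMorse.smooth.continuous hδ hm.isCompact_preimage_Iic hlt E
    (lo := fun i ↦ i) (hi := fun i ↦ i + 1) (fun i ↦ Nat.lt_succ_self i)
    (fun i j hij ↦ Nat.succ_le_of_lt hij) (fun y ↦ ?_) (fun i ↦ ?_) hU fun K hK ↦ ?_
  -- Once level N exceeds m y by δ, E_N f vanishes at y and no later band contains y, so the first N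
  -- terms telescope to E_0 f(y) = f(y).
  · obtain ⟨N, hN⟩ := hlarge (m y)
    refine ⟨Finset.range N, fun i hi ↦ Finset.mem_range.2 (hlt' hN hi.1), fun f ↦ ?_⟩
    have h1 : cutOp d p m δ (s 0) (ϑ 0) f y = f y := by rw [cutOp, if_pos h0]
    simp only [Cut.diff]
    rw [Finset.sum_range_sub' (fun i ↦ (E i).op f y), (E N).op_bot f hN, hE 0, h1, sub_zero]
  · rw [hQ, ← hE, ← hE]
    rfl
  · obtain ⟨b, hb⟩ := hK.bddAbove_image hm.isMorse.smooth.continuous.continuousOn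
    obtain ⟨N, hN⟩ := hlarge b
    refine (finite_lt_nat N).subset fun i ⟨y, hy, hyK⟩ ↦ ?_
    rw [hU] at hy
    exact hlt' hN (hy.1.trans_le (hb (mem_image_of_mem m hyK)))

theorem decomposition_compact (hm : IsMorseExhaustion d m) (hrange : range m = Icc 0 1)
    (p : ℝ≥0∞) [Fact (1 ≤ p)] (hδ : 0 < δ) {n : ℕ} {ϑ : Fin (n + 1) → ℝ} {s : Fin (n + 1) → ℝ → ℝ}
    (h0 : ϑ 0 = 0) (h1 : ϑ (Fin.last n) = 1)
    (hϑ : ∀ i : Fin n, ϑ i.castSucc + δ < ϑ i.succ - δ)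
    (hreg : ∀ i, i ≠ 0 → i ≠ Fin.last n → IsRegularWindow d m (ϑ i) δ)
    (hs : ∀ i, IsProfile (s i) δ) {Q : Fin n → (M → ℝ) → M → ℝ} {U : Fin n → Set M}
    (hQ : ∀ i, Q i = fun f ↦ cutOpCompact d p m δ (s i.castSucc) (ϑ i.castSucc) f -
      cutOpCompact d p m δ (s i.succ) (ϑ i.succ) f)
    (hU : ∀ i, U i = m ⁻¹' Ioo (ϑ i.castSucc - δ) (ϑ i.succ + δ)) :
    ∃ T : Fin n → C₀(M, ℝ) →L[ℝ] C₀(M, ℝ), (∀ i, InducesC0 (Q i) (T i)) ∧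
      (p ≠ ⊤ →
        ∃ P : Fin n → Lp ℝ p (riemannianVolume d M) →L[ℝ] Lp ℝ p (riemannianVolume d M),
          (∀ i, InducesLp (Q i) (P i)) ∧ IsSmoothDecompositionLp d U T P ∧
          BoundsLp P (2 ^ (p.toReal⁻¹ - 1)) (2 ^ p.toReal⁻¹ * awwConst p) ∧
          BoundsLp P 3⁻¹ 3 ∧ (p = 2 → ∀ i, IsSymmetricL2 (P i))) ∧
      (p = ⊤ → IsSmoothDecompositionC0 d U T ∧ BoundsC0 T 2⁻¹ (awwConst p) ∧
        BoundsC0 T 3⁻¹ 3) := by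
  have hmono : StrictMono ϑ := Fin.strictMono_iff_lt_succ.2 fun i ↦ by linarith [hϑ i]
  have hlt : ∀ k l, k < l → ϑ k + δ < ϑ l - δ := fun k l hkl ↦ by
    obtain ⟨i, rfl⟩ := Fin.eq_castSucc_of_ne_last (hkl.trans_le (Fin.le_last l)).ne
    linarith [hϑ i, hmono.monotone (Fin.castSucc_lt_iff_succ_le.1 hkl)]
  choose E hE using fun i ↦ exists_cut_cutOpCompact hm hrange hδ (ϑ := ϑ i) (s := s i)
    (by
      by_cases hi0 : i = 0
      · exact Or.inl (by rw [hi0, h0])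
      by_cases hi1 : i = Fin.last n
      · exact Or.inr (Or.inl (by rw [hi1, h1]))
      · exact Or.inr (Or.inr (hreg i hi0 hi1))) (hs i) p
  refine Cut.exists_decomposition hm.isMorse.smooth.continuous hδ hm.isCompact_preimage_Iic hlt E
    (lo := Fin.castSucc) (hi := Fin.succ) (fun i ↦ Fin.castSucc_lt_succ)
    (fun i j hij ↦ Fin.le_def.2 (Nat.succ_le_of_lt (Fin.lt_def.1 hij))) (fun y ↦ ?_) (fun i ↦ ?_) hU
    fun K _ ↦ toFinite _
  · refine ⟨Finset.univ, fun i _ ↦ Finset.mem_univ i, fun f ↦ ?_⟩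
    have e0 : (E 0).op f y = f y := by
      rw [hE, cutOpCompact, if_neg (by rw [h0]; norm_num), cutOp, if_pos h0]
    have e1 : (E (Fin.last n)).op f y = 0 := by
      rw [hE, cutOpCompact, if_pos h1]
      rfl
    -- Telescoping: the sum over all n + 1 cuts is split off once at its first and once at its last
    -- term, where the cuts are I and 0.
    have h2 := Fin.sum_univ_succ fun k ↦ (E k).op f y
    rw [Fin.sum_univ_castSucc, e0, e1] at h2
    simp only [Cut.diff, Finset.sum_sub_distrib]
    linarith
  · rw [hQ, ← hE, ← hE]
    rfl

end Main

end Latitudinal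

end

theorem mainTheorem6 {d : ℕ} {M : Type*} [TopologicalSpace M] [T2Space M]
    [SecondCountableTopology M] [ConnectedSpace M]
    [ChartedSpace (EuclideanSpace ℝ (Fin d)) M] [IsManifold (𝓡 d) ∞ M]
    [RiemannianBundle (fun x : M ↦ TangentSpace (𝓡 d) x)]
    [IsContMDiffRiemannianBundle (𝓡 d) ∞ (EuclideanSpace ℝ (Fin d))
      (fun x : M ↦ TangentSpace (𝓡 d) x)]
    [MeasurableSpace M] [BorelSpace M]
    (m : M → ℝ) (hm : IsMorseExhaustion d m) (p : ℝ≥0∞) [Fact (1 ≤ p)]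
    (δ : ℝ) (hδ : 0 < δ) :
    -- latitudinal projections
    (range m = Ici 0 ∨ range m = Icc 0 1 →
      ∀ (ϑ₁ ϑ₂ : ℝ) (s₁ s₂ : ℝ → ℝ), IsProfile s₁ δ → IsProfile s₂ δ →
        (ϑ₁ = 0 ∨ IsRegularWindow d m ϑ₁ δ) → IsRegularWindow d m ϑ₂ δ → ϑ₁ + δ < ϑ₂ - δ →
        ∀ E₁ E₂ Q : (M → ℝ) → M → ℝ, E₁ = cutOp d p m δ s₁ ϑ₁ → E₂ = cutOp d p m δ s₂ ϑ₂ →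
        Q = (fun f ↦ E₁ f - E₂ f) →
        (∀ f, E₂ (E₁ f) = E₂ f ∧ E₁ (E₂ f) = E₂ f) ∧
        (∀ f x,
          (m x ≤ ϑ₁ - δ ∨ ϑ₂ + δ ≤ m x → Q f x = 0) ∧
          (m x ∈ Ioo (ϑ₁ - δ) (ϑ₁ + δ) → Q f x = E₁ f x) ∧
          (m x ∈ Icc (ϑ₁ + δ) (ϑ₂ - δ) → Q f x = f x) ∧
          (m x ∈ Ioo (ϑ₂ - δ) (ϑ₂ + δ) → Q f x = f x - E₂ f x)) ∧
        (∃ T : C₀(M, ℝ) →L[ℝ] C₀(M, ℝ), InducesC0 Q T ∧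
          IsLocalizedHOperator d T (m ⁻¹' Ioo (ϑ₁ - δ) (ϑ₂ + δ)) ∧
          (p = ⊤ → IsIdempotentElem T ∧ ‖T‖ = awwConst p ∧ AWWLineNormC0 ‖T‖)) ∧
        ∃ P : Lp ℝ p (riemannianVolume d M) →L[ℝ] Lp ℝ p (riemannianVolume d M),
          InducesLp Q P ∧ IsIdempotentElem P ∧ ‖P‖ = awwConst p ∧ AWWLineNormLp p ‖P‖ ∧
          (p = 2 → IsSymmetricL2 P)) ∧
    -- the noncompact case
    (NoncompactSpace M → range m = Ici 0 →
      ∀ (ϑ : ℕ → ℝ) (s : ℕ → ℝ → ℝ), ϑ 0 = 0 → (∀ i, ϑ i + δ < ϑ (i + 1) - δ) →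
        (∀ i, 1 ≤ i → IsRegularWindow d m (ϑ i) δ) → (∀ i, IsProfile (s i) δ) →
        ∀ (Q : ℕ → (M → ℝ) → M → ℝ) (U : ℕ → Set M),
        (∀ i, Q i = fun f ↦
          cutOp d p m δ (s i) (ϑ i) f - cutOp d p m δ (s (i + 1)) (ϑ (i + 1)) f) →
        (∀ i, U i = m ⁻¹' Ioo (ϑ i - δ) (ϑ (i + 1) + δ)) →
        ∃ T : ℕ → C₀(M, ℝ) →L[ℝ] C₀(M, ℝ), (∀ i, InducesC0 (Q i) (T i)) ∧
          (p ≠ ⊤ →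
            ∃ P : ℕ → Lp ℝ p (riemannianVolume d M) →L[ℝ] Lp ℝ p (riemannianVolume d M),
              (∀ i, InducesLp (Q i) (P i)) ∧ IsSmoothDecompositionLp d U T P ∧
              BoundsLp P (2 ^ (p.toReal⁻¹ - 1)) (2 ^ p.toReal⁻¹ * awwConst p) ∧
              (p = 2 → ∀ i, IsSymmetricL2 (P i))) ∧
          (p = ⊤ → IsSmoothDecompositionC0 d U T ∧ BoundsC0 T 2⁻¹ (awwConst p))) ∧
    -- the compact case
    (CompactSpace M → range m = Icc 0 1 →
      ∀ (n : ℕ) (ϑ : Fin (n + 1) → ℝ) (s : Fin (n + 1) → ℝ → ℝ), ϑ 0 = 0 → ϑ (Fin.last n) = 1 →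
        (∀ i : Fin n, ϑ i.castSucc + δ < ϑ i.succ - δ) →
        (∀ i, i ≠ 0 → i ≠ Fin.last n → IsRegularWindow d m (ϑ i) δ) → (∀ i, IsProfile (s i) δ) →
        ∀ (Q : Fin n → (M → ℝ) → M → ℝ) (U : Fin n → Set M),
        (∀ i, Q i = fun f ↦ cutOpCompact d p m δ (s i.castSucc) (ϑ i.castSucc) f -
          cutOpCompact d p m δ (s i.succ) (ϑ i.succ) f) →
        (∀ i, U i = m ⁻¹' Ioo (ϑ i.castSucc - δ) (ϑ i.succ + δ)) →
        ∃ T : Fin n → C₀(M, ℝ) →L[ℝ] C₀(M, ℝ), (∀ i, InducesC0 (Q i) (T i)) ∧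
          (p ≠ ⊤ →
            ∃ P : Fin n → Lp ℝ p (riemannianVolume d M) →L[ℝ] Lp ℝ p (riemannianVolume d M),
              (∀ i, InducesLp (Q i) (P i)) ∧ IsSmoothDecompositionLp d U T P ∧
              BoundsLp P (2 ^ (p.toReal⁻¹ - 1)) (2 ^ p.toReal⁻¹ * awwConst p) ∧
              BoundsLp P 3⁻¹ 3 ∧
              (p = 2 → ∀ i, IsSymmetricL2 (P i))) ∧
          (p = ⊤ → IsSmoothDecompositionC0 d U T ∧ BoundsC0 T 2⁻¹ (awwConst p) ∧
            BoundsC0 T 3⁻¹ 3)) := by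
  refine ⟨fun _ ϑ₁ ϑ₂ s₁ s₂ hs₁ hs₂ h₁ h₂ h E₁ E₂ Q hE₁ hE₂ hQ ↦
    latitudinal_projection hm p hδ hs₁ hs₂ h₁ h₂ h hE₁ hE₂ hQ,
    fun _ _ ϑ s h0 hϑ hreg hs Q U hQ hU ↦ ?_,
    fun _ hrange n ϑ s h0 h1 hϑ hreg hs Q U hQ hU ↦
      decomposition_compact hm hrange p hδ h0 h1 hϑ hreg hs hQ hU⟩
  obtain ⟨T, hT, hLp, hC0⟩ := decomposition_noncompact hm p hδ h0 hϑ hreg hs hQ hU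
  refine ⟨T, hT, fun hp ↦ ?_, fun hp ↦ ⟨(hC0 hp).1, (hC0 hp).2.1⟩⟩
  obtain ⟨P, hP, hdec, hb, -, hsym⟩ := hLp hp
  exact ⟨P, hP, hdec, hb, hsym⟩
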